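/- Let $T_L,T_R,D_L,D_R,a_L,a_R\in\mathbb R$ and consider the planar piecewise linear system (Liénard canonical form) $$\begin{cases}\dot x=T_Lx-y\\ \dot y=D_Lx-a_L\end{cases}\ \text{for }x<0,\qquad \begin{cases}\dot x=T_Rx-y\\ \dot y=D_Rx-a_R\end{cases}\ \text{for }x>0,$$ with Filippov's convention on the switching line $\Sigma=\{x=0\}$. Put $\xi=a_RT_L-a_LT_R$. A limit cycle is a non-trivial closed orbit that crosses $\Sigma$, does so transversally at each of its points on $\Sigma$, and is isolated from other closed orbits. For $y_0\ge 0$ let $(0,y_L(y_0))$ be the first point of $\Sigma$ reached from $(0,y_0)$ by following the flow forward through $x<0$, and $(0,y_R(y_0))$ the first point of $\Sigma$ reached from $(0,y_0)$ by following the flow backward through $x>0$; $I_L$ and $I_R$ are the sets of those $y_0$ for which these points exist, together with $y_0=0$, with value $0$, when there are points $(y_0,y_L(y_0))$ (respectively $(y_0,y_R(y_0))$) with $y_0>0>y_L(y_0)$ (respectively $y_0>0>y_R(y_0)$) arbitrarily close to $(0,0)$. Let $\delta=y_R-y_L$ on $I_L\cap I_R$. A limit cycle through $(0,y_0^*)$,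 with $y_0^*$ in the interior of $I_L\cap I_R$ (so that $\delta(y_0^*)=0$), is hyperbolic if $\delta'(y_0^*)\neq 0$. Then the system has at most one hyperbolic limit cycle. If a hyperbolic limit cycle exists, then $\xi\ne0$; it is (orbitally) asymptotically stable if $\xi<0$, and it is unstable if $\xi>0$, that is, it is not orbitally stable and moreover it is repelling (orbitally asymptotically stable in reversed time). -/

import Mathlib

open Set Filter Topology MeasureTheory

noncomputable section

/-- Parameters of the Liénard canonical form: traces, determinants and constant terms of the left
and right linear systems. -/
structure LienardParams where
  TL : ℝ
  TR : ℝ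
  DL : ℝ
  DR : ℝ
  aL : ℝ
  aR : ℝ

namespace LienardParams

/-- `ξ = a_R T_L - a_L T_R`. -/
def xi (p : LienardParams) : ℝ := p.aR * p.TL - p.aL * p.TR

/-- The linear vector field acting for `x < 0`. -/
def leftField (p : LienardParams) (z : ℝ × ℝ) : ℝ × ℝ :=
  (p.TL * z.1 - z.2, p.DL * z.1 - p.aL)

/-- The linear vector field acting for `x > 0`. -/
def rightField (p : LienardParams) (z : ℝ × ℝ) : ℝ × ℝ :=
  (p.TR * z.1 - z.2, p.DR * z.1 - p.aR)

/-- The set-valued vector field given by Filippov's convention: on the switching line `x = 0` it is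
the convex hull of the two lateral limits of the vector field. -/
def filippov (p : LienardParams) (z : ℝ × ℝ) : Set (ℝ × ℝ) :=
  {v | (z.1 < 0 ∧ v = p.leftField z) ∨ (0 < z.1 ∧ v = p.rightField z) ∨
    (z.1 = 0 ∧ v ∈ segment ℝ (p.leftField z) (p.rightField z))}

/-- `γ` is a Filippov trajectory on the interval `J`: it is absolutely continuous on every compact
subinterval and solves the differential inclusion almost everywhere. -/
def IsTrajectoryOn (p : LienardParams) (J : Set ℝ) (γ : ℝ → ℝ × ℝ) : Prop :=
  (∀ a ∈ J, ∀ b ∈ J, AbsolutelyContinuousOnInterval γ a b) ∧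
    ∀ᵐ t ∂(volume.restrict J), ∃ v ∈ p.filippov (γ t), HasDerivAt γ v t

/-- A (non-trivial) closed orbit: the image of a non-constant periodic trajectory. -/
def IsClosedOrbit (p : LienardParams) (Γ : Set (ℝ × ℝ)) : Prop :=
  ∃ γ : ℝ → ℝ × ℝ, p.IsTrajectoryOn univ γ ∧ (∃ T : ℝ, 0 < T ∧ Function.Periodic γ T) ∧
    (∃ t, γ t ≠ γ 0) ∧ Γ = range γ

/-- The orbit meets the switching line and crosses it transversally wherever it does: on `x = 0`
both vector fields have first component `-y`, so transversality at `(0, y)` means `y ≠ 0`. -/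
def IsCrossing (Γ : Set (ℝ × ℝ)) : Prop :=
  (∃ z ∈ Γ, z.1 = 0) ∧ ∀ z ∈ Γ, z.1 = 0 → z.2 ≠ 0

/-- A limit cycle: a non-trivial closed crossing orbit which is isolated from other closed
orbits, that is, some neighbourhood of it contains no other closed orbit. -/
def IsLimitCycle (p : LienardParams) (Γ : Set (ℝ × ℝ)) : Prop :=
  p.IsClosedOrbit Γ ∧ IsCrossing Γ ∧
    ∃ U : Set (ℝ × ℝ), IsOpen U ∧ Γ ⊆ U ∧ ∀ Γ', p.IsClosedOrbit Γ' → Γ' ⊆ U → Γ' = Γ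

/-- The forward orbit from `(0, y₀)` stays in `x < 0` until it returns to `x = 0`, at `(0, y₁)`. -/
def LeftReturn (p : LienardParams) (y₀ y₁ : ℝ) : Prop :=
  ∃ (z : ℝ → ℝ × ℝ) (τ : ℝ), 0 < τ ∧ (∀ t, HasDerivAt z (p.leftField (z t)) t) ∧
    z 0 = (0, y₀) ∧ z τ = (0, y₁) ∧ ∀ t ∈ Ioo 0 τ, (z t).1 < 0

/-- The backward orbit from `(0, y₀)` stays in `x > 0` until it returns to `x = 0`, at `(0, y₁)`. -/
def RightReturn (p : LienardParams) (y₀ y₁ : ℝ) : Prop :=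
  ∃ (z : ℝ → ℝ × ℝ) (τ : ℝ), τ < 0 ∧ (∀ t, HasDerivAt z (p.rightField (z t)) t) ∧
    z 0 = (0, y₀) ∧ z τ = (0, y₁) ∧ ∀ t ∈ Ioo τ 0, 0 < (z t).1

/-- The domain in `[0, ∞)` of the half-map with return relation `R`, including the point `0` when
the half-map extends to it by the value `0`. -/
def halfMapDomain (R : ℝ → ℝ → Prop) : Set ℝ :=
  {y₀ | 0 ≤ y₀ ∧ ((∃ y₁, R y₀ y₁) ∨
    (y₀ = 0 ∧ ∀ ε > 0, ∃ u ∈ Ioo 0 ε, ∃ v ∈ Ioo (-ε) 0, R u v))}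

open Classical in
/-- The half-map with return relation `R`; the value `0` where there is no return is the extension
to `y₀ = 0` (and is meaningless outside `halfMapDomain R`). -/
def halfMap (R : ℝ → ℝ → Prop) (y₀ : ℝ) : ℝ :=
  if h : ∃ y₁, R y₀ y₁ then h.choose else 0

/-- The forward Poincaré half-map `y_L`. -/
def yL (p : LienardParams) : ℝ → ℝ := halfMap p.LeftReturn

/-- The backward Poincaré half-map `y_R`. -/
def yR (p : LienardParams) : ℝ → ℝ := halfMap p.RightReturn

/-- The displacement function `δ = y_R - y_L`. -/
def displacement (p : LienardParams) (y₀ : ℝ) : ℝ := p.yR y₀ - p.yL y₀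

/-- The domain `I = I_L ∩ I_R` of the displacement function. -/
def displacementDomain (p : LienardParams) : Set ℝ :=
  halfMapDomain p.LeftReturn ∩ halfMapDomain p.RightReturn

/-- A limit cycle is hyperbolic if the zero `y₀` of the displacement function that corresponds to
it is simple. -/
def IsHyperbolicLimitCycle (p : LienardParams) (Γ : Set (ℝ × ℝ)) : Prop :=
  p.IsLimitCycle Γ ∧ ∃ y₀ ∈ interior p.displacementDomain, (0, y₀) ∈ Γ ∧
    ∃ d : ℝ, HasDerivAt p.displacement d y₀ ∧ d ≠ 0

/-- The forward half-trajectories. -/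
def forwardTrajectories (p : LienardParams) : Set (ℝ → ℝ × ℝ) :=
  {γ | p.IsTrajectoryOn (Ici 0) γ}

/-- The backward half-trajectories, parametrized by reversed time. -/
def backwardTrajectories (p : LienardParams) : Set (ℝ → ℝ × ℝ) :=
  {γ | p.IsTrajectoryOn (Iic 0) fun t => γ (-t)}

/-- Orbital (Lyapunov) stability of `Γ` with respect to a set of half-trajectories. -/
def OrbitallyStable (S : Set (ℝ → ℝ × ℝ)) (Γ : Set (ℝ × ℝ)) : Prop :=
  ∀ U : Set (ℝ × ℝ), IsOpen U → Γ ⊆ U → ∃ V : Set (ℝ × ℝ), IsOpen V ∧ Γ ⊆ V ∧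
    ∀ γ ∈ S, γ 0 ∈ V → ∀ t ≥ 0, γ t ∈ U

/-- Orbital asymptotic stability: stability and local attraction. -/
def OrbitallyAsymptoticallyStable (S : Set (ℝ → ℝ × ℝ)) (Γ : Set (ℝ × ℝ)) : Prop :=
  OrbitallyStable S Γ ∧ ∃ V : Set (ℝ × ℝ), IsOpen V ∧ Γ ⊆ V ∧
    ∀ γ ∈ S, γ 0 ∈ V → Tendsto (fun t => Metric.infDist (γ t) Γ) atTop (𝓝 0)

/-- `Γ` is asymptotically stable. -/
def IsAsymptoticallyStable (p : LienardParams) (Γ : Set (ℝ × ℝ)) : Prop :=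
  OrbitallyAsymptoticallyStable p.forwardTrajectories Γ

/-- `Γ` is unstable, i.e. not orbitally stable. -/
def IsUnstable (p : LienardParams) (Γ : Set (ℝ × ℝ)) : Prop :=
  ¬ OrbitallyStable p.forwardTrajectories Γ

/-- `Γ` is repelling, i.e. asymptotically stable in reversed time. -/
def IsRepelling (p : LienardParams) (Γ : Set (ℝ × ℝ)) : Prop :=
  OrbitallyAsymptoticallyStable p.backwardTrajectories Γ

end LienardParams

end

/-! A closed crossing orbit is a loop: one arc in `x < 0` followed by one arc in `x > 0`. Reflecting
the right arc and reversing time turns it into an arc of a left system with data `(-TR, DR, -aR)`.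
Both half-maps thus become instances of one construction, and a loop is a pair of left arcs with the
same endpoints `y₀ > 0 > y₁`. A half-map has derivative `(y₀ / y₁) exp (T τ)`, where `τ` is the
flight time. At a loop, `δ'` therefore has the sign of the total divergence `TL τL + TR τR`.

The heart is `LeftArc.sign_eq`: for two left arcs with common endpoints, `T₁ τ₁ - T₂ τ₂` and `a₁ T₂
- a₂ T₁` have the same sign. For a loop this says that `TL τL + TR τR` has the sign of `ξ`. To prove
it, note that the sign of `y₀ + y₁` determines that of `T`. So the traces have equal signs, and time
reversal reduces to negative ones. As functions of the ratio `ρ = -y₁ / y₀`, the scaled quantities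
`k = a / (T y₀)` and `t = -T τ` solve differential equations whose only parameter is `d = D / T²`.
The difference `k₂ - k₁` solves a linear equation that is singular at `ρ = 1`, the limit of short
arcs, and the singularity replaces an initial condition: `d₁ < d₂` forces `k₁ < k₂`, and then `t₂ <
t₁`. Both signs are thus decided by comparing `d₁` with `d₂`.

Hence at every loop `δ'` has the sign of `ξ`. If `ξ = 0`, no loop is hyperbolic. If `ξ ≠ 0`, two
loops would give two zeros of `δ` on an interval where every zero is crossed in the same direction,
which is impossible (`Loop.not_lt`).

The return map has derivative `exp (TL τL + TR τR)` at the loop. If `ξ < 0` it contracts, which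
gives asymptotic stability once Filippov trajectories are known to follow arcs: their first
component is C¹, so they cross `x = 0` wherever `y ≠ 0`. If `ξ > 0`, time reversal gives repulsion.
Instability also needs forward trajectories to exist from arbitrary points, which is proved by
Zorn's lemma. -/

namespace LienardParams

/-! ### The fundamental solutions of `x'' = T x' - D x + 1` -/

/-- The generator of the homogenized system for `(x, x', 1)`. -/
noncomputable def generator (T D : ℝ) : (ℝ × ℝ × ℝ) →L[ℝ] (ℝ × ℝ × ℝ) :=
  (ContinuousLinearMap.fst ℝ ℝ ℝ ∘L ContinuousLinearMap.snd ℝ ℝ (ℝ × ℝ)).prod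
    ((ContinuousLinearMap.snd ℝ ℝ ℝ ∘L ContinuousLinearMap.snd ℝ ℝ (ℝ × ℝ)
      + T • (ContinuousLinearMap.fst ℝ ℝ ℝ ∘L ContinuousLinearMap.snd ℝ ℝ (ℝ × ℝ))
      - D • ContinuousLinearMap.fst ℝ ℝ (ℝ × ℝ)).prod 0)

lemma generator_apply (T D : ℝ) (v : ℝ × ℝ × ℝ) :
    generator T D v = (v.2.1, v.2.2 + T * v.2.1 - D * v.1, 0) := by
  simp [generator]

/-- The matrix exponential covers real, double and complex eigenvalues, as well as `D = 0`, in one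
formula. -/
noncomputable def fund (T D t : ℝ) : ℝ × ℝ × ℝ := NormedSpace.exp (t • generator T D) (0, 0, 1)

/-- The solution of `x'' = T x' - D x + 1` with `x(0) = x'(0) = 0`. -/
noncomputable def fP (T D t : ℝ) : ℝ := (fund T D t).1

/-- The derivative of `fP`, which solves `x'' = T x' - D x` with `x(0) = 0`, `x'(0) = 1`. -/
noncomputable def fS (T D t : ℝ) : ℝ := (fund T D t).2.1

lemma hasDerivAt_fund (T D t : ℝ) : HasDerivAt (fund T D) (generator T D (fund T D t)) t := by
  have h := hasDerivAt_exp_smul_const' (𝕂 := ℝ) (generator T D) t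
  exact h.clm_apply (hasDerivAt_const t ((0, 0, 1) : ℝ × ℝ × ℝ)) |>.congr_deriv (by simp [fund])

lemma fund_zero (T D : ℝ) : fund T D 0 = (0, 0, 1) := by simp [fund]

lemma fund_snd_snd (T D t : ℝ) : (fund T D t).2.2 = 1 := by
  have h : ∀ s, HasDerivAt (fun s => (fund T D s).2.2) 0 s := fun s => by
    have := (hasDerivAt_fund T D s).snd.snd
    rwa [generator_apply] at this
  have := is_const_of_deriv_eq_zero (fun s => (h s).differentiableAt) (fun s => (h s).deriv) t 0
  simpa [fund_zero] using this

@[simp] lemma fP_zero (T D : ℝ) : fP T D 0 = 0 := by simp [fP, fund_zero]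
@[simp] lemma fS_zero (T D : ℝ) : fS T D 0 = 0 := by simp [fS, fund_zero]

lemma hasDerivAt_fP (T D t : ℝ) : HasDerivAt (fP T D) (fS T D t) t := by
  have := (hasDerivAt_fund T D t).fst
  rwa [generator_apply] at this

lemma hasDerivAt_fS (T D t : ℝ) :
    HasDerivAt (fS T D) (1 + T * fS T D t - D * fP T D t) t := by
  have := (hasDerivAt_fund T D t).snd.fst
  rw [generator_apply, fund_snd_snd] at this
  exact this

lemma continuous_fP (T D : ℝ) : Continuous (fP T D) :=
  continuous_iff_continuousAt.2 fun t => (hasDerivAt_fP T D t).continuousAt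

lemma continuous_fS (T D : ℝ) : Continuous (fS T D) :=
  continuous_iff_continuousAt.2 fun t => (hasDerivAt_fS T D t).continuousAt

/-- The quantity `S² - P - T S P + D P²`, i.e. `S² - S' P`. -/
noncomputable def fR (T D t : ℝ) : ℝ :=
  fS T D t ^ 2 - fP T D t - T * fS T D t * fP T D t + D * fP T D t ^ 2

@[simp] lemma fR_zero (T D : ℝ) : fR T D 0 = 0 := by simp [fR]

lemma hasDerivAt_fR (T D t : ℝ) : HasDerivAt (fR T D) (fS T D t + T * fR T D t) t := by
  have hP := hasDerivAt_fP T D t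
  have hS := hasDerivAt_fS T D t
  refine ((((hS.pow 2).sub hP).sub ((hS.const_mul T).mul hP)).add
    ((hP.pow 2).const_mul D)).congr_deriv ?_
  simp only [fR]
  push_cast
  ring

lemma continuous_fR (T D : ℝ) : Continuous (fR T D) :=
  continuous_iff_continuousAt.2 fun t => (hasDerivAt_fR T D t).continuousAt

/-! ### The flow -/

/-- A linear vector field in Liénard form. -/
def field (T D a : ℝ) (z : ℝ × ℝ) : ℝ × ℝ := (T * z.1 - z.2, D * z.1 - a)

/-- The flow of `field T D a`. -/
noncomputable def flow (T D a t : ℝ) (z : ℝ × ℝ) : ℝ × ℝ :=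
  (z.1 * (1 + T * fS T D t - D * fP T D t) - z.2 * fS T D t + a * fP T D t,
    z.1 * D * fS T D t + z.2 * (1 - D * fP T D t) + a * (T * fP T D t - fS T D t))

@[simp] lemma flow_zero (T D a : ℝ) (z : ℝ × ℝ) : flow T D a 0 z = z := by simp [flow]

lemma hasDerivAt_flow (T D a t : ℝ) (z : ℝ × ℝ) :
    HasDerivAt (fun t => flow T D a t z) (field T D a (flow T D a t z)) t := by
  have hP := hasDerivAt_fP T D t
  have hS := hasDerivAt_fS T D t
  have h1 : HasDerivAt (fun t => z.1 * (1 + T * fS T D t - D * fP T D t) - z.2 * fS T D t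
      + a * fP T D t) (field T D a (flow T D a t z)).1 t := by
    refine (((((hS.const_mul T).const_add 1).sub (hP.const_mul D)).const_mul z.1).sub
      (hS.const_mul z.2) |>.add (hP.const_mul a)).congr_deriv ?_
    simp only [field, flow]
    ring
  have h2 : HasDerivAt (fun t => z.1 * D * fS T D t + z.2 * (1 - D * fP T D t)
      + a * (T * fP T D t - fS T D t)) (field T D a (flow T D a t z)).2 t := by
    refine (((hS.const_mul (z.1 * D)).add ((((hP.const_mul D).const_sub 1)).const_mul z.2)).add
      (((hP.const_mul T).sub hS).const_mul a)).congr_deriv ?_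
    simp only [field, flow]
    ring
  exact h1.prodMk h2

lemma continuous_flow (T D a : ℝ) : Continuous fun q : ℝ × (ℝ × ℝ) => flow T D a q.1 q.2 := by
  have hP := continuous_fP T D
  have hS := continuous_fS T D
  unfold flow
  fun_prop

lemma continuous_flow_time (T D a : ℝ) (z : ℝ × ℝ) : Continuous fun t => flow T D a t z :=
  (continuous_flow T D a).comp (Continuous.prodMk_left z)

/-- The linear part of `field`. -/
noncomputable def fieldLin (T D : ℝ) : (ℝ × ℝ) →L[ℝ] (ℝ × ℝ) :=
  (T • ContinuousLinearMap.fst ℝ ℝ ℝ - ContinuousLinearMap.snd ℝ ℝ ℝ).prod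
    (D • ContinuousLinearMap.fst ℝ ℝ ℝ)

lemma field_eq (T D a : ℝ) (z : ℝ × ℝ) : field T D a z = fieldLin T D z - (0, a) := by
  simp [field, fieldLin]

lemma lipschitzWith_field (T D a : ℝ) : LipschitzWith ‖fieldLin T D‖₊ (field T D a) := by
  refine LipschitzWith.of_dist_le_mul fun z w => ?_
  rw [field_eq, field_eq, dist_sub_right]
  exact (fieldLin T D).lipschitz.dist_le_mul z w

lemma continuous_field (T D a : ℝ) : Continuous (field T D a) := (lipschitzWith_field T D a).continuous

lemma solution_unique {T D a : ℝ} {f g : ℝ → ℝ × ℝ} {t₀ : ℝ}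
    (hf : ∀ t, HasDerivAt f (field T D a (f t)) t) (hg : ∀ t, HasDerivAt g (field T D a (g t)) t)
    (h : f t₀ = g t₀) : f = g :=
  ODE_solution_unique_univ (v := fun _ => field T D a) (s := fun _ => univ) (t₀ := t₀)
    (fun _ => (lipschitzWith_field T D a).lipschitzOnWith)
    (fun t => ⟨hf t, mem_univ _⟩) (fun t => ⟨hg t, mem_univ _⟩) h

lemma solution_eq_flow {T D a : ℝ} {f : ℝ → ℝ × ℝ}
    (hf : ∀ t, HasDerivAt f (field T D a (f t)) t) (t₀ t : ℝ) :
    f t = flow T D a (t - t₀) (f t₀) := by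
  refine congrFun (solution_unique (T := T) (D := D) (a := a) (t₀ := t₀)
    (g := fun t => flow T D a (t - t₀) (f t₀)) hf (fun t => ?_) (by simp)) t
  exact (hasDerivAt_flow T D a (t - t₀) (f t₀)).comp_sub_const t t₀

lemma flow_add (T D a s t : ℝ) (z : ℝ × ℝ) :
    flow T D a (s + t) z = flow T D a t (flow T D a s z) := by
  have := solution_eq_flow (fun t => hasDerivAt_flow T D a t z) s (s + t)
  simpa using this

/-- The time reversal `(x, y) ↦ (x, -y)`. -/
def conj (z : ℝ × ℝ) : ℝ × ℝ := (z.1, -z.2)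

/-- The symmetry `(x, y, t) ↦ (x, -y, -t)` changes the sign of the trace and keeps `D` and `a`. It
reduces positive traces to negative ones. -/
lemma flow_conj (T D a t : ℝ) (z : ℝ × ℝ) :
    flow (-T) D a t (conj z) = conj (flow T D a (-t) z) := by
  have h : ∀ t, HasDerivAt (fun t => conj (flow T D a (-t) z))
      (field (-T) D a (conj (flow T D a (-t) z))) t := fun t => by
    have h0 : HasDerivAt (fun t => flow T D a (-t) z) ((-1 : ℝ) • field T D a (flow T D a (-t) z)) t :=
      (hasDerivAt_flow T D a (-t) z).scomp t (hasDerivAt_neg t)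
    have h1 : HasDerivAt (fun t => (flow T D a (-t) z).1) _ t := h0.fst
    have h2 : HasDerivAt (fun t => (flow T D a (-t) z).2) _ t := h0.snd
    refine (h1.prodMk h2.neg).congr_deriv ?_
    simp [field, conj]
    ring
  have := solution_eq_flow h 0 t
  simpa using this.symm

/-- The pair `(p, T p - s)` is an orbit of `field T D 1` from the origin, so uniqueness of solutions
identifies it. -/
lemma fS_eq_of_linear {T D : ℝ} {p s : ℝ → ℝ} (hp : ∀ t, HasDerivAt p (s t) t)
    (hs : ∀ t, HasDerivAt s (1 + T * s t - D * p t) t) (h0 : p 0 = 0) (h0' : s 0 = 0) (t : ℝ) :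
    p t = fP T D t ∧ s t = fS T D t := by
  have h : ∀ t, HasDerivAt (fun t => (p t, T * p t - s t))
      (field T D 1 (p t, T * p t - s t)) t := fun t => by
    refine ((hp t).prodMk (((hp t).const_mul T).sub (hs t))).congr_deriv ?_
    simp [field]; ring
  have := solution_eq_flow h 0 t
  simp only [flow, h0, h0', Prod.ext_iff] at this
  obtain ⟨h1, h2⟩ := this
  simp at h1 h2
  refine ⟨h1, ?_⟩
  rw [h1] at h2
  linarith

/-- The right-hand side solves `u' = T u` with `u(0) = 1`. -/
lemma exp_eq_fR (T D t : ℝ) :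
    Real.exp (T * t) = 1 + T * fS T D t - D * fP T D t + D * fR T D t := by
  have hE : ∀ t, HasDerivAt (fun t => (1 + T * fS T D t - D * fP T D t + D * fR T D t)
      * Real.exp (-(T * t))) 0 t := fun t => by
    have h1 := ((((hasDerivAt_fS T D t).const_mul T).const_add 1).sub
      ((hasDerivAt_fP T D t).const_mul D)).add ((hasDerivAt_fR T D t).const_mul D)
    have h2 : HasDerivAt (fun t => Real.exp (-(T * t))) (Real.exp (-(T * t)) * -(T * 1)) t :=
      (((hasDerivAt_id t).const_mul T).neg).exp
    refine (h1.mul h2).congr_deriv ?_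
    simp only [Pi.add_apply, Pi.sub_apply]
    ring
  have := is_const_of_deriv_eq_zero (fun s => (hE s).differentiableAt) (fun s => (hE s).deriv) t 0
  simp only [Real.exp_neg] at this
  simp at this
  field_simp at this
  linarith

/-- Time reversal exchanges `P` and `R` up to an exponential factor. This makes `Good` invariant
under `T ↦ -T`. -/
lemma fundamental_neg (T D t : ℝ) :
    fP (-T) D t = Real.exp (-(T * t)) * fR T D t ∧
      fS (-T) D t = Real.exp (-(T * t)) * fS T D t := by
  have h2 : ∀ t, HasDerivAt (fun t => Real.exp (-(T * t))) (Real.exp (-(T * t)) * -(T * 1)) t :=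
    fun t => (((hasDerivAt_id t).const_mul T).neg).exp
  have := fS_eq_of_linear (T := -T) (D := D) (p := fun t => Real.exp (-(T * t)) * fR T D t)
    (s := fun t => Real.exp (-(T * t)) * fS T D t)
    (fun t => ((h2 t).mul (hasDerivAt_fR T D t)).congr_deriv (by ring))
    (fun t => ((h2 t).mul (hasDerivAt_fS T D t)).congr_deriv (by
      have h3 : Real.exp (-(T * t)) * Real.exp (T * t) = 1 := by
        rw [← Real.exp_add]; simp
      rw [exp_eq_fR T D t] at h3
      linear_combination h3)) (by simp) (by simp) t
  exact ⟨this.1.symm, this.2.symm⟩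

lemma fR_eq_exp_mul_fP (T D t : ℝ) : fR T D t = Real.exp (T * t) * fP (-T) D t := by
  rw [(fundamental_neg T D t).1, ← mul_assoc, ← Real.exp_add]; simp

/-! ### Behaviour at time `0` -/

lemma fS_div_tendsto (T D : ℝ) : Tendsto (fun t => fS T D t / t) (𝓝[>] 0) (𝓝 1) := by
  have h := (hasDerivAt_fS T D 0).tendsto_slope_zero_right
  simpa [div_eq_inv_mul] using h

lemma eventually_gt_ne_zero : ∀ᶠ t : ℝ in 𝓝[>] 0, 0 < t := eventually_mem_nhdsWithin

/-- One application of L'Hôpital's rule. Iterating it yields the leading coefficients of `P`, `R`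
and `P - R` at `0`. -/
lemma tendsto_of_hasDerivAt_div {f f' : ℝ → ℝ} {c : ℝ} (n : ℕ) (hf : ∀ t, HasDerivAt f (f' t) t)
    (h0 : f 0 = 0) (h : Tendsto (fun t => f' t / t ^ n) (𝓝[>] 0) (𝓝 c)) :
    Tendsto (fun t => f t / t ^ (n + 1)) (𝓝[>] 0) (𝓝 (c / (n + 1))) := by
  refine HasDerivAt.lhopital_zero_nhdsGT (f' := f') (g' := fun t => ((n + 1 : ℕ) : ℝ) * t ^ n)
    (Eventually.of_forall hf)
    (Eventually.of_forall fun t => by simpa using hasDerivAt_pow (n + 1) t) ?_ ?_ ?_ ?_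
  · filter_upwards [eventually_gt_ne_zero] with t ht
    positivity
  · have := (hf 0).continuousAt.tendsto
    rw [h0] at this
    exact this.mono_left nhdsWithin_le_nhds
  · have : ContinuousAt (fun t : ℝ => t ^ (n + 1)) 0 := by fun_prop
    have h2 := this.tendsto
    simp only [ne_eq, Nat.add_eq_zero_iff, one_ne_zero, and_false, not_false_eq_true, zero_pow] at h2
    exact h2.mono_left nhdsWithin_le_nhds
  · refine (h.div_const ((n : ℝ) + 1)).congr fun t => ?_
    push_cast
    rw [div_div, mul_comm]

lemma fP_div_tendsto (T D : ℝ) : Tendsto (fun t => fP T D t / t ^ 2) (𝓝[>] 0) (𝓝 (1 / 2)) := by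
  have := tendsto_of_hasDerivAt_div (f := fP T D) 1 (hasDerivAt_fP T D) (by simp)
    (c := 1) (by simpa using fS_div_tendsto T D)
  norm_num at this ⊢
  exact this

lemma fR_div_tendsto (T D : ℝ) : Tendsto (fun t => fR T D t / t ^ 2) (𝓝[>] 0) (𝓝 (1 / 2)) := by
  have hd : Tendsto (fun t => fR T D t / t) (𝓝[>] 0) (𝓝 0) := by
    have h := (hasDerivAt_fR T D 0).tendsto_slope_zero_right
    simpa [div_eq_inv_mul] using h
  have := tendsto_of_hasDerivAt_div (f := fR T D) 1 (hasDerivAt_fR T D) (by simp)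
    (c := 1) (by
      have := (fS_div_tendsto T D).add (hd.const_mul T)
      simp only [mul_zero, add_zero] at this
      refine this.congr fun t => ?_
      simp only [pow_one]
      ring)
  norm_num at this ⊢
  exact this

/-- The quadratic terms of `P` and `R` cancel. The cubic one is what the limit of `gSpeed` at `0`
depends on. -/
lemma fP_sub_fR_div_tendsto (T D : ℝ) :
    Tendsto (fun t => (fP T D t - fR T D t) / t ^ 3) (𝓝[>] 0) (𝓝 (-T / 6)) := by
  have := tendsto_of_hasDerivAt_div (f := fun t => fP T D t - fR T D t) 2
    (f' := fun t => - T * fR T D t)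
    (fun t => ((hasDerivAt_fP T D t).sub (hasDerivAt_fR T D t)).congr_deriv (by ring)) (by simp)
    (c := -T * (1 / 2)) (by
      refine ((fR_div_tendsto T D).const_mul (-T)).congr fun t => ?_
      ring)
  norm_num at this ⊢
  convert this using 2
  ring

lemma fS_eventually_pos (T D : ℝ) : ∀ᶠ t in 𝓝[>] 0, 0 < fS T D t := by
  filter_upwards [(fS_div_tendsto T D).eventually (lt_mem_nhds (show (1 / 2 : ℝ) < 1 by norm_num)),
    eventually_gt_ne_zero] with t h ht
  have : 0 < fS T D t / t := by linarith
  exact (div_pos_iff_of_pos_right ht).1 this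

lemma fP_eventually_pos (T D : ℝ) : ∀ᶠ t in 𝓝[>] 0, 0 < fP T D t := by
  filter_upwards [(fP_div_tendsto T D).eventually (lt_mem_nhds (show (1 / 4 : ℝ) < 1 / 2 by norm_num)),
    eventually_gt_ne_zero] with t h ht
  have : 0 < fP T D t / t ^ 2 := by linarith
  exact (div_pos_iff_of_pos_right (by positivity)).1 this

lemma fR_eventually_pos (T D : ℝ) : ∀ᶠ t in 𝓝[>] 0, 0 < fR T D t := by
  filter_upwards [(fR_div_tendsto T D).eventually (lt_mem_nhds (show (1 / 4 : ℝ) < 1 / 2 by norm_num)),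
    eventually_gt_ne_zero] with t h ht
  have : 0 < fR T D t / t ^ 2 := by linarith
  exact (div_pos_iff_of_pos_right (by positivity)).1 this

end LienardParams

/-! ### Left arcs, and positivity of `P` and `R` along them -/

namespace LienardParams

/-- Positivity is assumed only just to the right of `a`, since `P` and `R` vanish at `0` itself. -/
lemma exists_first_zero {f : ℝ → ℝ} {a b : ℝ} (hf : ContinuousOn f (Icc a b)) (hab : a < b)
    (hpos : ∀ᶠ t in 𝓝[>] a, 0 < f t) (hb : f b ≤ 0) :
    ∃ c ∈ Ioc a b, f c = 0 ∧ ∀ t ∈ Ioo a c, 0 < f t := by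
  obtain ⟨u, hu, hu'⟩ := (mem_nhdsGT_iff_exists_Ioo_subset).1 hpos
  have hu : a < u := hu
  obtain ⟨a', ha', ha''⟩ := exists_between (lt_min hu hab)
  have hfa' : 0 < f a' := hu' ⟨ha', lt_of_lt_of_le ha'' (min_le_left _ _)⟩
  have ha'b : a' < b := lt_of_lt_of_le ha'' (min_le_right _ _)
  have hf' : ContinuousOn f (Icc a' b) := hf.mono (Icc_subset_Icc_left ha'.le)
  have hcomp : IsCompact (Icc a' b ∩ f ⁻¹' Iic 0) :=
    isCompact_Icc.of_isClosed_subset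
      (hf'.preimage_isClosed_of_isClosed isClosed_Icc isClosed_Iic) inter_subset_left
  obtain ⟨c, ⟨hc1, hc2⟩, hc⟩ := hcomp.exists_isLeast ⟨b, ⟨ha'b.le, le_rfl⟩, hb⟩
  have hc2 : f c ≤ 0 := hc2
  have hac : a' < c := lt_of_le_of_ne hc1.1 fun h => by rw [← h] at hc2; linarith
  have hlt : ∀ t ∈ Ioo a c, 0 < f t := fun t ht => by
    by_cases h : t < u
    · exact hu' ⟨ht.1, h⟩
    · have h1 : a' ≤ t := (ha''.trans_le (min_le_left _ _)).le.trans (not_lt.1 h)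
      by_contra h2
      exact absurd (hc ⟨⟨h1, ht.2.le.trans hc1.2⟩, not_lt.1 h2⟩) (not_le.2 ht.2)
  refine ⟨c, ⟨ha'.trans hac, hc1.2⟩, le_antisymm hc2 ?_, hlt⟩
  have h1 : Tendsto f (𝓝[Ioo a' c] c) (𝓝 (f c)) :=
    (hf' c hc1).mono_left (nhdsWithin_mono _ fun t ht => ⟨ht.1.le, ht.2.le.trans hc1.2⟩)
  have : (𝓝[Ioo a' c] c).NeBot := by
    rw [← mem_closure_iff_nhdsWithin_neBot, closure_Ioo hac.ne]
    exact ⟨hac.le, le_rfl⟩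
  refine ge_of_tendsto h1 ?_
  filter_upwards [self_mem_nhdsWithin] with t ht
  exact (hlt t ⟨ha'.trans ht.1, ht.2⟩).le

/-- The energy `S² / 2 - P + D P² / 2` is negative for positive times when `T < 0`. -/
lemma energy_neg {T : ℝ} (hT : T < 0) (D : ℝ) {t : ℝ} (ht : 0 < t) :
    fS T D t ^ 2 / 2 - fP T D t + D * fP T D t ^ 2 / 2 < 0 := by
  set e : ℝ → ℝ := fun t => fS T D t ^ 2 / 2 - fP T D t + D * fP T D t ^ 2 / 2 with he
  have hd : ∀ t, HasDerivAt e (T * fS T D t ^ 2) t := fun t => by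
    have hP := hasDerivAt_fP T D t
    have hS := hasDerivAt_fS T D t
    refine ((((hS.pow 2).div_const 2).sub hP).add
      (((hP.pow 2).const_mul D).div_const 2)).congr_deriv ?_
    push_cast
    ring
  have hanti : Antitone e := antitone_of_deriv_nonpos (fun t => (hd t).differentiableAt)
    fun t => by rw [(hd t).deriv]; nlinarith [sq_nonneg (fS T D t)]
  obtain ⟨u, hu, hu'⟩ := (mem_nhdsGT_iff_exists_Ioo_subset).1 (fS_eventually_pos T D)
  have hu : 0 < u := hu
  have hm : 0 < min u t := lt_min hu ht
  have hstr : StrictAntiOn e (Icc 0 (min u t)) := by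
    refine strictAntiOn_of_deriv_neg (convex_Icc _ _)
      (fun t _ => (hd t).continuousAt.continuousWithinAt) fun s hs => ?_
    rw [interior_Icc] at hs
    rw [(hd s).deriv]
    have : 0 < fS T D s := hu' ⟨hs.1, hs.2.trans_le (min_le_left _ _)⟩
    nlinarith [mul_pos this this]
  have h1 := hstr ⟨le_rfl, hm.le⟩ ⟨hm.le, le_rfl⟩ hm
  have h2 := hanti (min_le_right u t)
  have h3 : e 0 = 0 := by simp [he]
  change e t < 0
  linarith

/-- At a zero of `P` the energy would be `S² / 2 ≥ 0`, against `energy_neg`. -/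
lemma fP_pos_of_neg {T : ℝ} (hT : T < 0) (D : ℝ) {t : ℝ} (ht : 0 < t) : 0 < fP T D t := by
  by_contra h
  obtain ⟨c, hc, hc0, -⟩ := exists_first_zero (continuous_fP T D).continuousOn ht
    (fP_eventually_pos T D) (not_lt.1 h)
  have := energy_neg hT D hc.1
  rw [hc0] at this
  nlinarith [sq_nonneg (fS T D c)]

/-- The orbit of `(0, y₀)` stays in `x < 0` until it reaches `(0, y₁)` at time `τ`. -/
structure LeftArc (T D a y₀ y₁ τ : ℝ) : Prop where
  pos : 0 < τ
  land : flow T D a τ (0, y₀) = (0, y₁)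
  neg : ∀ t ∈ Ioo 0 τ, (flow T D a t (0, y₀)).1 < 0

lemma flow_section_fst (T D a t y : ℝ) :
    (flow T D a t (0, y)).1 = a * fP T D t - y * fS T D t := by
  simp [flow]; ring

lemma LeftArc.rev {T D a y₀ y₁ τ : ℝ} (h : LeftArc T D a y₀ y₁ τ) :
    LeftArc (-T) D a (-y₁) (-y₀) τ := by
  have key : ∀ t, flow (-T) D a t (0, -y₁) = conj (flow T D a (τ - t) (0, y₀)) := fun t => by
    have h1 : ((0, -y₁) : ℝ × ℝ) = conj (0, y₁) := rfl
    rw [h1, flow_conj, ← h.land, ← flow_add, sub_eq_add_neg]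
  refine ⟨h.pos, ?_, fun t ht => ?_⟩
  · rw [key]; simp [conj]
  · rw [key]; exact h.neg _ ⟨by linarith [ht.2], by linarith [ht.1]⟩

lemma LeftArc.fst_eq {T D a y₀ y₁ τ : ℝ} (h : LeftArc T D a y₀ y₁ τ) :
    a * fP T D τ = y₀ * fS T D τ := by
  have := congrArg Prod.fst h.land
  rw [flow_section_fst] at this
  simp at this; linarith

lemma LeftArc.snd_eq {T D a y₀ y₁ τ : ℝ} (h : LeftArc T D a y₀ y₁ τ) :
    y₁ = y₀ * (1 - D * fP T D τ) + a * (T * fP T D τ - fS T D τ) := by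
  have := congrArg Prod.snd h.land
  simp [flow] at this; linarith

/-- Eliminating `a` between the two coordinates of the landing point shows that `-y₁ / y₀ = R / P`
depends on the flight time only. -/
lemma LeftArc.mul_eq {T D a y₀ y₁ τ : ℝ} (h : LeftArc T D a y₀ y₁ τ) :
    y₁ * fP T D τ = - (y₀ * fR T D τ) := by
  rw [h.snd_eq, fR]
  linear_combination (T * fP T D τ - fS T D τ) * h.fst_eq

lemma LeftArc.unique {T D a y₀ y₁ y₁' τ τ' : ℝ} (h : LeftArc T D a y₀ y₁ τ)
    (h' : LeftArc T D a y₀ y₁' τ') : τ = τ' ∧ y₁ = y₁' := by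
  have : τ = τ' := by
    rcases lt_trichotomy τ τ' with hlt | rfl | hlt
    · have := h'.neg τ ⟨h.pos, hlt⟩
      rw [h.land] at this; simp at this
    · rfl
    · have := h.neg τ' ⟨h'.pos, hlt⟩
      rw [h'.land] at this; simp at this
  subst this
  exact ⟨rfl, by have := h.land.symm.trans h'.land; simpa using this⟩

/-- `P` and `R` are positive on `(0, τ]`. -/
def Good (T D τ : ℝ) : Prop := ∀ t ∈ Ioc 0 τ, 0 < fP T D t ∧ 0 < fR T D t

lemma Good.neg {T D τ : ℝ} (h : Good T D τ) : Good (-T) D τ := fun t ht => by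
  rw [(fundamental_neg T D t).1, fR_eq_exp_mul_fP (-T), neg_neg]
  exact ⟨mul_pos (Real.exp_pos _) (h t ht).2, mul_pos (Real.exp_pos _) (h t ht).1⟩

/-- Let `c` be the first zero of `R`. If `c = τ`, then `y₁ P(τ) = 0`, which is impossible. If `c <
τ`, compare with the orbit of `(0, 1)` for the constant term `k = S(c) / P(c)`. It touches the
origin at time `c` and then has `x = k P(t - c) < 0`, so `k P(τ) < S(τ)`. Since the arc is still in
`x < 0` at time `c`, `a < k y₀`. Hence `a P(τ) < y₀ S(τ)`, so the arc cannot land at time `τ`. -/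
lemma LeftArc.good_of_neg {T D a y₀ y₁ τ : ℝ} (h : LeftArc T D a y₀ y₁ τ) (hT : T < 0)
    (hy₀ : 0 < y₀) (hy₁ : y₁ < 0) : Good T D τ := by
  intro t ht
  refine ⟨fP_pos_of_neg hT D ht.1, ?_⟩
  by_contra hR
  obtain ⟨c, hc, hc0, hcpos⟩ := exists_first_zero (continuous_fR T D).continuousOn ht.1
    (fR_eventually_pos T D) (not_lt.1 hR)
  have hPc := fP_pos_of_neg hT D hc.1
  have hPτ := fP_pos_of_neg hT D h.pos
  rcases eq_or_lt_of_le (hc.2.trans ht.2) with hcτ | hcτ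
  · have h1 := h.mul_eq
    rw [← hcτ, hc0] at h1
    nlinarith
  have hneg := h.neg c ⟨hc.1, hcτ⟩
  rw [flow_section_fst] at hneg
  -- the orbit of `(0, 1)` for the constant term `k` is tangent to `x = 0` at time `c`
  set k := fS T D c / fP T D c with hk
  have hkP : k * fP T D c = fS T D c := by rw [hk]; field_simp
  have hland : flow T D k c (0, 1) = (0, 0) := by
    have h2 : fP T D c * (1 - D * fP T D c + k * (T * fP T D c - fS T D c)) = 0 := by
      rw [fR] at hc0
      linear_combination (T * fP T D c - fS T D c) * hkP - hc0
    have h3 := (mul_eq_zero.1 h2).resolve_left hPc.ne'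
    ext
    · rw [flow_section_fst]; simp only; linarith
    · simp [flow]; linarith
  have hafter : (flow T D k τ (0, 1)).1 = k * fP T D (τ - c) := by
    have := flow_add T D k c (τ - c) (0, 1)
    rw [add_sub_cancel] at this
    rw [this, hland, flow_section_fst]; ring
  have hk0 : k < 0 := by
    -- the derivative of `R` at its first zero is `S`, hence `S ≤ 0`
    have hS : fS T D c ≤ 0 := by
      by_contra hS
      have hd := hasDerivAt_fR T D c
      rw [hc0, mul_zero, add_zero] at hd
      have hsl := hd.tendsto_slope_zero_left
      have h1 := hsl.eventually (lt_mem_nhds (not_le.1 hS))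
      have h2 : ∀ᶠ t in 𝓝[<] (0 : ℝ), -c < t :=
        eventually_nhdsWithin_of_eventually_nhds (lt_mem_nhds (by linarith [hc.1]))
      obtain ⟨s, ⟨hs1, hs2⟩, hs3⟩ := ((h1.and h2).and self_mem_nhdsWithin).exists
      have hs3 : s < 0 := hs3
      have h3 := hcpos (c + s) ⟨by linarith, by linarith⟩
      rw [hc0, smul_eq_mul, sub_zero] at hs1
      have : s⁻¹ < 0 := inv_lt_zero.2 hs3
      nlinarith
    -- If `S` vanished along with `R`, then `D P = 1`, and `exp_eq_fR` would give `exp (T c) = 0`.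
    refine div_neg_of_neg_of_pos (lt_of_le_of_ne hS fun h0 => ?_) hPc
    have hE := exp_eq_fR T D c
    rw [hc0, h0] at hE
    rw [fR, h0] at hc0
    have h4 : fP T D c * (D * fP T D c - 1) = 0 := by linear_combination hc0
    have h5 := (mul_eq_zero.1 h4).resolve_left hPc.ne'
    have : Real.exp (T * c) = 0 := by rw [hE]; linear_combination -h5
    exact (Real.exp_pos _).ne' this
  have h1 : (flow T D k τ (0, 1)).1 < 0 := by
    rw [hafter]
    exact mul_neg_of_neg_of_pos hk0 (fP_pos_of_neg hT D (by linarith))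
  rw [flow_section_fst] at h1
  have h2 := h.fst_eq
  -- compare `a` with `k y₀`
  have h3 : a < k * y₀ := by
    have : a * fP T D c < k * y₀ * fP T D c := by
      have : k * y₀ * fP T D c = y₀ * fS T D c := by rw [← hkP]; ring
      linarith
    exact lt_of_mul_lt_mul_right this hPc.le
  nlinarith [mul_pos (sub_pos.2 h3) hPτ]

/-- For `T = 0`, `R = P`, so at a zero of `P` the formula for `R` gives `S = 0` too. The orbit is
then back at its starting point, which is neither in `x < 0` nor equal to `(0, y₁)`. -/
lemma LeftArc.good_of_zero {D a y₀ y₁ τ : ℝ} (h : LeftArc 0 D a y₀ y₁ τ)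
    (hy₀ : 0 < y₀) (hy₁ : y₁ < 0) : Good 0 D τ := by
  have hR : ∀ t, fR 0 D t = fP 0 D t := fun t => by
    have := fR_eq_exp_mul_fP 0 D t
    simpa using this
  intro t ht
  rw [hR, and_self]
  by_contra hP
  obtain ⟨c, hc, hc0, -⟩ := exists_first_zero (continuous_fP 0 D).continuousOn ht.1
    (fP_eventually_pos 0 D) (not_lt.1 hP)
  have h1 := hR c
  rw [fR, hc0] at h1
  have hS : fS 0 D c = 0 := by simpa using h1
  rcases eq_or_lt_of_le (hc.2.trans ht.2) with hcτ | hcτ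
  · have := h.snd_eq
    rw [← hcτ, hc0, hS] at this
    linarith
  · have := h.neg c ⟨hc.1, hcτ⟩
    rw [flow_section_fst, hc0, hS] at this
    simp at this

lemma LeftArc.good {T D a y₀ y₁ τ : ℝ} (h : LeftArc T D a y₀ y₁ τ)
    (hy₀ : 0 < y₀) (hy₁ : y₁ < 0) : Good T D τ := by
  rcases lt_trichotomy T 0 with hT | rfl | hT
  · exact h.good_of_neg hT hy₀ hy₁
  · exact h.good_of_zero hy₀ hy₁
  · have := (h.rev.good_of_neg (by linarith) (by linarith) (by linarith)).neg
    rwa [neg_neg] at this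

/-- The ratio `S / P`. -/
noncomputable def kRatio (T D t : ℝ) : ℝ := fS T D t / fP T D t

lemma hasDerivAt_kRatio {T D t : ℝ} (h : fP T D t ≠ 0) :
    HasDerivAt (kRatio T D) (-fR T D t / fP T D t ^ 2) t := by
  refine ((hasDerivAt_fS T D t).div (hasDerivAt_fP T D t) h).congr_deriv ?_
  rw [fR]; congr 1; ring

/-- The ratio `R / P`, which is `- y₁ / y₀` along a return. -/
noncomputable def rRatio (T D t : ℝ) : ℝ := fR T D t / fP T D t

lemma hasDerivAt_rRatio {T D t : ℝ} (h : fP T D t ≠ 0) :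
    HasDerivAt (rRatio T D) (((fS T D t + T * fR T D t) * fP T D t - fR T D t * fS T D t)
      / fP T D t ^ 2) t :=
  (hasDerivAt_fR T D t).div (hasDerivAt_fP T D t) h

/-- The derivative of `S / P` is `-R / P²`; this is what the positivity of `R` is for. -/
lemma Good.strictAntiOn {T D τ : ℝ} (h : Good T D τ) : StrictAntiOn (kRatio T D) (Ioc 0 τ) := by
  refine strictAntiOn_of_deriv_neg (convex_Ioc _ _)
    (fun t ht => (hasDerivAt_kRatio (h t ht).1.ne').continuousAt.continuousWithinAt) fun t ht => ?_
  have ht := interior_subset ht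
  rw [(hasDerivAt_kRatio (h t ht).1.ne').deriv]
  have h1 := (h t ht).1
  have h2 := (h t ht).2
  rw [neg_div]
  exact neg_neg_of_pos (by positivity)

lemma Good.mono {T D τ τ' : ℝ} (h : Good T D τ) (hτ : τ' ≤ τ) : Good T D τ' :=
  fun t ht => h t ⟨ht.1, ht.2.trans hτ⟩

/-- Along the orbit `x = P(t) (a - y₀ k(t))` with `k = S / P` strictly decreasing, so `x < 0` until
`k` reaches `a / y₀`. Together with `LeftArc.eq_kRatio` this parametrizes the arcs by their flight
time. -/
lemma Good.leftArc {T D τ : ℝ} (h : Good T D τ) (hτ : 0 < τ) {a y₀ : ℝ} (hy₀ : 0 < y₀)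
    (ha : a = y₀ * kRatio T D τ) : LeftArc T D a y₀ (-(rRatio T D τ * y₀)) τ := by
  have hP := (h τ ⟨hτ, le_rfl⟩).1
  have haP : a * fP T D τ = y₀ * fS T D τ := by
    rw [ha, kRatio]; field_simp
  refine ⟨hτ, ?_, fun t ht => ?_⟩
  · ext
    · rw [flow_section_fst]; simp only; linarith
    · simp only [flow, rRatio]
      have hne := hP.ne'
      field_simp
      simp only [fR]
      linear_combination (T * fP T D τ - fS T D τ) * haP
  · have hPt := (h t ⟨ht.1, ht.2.le⟩).1
    have := h.strictAntiOn ⟨ht.1, ht.2.le⟩ ⟨hτ, le_rfl⟩ ht.2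
    rw [flow_section_fst]
    have h2 : fS T D t = kRatio T D t * fP T D t := by rw [kRatio]; field_simp
    rw [h2, ha]
    nlinarith [mul_pos (mul_pos hy₀ hPt) (sub_pos.2 this)]

lemma LeftArc.eq_kRatio {T D a y₀ y₁ τ : ℝ} (h : LeftArc T D a y₀ y₁ τ)
    (hy₀ : 0 < y₀) (hy₁ : y₁ < 0) : a = y₀ * kRatio T D τ ∧ y₁ = -(rRatio T D τ * y₀) := by
  have hP := (h.good hy₀ hy₁ τ ⟨h.pos, le_rfl⟩).1
  have h1 := h.fst_eq
  have h2 := h.mul_eq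
  rw [kRatio, rRatio]
  constructor
  · field_simp; linarith
  · field_simp; linarith

end LienardParams

/-! ### Comparison of ratio profiles through a singular linear equation -/

namespace LienardParams

lemma deriv_nonpos_of_pos_left {f : ℝ → ℝ} {f' a c : ℝ} (hf : HasDerivAt f f' c) (hac : a < c)
    (hc : f c = 0) (hpos : ∀ t ∈ Ioo a c, 0 < f t) : f' ≤ 0 := by
  by_contra h
  have h1 := hf.tendsto_slope_zero_left.eventually (lt_mem_nhds (not_le.1 h))
  have h2 : ∀ᶠ t in 𝓝[<] (0 : ℝ), a - c < t :=
    eventually_nhdsWithin_of_eventually_nhds (lt_mem_nhds (by linarith))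
  obtain ⟨s, ⟨hs1, hs2⟩, hs3⟩ := ((h1.and h2).and self_mem_nhdsWithin).exists
  have hs3 : s < 0 := hs3
  have h3 := hpos (c + s) ⟨by linarith, by linarith⟩
  rw [hc, smul_eq_mul, sub_zero] at hs1
  have : s⁻¹ < 0 := inv_lt_zero.2 hs3
  nlinarith

/-- If `|c| ≤ M`, then `u exp (M t)` is nonincreasing as long as `u` is negative, so `u` cannot
climb back to `0`. -/
lemma neg_of_linear_deriv {u c s : ℝ → ℝ} {a b : ℝ} (hab : a ≤ b)
    (hu : ∀ t ∈ Icc a b, HasDerivAt u (c t * u t - s t) t) (hc : ContinuousOn c (Icc a b))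
    (hs : ∀ t ∈ Icc a b, 0 ≤ s t) (ha : u a < 0) : u b < 0 := by
  by_contra hb
  have hab' : a < b := lt_of_le_of_ne hab fun h => hb (h ▸ ha)
  have huc : ContinuousOn u (Icc a b) := fun t ht => (hu t ht).continuousAt.continuousWithinAt
  obtain ⟨e, he, he0, hneg⟩ := exists_first_zero (f := fun t => -u t) huc.neg hab' (by
      have h1 := (hu a ⟨le_rfl, hab⟩).continuousAt.eventually (gt_mem_nhds ha)
      filter_upwards [mem_nhdsWithin_of_mem_nhds h1] with t ht
      linarith) (by simpa using hb)
  obtain ⟨M, hM⟩ := isCompact_Icc.exists_bound_of_continuousOn hc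
  have hd : ∀ t ∈ Icc a b, HasDerivAt (fun t => u t * Real.exp (M * t))
      ((c t * u t - s t + M * u t) * Real.exp (M * t)) t := fun t ht => by
    have h2 : HasDerivAt (fun t => Real.exp (M * t)) (Real.exp (M * t) * (M * 1)) t :=
      ((hasDerivAt_id t).const_mul M).exp
    exact ((hu t ht).mul h2).congr_deriv (by ring)
  have hanti : AntitoneOn (fun t => u t * Real.exp (M * t)) (Icc a e) := by
    refine antitoneOn_of_deriv_nonpos (convex_Icc _ _) (fun t ht =>
      (hd t ⟨ht.1, ht.2.trans he.2⟩).continuousAt.continuousWithinAt) (fun t ht => ?_) fun t ht => ?_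
    · rw [interior_Icc] at ht
      exact (hd t ⟨ht.1.le, ht.2.le.trans he.2⟩).differentiableAt.differentiableWithinAt
    · rw [interior_Icc] at ht
      have ht' : t ∈ Icc a b := ⟨ht.1.le, ht.2.le.trans he.2⟩
      rw [(hd t ht').deriv]
      refine mul_nonpos_of_nonpos_of_nonneg ?_ (Real.exp_pos _).le
      have h1 := hM t ht'
      have h2 := hneg t ht
      have h3 := hs t ht'
      rw [Real.norm_eq_abs] at h1
      have h4 := neg_abs_le (c t)
      nlinarith
  have h1 := hanti ⟨le_rfl, he.1.le⟩ ⟨he.1.le, le_rfl⟩ he.1.le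
  have h2 : u e = 0 := by linarith
  simp only [h2, zero_mul] at h1
  have := mul_neg_of_neg_of_pos ha (Real.exp_pos (M * a))
  linarith

/-- A one-parameter family of left half-maps, parametrized by the ratio `ρ = - y₁ / y₀`: the
normalized constant term `k` and the normalized return time `t` as functions of `ρ ∈ [q, 1)`. -/
structure RatioProfile (d q : ℝ) (k t : ℝ → ℝ) : Prop where
  q_pos : 0 < q
  hk : ∀ ρ ∈ Ico q 1,
    HasDerivAt k (-(ρ * (d - k ρ + k ρ ^ 2) / ((1 + ρ) * (ρ + k ρ * (1 - ρ))))) ρ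
  ht : ∀ ρ ∈ Ico q 1, HasDerivAt t (-1 / (ρ + k ρ * (1 - ρ))) ρ
  g_pos : ∀ ρ ∈ Ico q 1, 0 < ρ + k ρ * (1 - ρ)
  n_pos : ∀ ρ ∈ Ico q 1, 0 < d - k ρ + k ρ ^ 2
  g_lim : Tendsto (fun ρ => ρ + k ρ * (1 - ρ)) (𝓝[<] 1) (𝓝 (1 / 3))
  t_lim : Tendsto t (𝓝[<] 1) (𝓝 0)

namespace RatioProfile

variable {d₁ d₂ q : ℝ} {k₁ k₂ t₁ t₂ : ℝ → ℝ}

/-- The coefficient of the linear equation satisfied by `k₂ - k₁`. -/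
noncomputable def coeff (d₁ : ℝ) (k₁ k₂ : ℝ → ℝ) (ρ : ℝ) : ℝ :=
  -(ρ * ((k₁ ρ + k₂ ρ - 1) * (ρ + k₁ ρ * (1 - ρ)) - (d₁ - k₁ ρ + k₁ ρ ^ 2) * (1 - ρ))
    / ((1 + ρ) * ((ρ + k₁ ρ * (1 - ρ)) * (ρ + k₂ ρ * (1 - ρ)))))

/-- Apart from the source term carrying `d₂ - d₁`, the difference of the two right-hand sides is
divisible by `k₂ - k₁`. -/
lemma hasDerivAt_sub (h₁ : RatioProfile d₁ q k₁ t₁) (h₂ : RatioProfile d₂ q k₂ t₂) {ρ : ℝ}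
    (hρ : ρ ∈ Ico q 1) : HasDerivAt (fun ρ => k₂ ρ - k₁ ρ)
      (coeff d₁ k₁ k₂ ρ * (k₂ ρ - k₁ ρ)
        - ρ * (d₂ - d₁) / ((1 + ρ) * (ρ + k₂ ρ * (1 - ρ)))) ρ := by
  refine ((h₂.hk ρ hρ).sub (h₁.hk ρ hρ)).congr_deriv ?_
  have hg1 := (h₁.g_pos ρ hρ).ne'
  have hg2 := (h₂.g_pos ρ hρ).ne'
  have hq : 0 < ρ := h₁.q_pos.trans_le hρ.1
  have h3 : 1 + ρ ≠ 0 := by positivity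
  rw [coeff]
  generalize e1 : ρ + k₁ ρ * (1 - ρ) = g₁ at *
  generalize e2 : ρ + k₂ ρ * (1 - ρ) = g₂ at *
  field_simp
  rw [← e1, ← e2]
  ring

lemma continuousOn_coeff (h₁ : RatioProfile d₁ q k₁ t₁) (h₂ : RatioProfile d₂ q k₂ t₂) :
    ContinuousOn (coeff d₁ k₁ k₂) (Ico q 1) := by
  have hc1 : ContinuousOn k₁ (Ico q 1) := fun ρ hρ => (h₁.hk ρ hρ).continuousAt.continuousWithinAt
  have hc2 : ContinuousOn k₂ (Ico q 1) := fun ρ hρ => (h₂.hk ρ hρ).continuousAt.continuousWithinAt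
  unfold coeff
  refine ContinuousOn.neg (ContinuousOn.div (by fun_prop) (by fun_prop) fun ρ hρ => ?_)
  have hg1 := (h₁.g_pos ρ hρ)
  have hg2 := (h₂.g_pos ρ hρ)
  have hq : 0 < ρ := h₁.q_pos.trans_le hρ.1
  positivity

/-- As `ρ → 1` both speeds `ρ + k (1 - ρ)` tend to `1 / 3`. The leading part of `(1 - ρ) coeff` then
tends to `(4/3) / (2/3) = 2`, and the rest is nonnegative. The bound `1` suffices to make `(1 - ρ)
(k₂ - k₁)` nonincreasing where `k₂ < k₁`. -/
lemma eventually_coeff (h₁ : RatioProfile d₁ q k₁ t₁) (h₂ : RatioProfile d₂ q k₂ t₂) (hq : q < 1) :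
    ∀ᶠ ρ in 𝓝[<] (1 : ℝ), 1 ≤ (1 - ρ) * coeff d₁ k₁ k₂ ρ := by
  have hid : Tendsto (fun ρ : ℝ => ρ) (𝓝[<] (1 : ℝ)) (𝓝 1) := tendsto_id.mono_left nhdsWithin_le_nhds
  have hl : Tendsto (fun ρ => ρ * (1 + ρ - (ρ + k₁ ρ * (1 - ρ)) - (ρ + k₂ ρ * (1 - ρ)))
      / ((1 + ρ) * (ρ + k₂ ρ * (1 - ρ)))) (𝓝[<] 1)
      (𝓝 (1 * (1 + 1 - 1 / 3 - 1 / 3) / ((1 + 1) * (1 / 3)))) :=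
    (hid.mul (((hid.const_add 1).sub h₁.g_lim).sub h₂.g_lim)).div
      ((hid.const_add 1).mul h₂.g_lim) (by norm_num)
  have hmem : ∀ᶠ ρ in 𝓝[<] (1 : ℝ), ρ ∈ Ico q 1 := by
    filter_upwards [Ioo_mem_nhdsLT hq] with ρ hρ using ⟨hρ.1.le, hρ.2⟩
  filter_upwards [hl.eventually (lt_mem_nhds (show (1 : ℝ) < _ by norm_num)), hmem] with ρ h hρ
  refine h.le.trans ?_
  have hg1 := h₁.g_pos ρ hρ
  have hg2 := h₂.g_pos ρ hρ
  have hN := h₁.n_pos ρ hρ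
  have hρ0 : 0 < ρ := h₁.q_pos.trans_le hρ.1
  have h4 : 0 ≤ (1 - ρ) ^ 2 * ρ * (d₁ - k₁ ρ + k₁ ρ ^ 2)
      / ((1 + ρ) * ((ρ + k₁ ρ * (1 - ρ)) * (ρ + k₂ ρ * (1 - ρ)))) := by positivity
  have h5 : (1 - ρ) * coeff d₁ k₁ k₂ ρ
      = ρ * (1 + ρ - (ρ + k₁ ρ * (1 - ρ)) - (ρ + k₂ ρ * (1 - ρ)))
        / ((1 + ρ) * (ρ + k₂ ρ * (1 - ρ))) + (1 - ρ) ^ 2 * ρ * (d₁ - k₁ ρ + k₁ ρ ^ 2)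
      / ((1 + ρ) * ((ρ + k₁ ρ * (1 - ρ)) * (ρ + k₂ ρ * (1 - ρ)))) := by
    have := hg1.ne'
    have := hg2.ne'
    rw [coeff]
    generalize e1 : ρ + k₁ ρ * (1 - ρ) = g₁ at *
    generalize e2 : ρ + k₂ ρ * (1 - ρ) = g₂ at *
    field_simp
    rw [← e1, ← e2]
    ring
  linarith

/-- If `k₂ - k₁` is negative at `ρ`, it stays negative up to `1`. Near `1` the product `(1 - ρ) (k₂
- k₁)` is then negative and nonincreasing. But it is the difference of the two speeds, which tends
to `1/3 - 1/3 = 0`. -/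
lemma k_le (h₁ : RatioProfile d₁ q k₁ t₁) (h₂ : RatioProfile d₂ q k₂ t₂) (hd : d₁ ≤ d₂) {ρ : ℝ}
    (hρ : ρ ∈ Ico q 1) : k₁ ρ ≤ k₂ ρ := by
  by_contra hlt
  have hq : q < 1 := hρ.1.trans_lt hρ.2
  have hs : ∀ x ∈ Ico q 1, 0 ≤ x * (d₂ - d₁) / ((1 + x) * (x + k₂ x * (1 - x))) := fun x hx => by
    have hg2 := h₂.g_pos x hx
    have hx0 : 0 < x := h₁.q_pos.trans_le hx.1
    have := sub_nonneg.2 hd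
    positivity
  have hneg : ∀ x ∈ Ico ρ 1, k₂ x - k₁ x < 0 := fun x hx => by
    have hsub : Icc ρ x ⊆ Ico q 1 := fun y hy => ⟨hρ.1.trans hy.1, hy.2.trans_lt hx.2⟩
    exact neg_of_linear_deriv (u := fun ρ => k₂ ρ - k₁ ρ) hx.1
      (fun y hy => h₁.hasDerivAt_sub h₂ (hsub hy)) ((h₁.continuousOn_coeff h₂).mono hsub)
      (fun y hy => hs y (hsub hy)) (by linarith)
  obtain ⟨l, hl, hl'⟩ := (mem_nhdsLT_iff_exists_Ioo_subset).1 (h₁.eventually_coeff h₂ hq)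
  have hl : l < 1 := hl
  obtain ⟨b, hb, hb1⟩ := exists_between (max_lt hl hρ.2)
  have hlb : l < b := (le_max_left _ _).trans_lt hb
  have hρb : ρ < b := (le_max_right _ _).trans_lt hb
  have hd' : ∀ x ∈ Ico b 1, HasDerivAt (fun x => (1 - x) * (k₂ x - k₁ x))
      ((-1) * (k₂ x - k₁ x) + (1 - x) * (coeff d₁ k₁ k₂ x * (k₂ x - k₁ x)
        - x * (d₂ - d₁) / ((1 + x) * (x + k₂ x * (1 - x))))) x := fun x hx =>
    ((hasDerivAt_id x).const_sub 1).mul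
      (h₁.hasDerivAt_sub h₂ ⟨hρ.1.trans (hρb.le.trans hx.1), hx.2⟩)
  have hanti : AntitoneOn (fun x => (1 - x) * (k₂ x - k₁ x)) (Ico b 1) := by
    refine antitoneOn_of_deriv_nonpos (convex_Ico _ _)
      (fun x hx => (hd' x hx).continuousAt.continuousWithinAt)
      (fun x hx => (hd' x (interior_subset hx)).differentiableAt.differentiableWithinAt)
      fun x hx => ?_
    have hx := interior_subset hx
    rw [(hd' x hx).deriv]
    have e1 : 1 ≤ (1 - x) * coeff d₁ k₁ k₂ x := hl' ⟨hlb.trans_le hx.1, hx.2⟩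
    have e2 := hneg x ⟨hρb.le.trans hx.1, hx.2⟩
    have e3 := hs x ⟨hρ.1.trans (hρb.le.trans hx.1), hx.2⟩
    nlinarith [mul_nonneg (sub_nonneg.2 hx.2.le) e3, mul_nonneg (sub_nonneg.2 e1) (neg_nonneg.2 e2.le)]
  have hlim : Tendsto (fun x => (1 - x) * (k₂ x - k₁ x)) (𝓝[<] 1) (𝓝 (1 / 3 - 1 / 3)) :=
    (h₂.g_lim.sub h₁.g_lim).congr fun x => by ring
  have hle := le_of_tendsto hlim (b := (1 - b) * (k₂ b - k₁ b)) (by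
    filter_upwards [Ioo_mem_nhdsLT hb1] with x hx
    exact hanti ⟨le_rfl, hb1⟩ ⟨hx.1.le, hx.2⟩ hx.1.le)
  nlinarith [hneg b ⟨hρb.le, hb1⟩]

/-- Where `k₁ = k₂` only the source term is left in the derivative of `k₂ - k₁`. It is negative, so
`k₂ < k₁` just to the right, against `k_le`. -/
lemma k_lt (h₁ : RatioProfile d₁ q k₁ t₁) (h₂ : RatioProfile d₂ q k₂ t₂) (hd : d₁ < d₂) {ρ : ℝ}
    (hρ : ρ ∈ Ico q 1) : k₁ ρ < k₂ ρ := by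
  refine lt_of_le_of_ne (h₁.k_le h₂ hd.le hρ) fun heq => ?_
  have hder := h₁.hasDerivAt_sub h₂ hρ
  have hg2 := h₂.g_pos ρ hρ
  have hρ0 : 0 < ρ := h₁.q_pos.trans_le hρ.1
  have hneg : coeff d₁ k₁ k₂ ρ * (k₂ ρ - k₁ ρ)
        - ρ * (d₂ - d₁) / ((1 + ρ) * (ρ + k₂ ρ * (1 - ρ))) < 0 := by
    have := sub_pos.2 hd
    have : 0 < ρ * (d₂ - d₁) / ((1 + ρ) * (ρ + k₂ ρ * (1 - ρ))) := by positivity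
    rw [heq, sub_self, mul_zero]
    linarith
  have h1 := hder.tendsto_slope_zero_right.eventually (gt_mem_nhds hneg)
  have h2 : ∀ᶠ s in 𝓝[>] (0 : ℝ), s < 1 - ρ :=
    eventually_nhdsWithin_of_eventually_nhds (gt_mem_nhds (by linarith [hρ.2]))
  obtain ⟨s, ⟨hs1, hs2⟩, hs3⟩ := ((h1.and h2).and self_mem_nhdsWithin).exists
  have hs3 : 0 < s := hs3
  have h3 := h₁.k_le h₂ hd.le (ρ := ρ + s) ⟨by linarith [hρ.1], by linarith⟩
  rw [smul_eq_mul, heq, sub_self, sub_zero] at hs1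
  have : 0 ≤ s⁻¹ * (k₂ (ρ + s) - k₁ (ρ + s)) := mul_nonneg (by positivity) (by linarith)
  linarith

lemma hasDerivAt_time_sub (h₁ : RatioProfile d₁ q k₁ t₁) (h₂ : RatioProfile d₂ q k₂ t₂) {ρ : ℝ}
    (hρ : ρ ∈ Ico q 1) : HasDerivAt (fun ρ => t₂ ρ - t₁ ρ)
      ((1 - ρ) * (k₂ ρ - k₁ ρ) / ((ρ + k₁ ρ * (1 - ρ)) * (ρ + k₂ ρ * (1 - ρ)))) ρ := by
  refine ((h₂.ht ρ hρ).sub (h₁.ht ρ hρ)).congr_deriv ?_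
  have hg1 := (h₁.g_pos ρ hρ).ne'
  have hg2 := (h₂.g_pos ρ hρ).ne'
  generalize e1 : ρ + k₁ ρ * (1 - ρ) = g₁ at *
  generalize e2 : ρ + k₂ ρ * (1 - ρ) = g₂ at *
  field_simp
  rw [← e1, ← e2]
  ring

/-- The derivative of `t₂ - t₁` has the sign of `k₂ - k₁`, and both times tend to `0` as `ρ → 1`. -/
lemma time_le (h₁ : RatioProfile d₁ q k₁ t₁) (h₂ : RatioProfile d₂ q k₂ t₂) (hd : d₁ ≤ d₂) {ρ : ℝ}
    (hρ : ρ ∈ Ico q 1) : t₂ ρ ≤ t₁ ρ := by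
  have hmono : MonotoneOn (fun ρ => t₂ ρ - t₁ ρ) (Ico q 1) := by
    refine monotoneOn_of_deriv_nonneg (convex_Ico _ _)
      (fun x hx => (h₁.hasDerivAt_time_sub h₂ hx).continuousAt.continuousWithinAt)
      (fun x hx => (h₁.hasDerivAt_time_sub h₂
        (interior_subset hx)).differentiableAt.differentiableWithinAt) fun x hx => ?_
    have hx := interior_subset hx
    rw [(h₁.hasDerivAt_time_sub h₂ hx).deriv]
    have hg1 := h₁.g_pos x hx
    have hg2 := h₂.g_pos x hx
    have h3 := sub_nonneg.2 (h₁.k_le h₂ hd hx)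
    have h4 := sub_nonneg.2 hx.2.le
    positivity
  have hlim : Tendsto (fun ρ => t₂ ρ - t₁ ρ) (𝓝[<] 1) (𝓝 (0 - 0)) := h₂.t_lim.sub h₁.t_lim
  have := ge_of_tendsto hlim (b := t₂ ρ - t₁ ρ) (by
    filter_upwards [Ioo_mem_nhdsLT hρ.2] with x hx
    exact hmono hρ ⟨hρ.1.trans hx.1.le, hx.2⟩ hx.1.le)
  linarith

lemma time_lt (h₁ : RatioProfile d₁ q k₁ t₁) (h₂ : RatioProfile d₂ q k₂ t₂) (hd : d₁ < d₂) {ρ : ℝ}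
    (hρ : ρ ∈ Ico q 1) : t₂ ρ < t₁ ρ := by
  have hmono : StrictMonoOn (fun ρ => t₂ ρ - t₁ ρ) (Ico q 1) := by
    refine strictMonoOn_of_deriv_pos (convex_Ico _ _)
      (fun x hx => (h₁.hasDerivAt_time_sub h₂ hx).continuousAt.continuousWithinAt) fun x hx => ?_
    have hx := interior_subset hx
    rw [(h₁.hasDerivAt_time_sub h₂ hx).deriv]
    have hg1 := h₁.g_pos x hx
    have hg2 := h₂.g_pos x hx
    have h3 := sub_pos.2 (h₁.k_lt h₂ hd hx)
    have h4 := sub_pos.2 hx.2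
    positivity
  -- The limit at `1` yields only a weak inequality; strictness is gained between `ρ` and an
  -- intermediate point.
  obtain ⟨x, hx, hx'⟩ := exists_between hρ.2
  have h1 := h₁.time_le h₂ hd.le (ρ := x) ⟨hρ.1.trans hx.le, hx'⟩
  have h2 := hmono hρ ⟨hρ.1.trans hx.le, hx'⟩ hx
  simp only at h2
  linarith

end RatioProfile

/-- The inverse is taken on all of `(0, b)` with `b > τ`, so that its derivative is two-sided even
at the endpoint `r τ`. -/
lemma exists_inverse {r g : ℝ → ℝ} {b τ : ℝ} (hτ : τ ∈ Ioo 0 b)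
    (hr : ∀ t ∈ Ioo 0 b, HasDerivAt r (-g t) t) (hg : ∀ t ∈ Ioo 0 b, 0 < g t)
    (hgc : ContinuousOn g (Ioo 0 b)) (hr1 : ∀ t ∈ Ioo 0 b, r t < 1)
    (hlim : Tendsto r (𝓝[>] 0) (𝓝 1)) :
    ∃ s : ℝ → ℝ, (∀ ρ ∈ Ico (r τ) 1, s ρ ∈ Ioc 0 τ ∧ r (s ρ) = ρ ∧
      HasDerivAt s (-(g (s ρ))⁻¹) ρ) ∧ Tendsto s (𝓝[<] 1) (𝓝[>] 0) ∧ s (r τ) = τ := by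
  have hanti : StrictAntiOn r (Ioo 0 b) :=
    strictAntiOn_of_deriv_neg (convex_Ioo _ _)
      (fun t ht => (hr t ht).continuousAt.continuousWithinAt) fun t ht => by
        rw [interior_Ioo] at ht
        rw [(hr t ht).deriv]; linarith [hg t ht]
  have hex : ∀ ρ ∈ Ico (r τ) 1, ∃ t ∈ Ioc 0 τ, r t = ρ := fun ρ hρ => by
    have h1 := hlim.eventually (lt_mem_nhds hρ.2)
    obtain ⟨e, he, he'⟩ := (h1.and (Ioo_mem_nhdsGT hτ.1)).exists
    have hsub : Icc e τ ⊆ Ioo 0 b := fun t ht => ⟨he'.1.trans_le ht.1, ht.2.trans_lt hτ.2⟩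
    obtain ⟨t, ht, rfl⟩ := intermediate_value_Icc' he'.2.le
      (fun t ht => (hr t (hsub ht)).continuousAt.continuousWithinAt) ⟨hρ.1, he.le⟩
    exact ⟨t, ⟨he'.1.trans_le ht.1, ht.2⟩, rfl⟩
  obtain ⟨b', hb', hb'b⟩ := exists_between hτ.2
  have hex' : ∀ ρ : ℝ, ∃ t, (∃ t' ∈ Ioo 0 b, r t' = ρ) → t ∈ Ioo 0 b ∧ r t = ρ := fun ρ => by
    by_cases h : ∃ t' ∈ Ioo 0 b, r t' = ρ
    · obtain ⟨t, ht, htρ⟩ := h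
      exact ⟨t, fun _ => ⟨ht, htρ⟩⟩
    · exact ⟨0, fun h' => absurd h' h⟩
  choose s hs using hex'
  have hsr : ∀ t ∈ Ioo 0 b, s (r t) = t := fun t ht => by
    obtain ⟨h1, h2⟩ := hs (r t) ⟨t, ht, rfl⟩
    exact hanti.injOn h1 ht h2
  have hsub : Ioc 0 τ ⊆ Ioo 0 b := fun t ht => ⟨ht.1, ht.2.trans_lt hτ.2⟩
  refine ⟨s, fun ρ hρ => ?_, ?_, hsr τ hτ⟩
  · obtain ⟨t, ht, rfl⟩ := hex ρ hρ
    have htb := hsub ht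
    rw [hsr t htb]
    refine ⟨ht, rfl, ?_⟩
    have hstrict : HasStrictDerivAt r (-g t) t :=
      hasStrictDerivAt_of_hasDerivAt_of_continuousAt
        (by filter_upwards [Ioo_mem_nhds htb.1 htb.2] with x hx using hr x hx)
        ((hgc.continuousAt (Ioo_mem_nhds htb.1 htb.2)).neg)
    have hne : -g t ≠ 0 := (neg_neg_of_pos (hg t htb)).ne
    have hinv := hstrict.to_localInverse hne
    rw [inv_neg] at hinv
    refine hinv.hasDerivAt.congr_of_eventuallyEq ?_
    have h1 := hstrict.eventually_right_inverse hne
    have h2 : ∀ᶠ x in 𝓝 (r t), hstrict.localInverse r (-g t) t hne x ∈ Ioo 0 b := by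
      have := hinv.hasDerivAt.continuousAt.tendsto
      rw [HasStrictDerivAt.localInverse, HasStrictFDerivAt.localInverse_apply_image] at this
      exact this (Ioo_mem_nhds htb.1 htb.2)
    filter_upwards [h1, h2] with x hx1 hx2
    conv_lhs => rw [← hx1]
    exact hsr _ hx2
  · rw [(nhdsGT_basis (0 : ℝ)).tendsto_right_iff]
    intro ε hε
    have hm : min ε τ ∈ Ioc 0 τ := ⟨lt_min hε hτ.1, min_le_right _ _⟩
    have hrm := hr1 _ (hsub hm)
    filter_upwards [Ioo_mem_nhdsLT hrm] with ρ hρ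
    obtain ⟨t, ht, rfl⟩ := hex ρ ⟨(hanti.antitoneOn (hsub hm) hτ hm.2).trans hρ.1.le, hρ.2⟩
    rw [hsr t (hsub ht)]
    refine ⟨ht.1, lt_of_lt_of_le ?_ (min_le_left ε τ)⟩
    by_contra h
    exact absurd (hanti.antitoneOn (hsub hm) (hsub ht) (not_lt.1 h)) (not_le.2 hρ.1)

end LienardParams

/-! ### The ratio profile of a linear system -/

namespace LienardParams

lemma Good.exists_gt {T D τ : ℝ} (h : Good T D τ) (hτ : 0 < τ) : ∃ b, τ < b ∧ Good T D b := by
  have h1 : ∀ᶠ t in 𝓝 τ, 0 < fP T D t ∧ 0 < fR T D t :=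
    ((continuous_fP T D).continuousAt.eventually (lt_mem_nhds (h τ ⟨hτ, le_rfl⟩).1)).and
      ((continuous_fR T D).continuousAt.eventually (lt_mem_nhds (h τ ⟨hτ, le_rfl⟩).2))
  obtain ⟨u, hu, hu'⟩ := (mem_nhdsGE_iff_exists_Icc_subset).1 (mem_nhdsWithin_of_mem_nhds h1)
  refine ⟨u, hu, fun t ht => ?_⟩
  rcases le_total t τ with h2 | h2
  · exact h t ⟨ht.1, h2⟩
  · exact hu' ⟨h2, ht.2⟩

lemma fP_sub_fR_strictMonoOn {T D b : ℝ} (hT : T < 0) (h : Good T D b) :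
    StrictMonoOn (fun t => fP T D t - fR T D t) (Icc 0 b) := by
  have hd : ∀ t, HasDerivAt (fun t => fP T D t - fR T D t) (-T * fR T D t) t := fun t =>
    ((hasDerivAt_fP T D t).sub (hasDerivAt_fR T D t)).congr_deriv (by ring)
  refine strictMonoOn_of_deriv_pos (convex_Icc _ _)
    (fun t _ => (hd t).continuousAt.continuousWithinAt) fun t ht => ?_
  rw [interior_Icc] at ht
  rw [(hd t).deriv]
  exact mul_pos (by linarith) (h t ⟨ht.1, ht.2.le⟩).2

lemma rRatio_lt_one {T D τ : ℝ} (hT : T < 0) (h : Good T D τ) (hτ : 0 < τ) : rRatio T D τ < 1 := by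
  have h1 := fP_sub_fR_strictMonoOn hT h ⟨le_rfl, hτ.le⟩ ⟨hτ.le, le_rfl⟩ hτ
  simp only [fP_zero, fR_zero, sub_self] at h1
  rw [rRatio, div_lt_one (h τ ⟨hτ, le_rfl⟩).1]
  linarith

lemma rRatio_zero {D τ : ℝ} (h : Good 0 D τ) (hτ : 0 < τ) : rRatio 0 D τ = 1 := by
  have := fR_eq_exp_mul_fP 0 D τ
  simp only [zero_mul, Real.exp_zero, neg_zero, one_mul] at this
  rw [rRatio, this, div_self (h τ ⟨hτ, le_rfl⟩).1.ne']

/-- The speed at which `rRatio` decreases in normalized time. -/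
noncomputable def gSpeed (T D t : ℝ) : ℝ :=
  rRatio T D t + kRatio T D t / T * (1 - rRatio T D t)

lemma hasDerivAt_rRatio' {T D t : ℝ} (hT : T ≠ 0) (h : fP T D t ≠ 0) :
    HasDerivAt (rRatio T D) (-(-T * gSpeed T D t)) t := by
  refine (hasDerivAt_rRatio h).congr_deriv ?_
  rw [gSpeed, rRatio, kRatio]
  field_simp
  ring

/-- The numerator of the profile equation becomes manifestly positive, and its factor `1 + ρ`
cancels the one in the denominator. -/
lemma kRatio_identity {T D t : ℝ} (hT : T ≠ 0) (hP : fP T D t ≠ 0) :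
    (D / T ^ 2 - kRatio T D t / T + (kRatio T D t / T) ^ 2)
      = (1 + rRatio T D t) / (T ^ 2 * fP T D t) := by
  rw [kRatio, rRatio]
  field_simp
  rw [fR]; ring

lemma hasDerivAt_gSpeed {T D t : ℝ} (hT : T ≠ 0) (h : fP T D t ≠ 0) :
    HasDerivAt (gSpeed T D) (T * gSpeed T D t * (1 - kRatio T D t / T)
      - rRatio T D t * (1 - rRatio T D t) / (T * fP T D t)) t := by
  have h1 := hasDerivAt_rRatio' (D := D) hT h
  have h2 := (hasDerivAt_kRatio (T := T) (D := D) h).div_const T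
  refine (h1.add (h2.mul (h1.const_sub 1))).congr_deriv ?_
  have h3 : fR T D t = rRatio T D t * fP T D t := by rw [rRatio]; field_simp
  rw [h3]
  field_simp
  ring

lemma rRatio_tendsto (T D : ℝ) : Tendsto (rRatio T D) (𝓝[>] 0) (𝓝 1) := by
  have h := (fR_div_tendsto T D).div (fP_div_tendsto T D) (by norm_num)
  norm_num at h
  refine h.congr' ?_
  filter_upwards [eventually_gt_ne_zero, fP_eventually_pos T D] with t ht hP
  simp only [Pi.div_apply, rRatio]
  field_simp

/-- Written as `R / P + S (P - R) / (T P²)`, the speed tends to `1 - (1/6) / (1/4) = 1/3`. -/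
lemma gSpeed_tendsto {T : ℝ} (hT : T ≠ 0) (D : ℝ) :
    Tendsto (gSpeed T D) (𝓝[>] 0) (𝓝 (1 / 3)) := by
  have h := ((fS_div_tendsto T D).mul (fP_sub_fR_div_tendsto T D)).div
    (((fP_div_tendsto T D).pow 2).const_mul T) (by
      simp only [ne_eq, mul_eq_zero, hT, false_or]; norm_num)
  have h2 := (rRatio_tendsto T D).add h
  have e : 1 + 1 * (-T / 6) / (T * (1 / 2) ^ 2) = 1 / 3 := by field_simp; norm_num
  rw [e] at h2
  refine h2.congr' ?_
  filter_upwards [eventually_gt_ne_zero, fP_eventually_pos T D] with t ht hP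
  simp only [Pi.div_apply, gSpeed, rRatio, kRatio]
  field_simp

/-- At a first zero of the speed only `-ρ (1 - ρ) / (T P)` is left in its derivative. For `T < 0`
and `0 < ρ < 1` this is positive, whereas a function coming down to its first zero has derivative at
most `0`. -/
lemma gSpeed_pos {T D b : ℝ} (hT : T < 0) (h : Good T D b) {t : ℝ} (ht : t ∈ Ioc 0 b) :
    0 < gSpeed T D t := by
  by_contra hneg
  -- The formula degenerates at `0`, where `P` vanishes; the value there is the limit `1 / 3`.
  set f : ℝ → ℝ := fun t => if t = 0 then 1 / 3 else gSpeed T D t with hf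
  have hft : ∀ s, 0 < s → f s = gSpeed T D s := fun s hs => by simp [hf, hs.ne']
  have hfe : ∀ s, 0 < s → f =ᶠ[𝓝 s] gSpeed T D := fun s hs => by
    filter_upwards [lt_mem_nhds hs] with x hx using hft x hx
  have hfd : ∀ s ∈ Ioc 0 b, HasDerivAt f _ s := fun s hs =>
    (hasDerivAt_gSpeed hT.ne (h s hs).1.ne').congr_of_eventuallyEq (hfe s hs.1)
  have hpos : ∀ᶠ s in 𝓝[>] (0 : ℝ), 0 < f s := by
    filter_upwards [(gSpeed_tendsto hT.ne D).eventually
      (lt_mem_nhds (show (0 : ℝ) < 1 / 3 by norm_num)), eventually_gt_ne_zero] with s hs hs'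
    rw [hft s hs']; exact hs
  have hcont : ContinuousOn f (Icc 0 t) := by
    intro s hs
    rcases eq_or_lt_of_le hs.1 with rfl | hs0
    · have h0 : Tendsto f (𝓝[>] 0) (𝓝 (f 0)) := by
        rw [show f 0 = 1 / 3 by simp [hf]]
        refine (gSpeed_tendsto hT.ne D).congr' ?_
        filter_upwards [eventually_gt_ne_zero] with s hs' using (hft s hs').symm
      have : ContinuousWithinAt f (Ioi 0) 0 := h0
      exact (continuousWithinAt_Ioi_iff_Ici.1 this).mono fun x hx => hx.1
    · exact (hfd s ⟨hs0, hs.2.trans ht.2⟩).continuousAt.continuousWithinAt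
  obtain ⟨c, hc, hc0, hcpos⟩ := exists_first_zero hcont ht.1 hpos
    (by rw [hft t ht.1]; exact not_lt.1 hneg)
  have hcb : c ∈ Ioc 0 b := ⟨hc.1, hc.2.trans ht.2⟩
  have h1 := deriv_nonpos_of_pos_left (hfd c hcb) hc.1 hc0 hcpos
  rw [← hft c hc.1, hc0] at h1
  have hP := (h c hcb).1
  have hr : 0 < rRatio T D c := div_pos (h c hcb).2 hP
  have hr1 : rRatio T D c < 1 := rRatio_lt_one hT (h.mono hcb.2) hc.1
  have h2 : rRatio T D c * (1 - rRatio T D c) / (T * fP T D c) < 0 :=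
    div_neg_of_pos_of_neg (mul_pos hr (by linarith)) (mul_neg_of_neg_of_pos hT hP)
  linarith

/-- `R / P` decreases from `1` in time, so it can serve as the independent variable. Dividing `k` by
`T` and multiplying time by `-T` leaves `D / T²` as the only parameter. -/
lemma Good.exists_ratioProfile {T D τ : ℝ} (hT : T < 0) (h : Good T D τ) (hτ : 0 < τ) :
    ∃ k t, RatioProfile (D / T ^ 2) (rRatio T D τ) k t ∧
      k (rRatio T D τ) = kRatio T D τ / T ∧ t (rRatio T D τ) = -T * τ := by
  obtain ⟨b, hb, hgb⟩ := h.exists_gt hτ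
  have hP : ∀ t ∈ Ioo 0 b, fP T D t ≠ 0 := fun t ht => (hgb t ⟨ht.1, ht.2.le⟩).1.ne'
  obtain ⟨s, hs, hslim, hsτ⟩ := exists_inverse (r := rRatio T D) (g := fun t => -T * gSpeed T D t)
    ⟨hτ, hb⟩ (fun t ht => hasDerivAt_rRatio' hT.ne (hP t ht))
    (fun t ht => mul_pos (by linarith) (gSpeed_pos hT hgb ⟨ht.1, ht.2.le⟩))
    (fun t ht => ((hasDerivAt_gSpeed hT.ne (hP t ht)).continuousAt.const_smul
      (-T)).continuousWithinAt)
    (fun t ht => rRatio_lt_one hT (hgb.mono ht.2.le) ht.1) (rRatio_tendsto T D)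
  have hq : 0 < rRatio T D τ := div_pos (h τ ⟨hτ, le_rfl⟩).2 (h τ ⟨hτ, le_rfl⟩).1
  have hg : ∀ ρ ∈ Ico (rRatio T D τ) 1, ρ + kRatio T D (s ρ) / T * (1 - ρ) = gSpeed T D (s ρ) :=
    fun ρ hρ => by rw [gSpeed, (hs ρ hρ).2.1]
  have hmem : ∀ᶠ ρ in 𝓝[<] (1 : ℝ), ρ ∈ Ico (rRatio T D τ) 1 := by
    filter_upwards [Ioo_mem_nhdsLT (rRatio_lt_one hT h hτ)] with ρ hρ using ⟨hρ.1.le, hρ.2⟩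
  refine ⟨fun ρ => kRatio T D (s ρ) / T, fun ρ => -T * s ρ, ⟨hq, fun ρ hρ => ?_, fun ρ hρ => ?_,
    fun ρ hρ => ?_, fun ρ hρ => ?_, ?_, ?_⟩, by simp only [hsτ], by simp only [hsτ]⟩
  · obtain ⟨hs1, hs2, hs3⟩ := hs ρ hρ
    have hPs := h (s ρ) hs1
    have h1 := ((hasDerivAt_kRatio (T := T) (D := D) hPs.1.ne').comp ρ hs3).div_const T
    refine h1.congr_deriv ?_
    have hgs := gSpeed_pos hT h hs1
    have hρ0 : 0 < 1 + ρ := by linarith [hρ.1]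
    simp only [hg ρ hρ]
    rw [kRatio_identity hT.ne hPs.1.ne', hs2]
    have h3 : fR T D (s ρ) = ρ * fP T D (s ρ) := by
      have h4 : rRatio T D (s ρ) * fP T D (s ρ) = fR T D (s ρ) := by
        rw [rRatio, div_mul_cancel₀ _ hPs.1.ne']
      rw [← h4, hs2]
    have := hPs.1.ne'
    have := hgs.ne'
    have := hT.ne
    rw [h3]
    field_simp
  · obtain ⟨hs1, hs2, hs3⟩ := hs ρ hρ
    refine (hs3.const_mul (-T)).congr_deriv ?_
    have hgs := (gSpeed_pos hT h hs1).ne'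
    have := hT.ne
    simp only [hg ρ hρ]
    field_simp
  · simp only [hg ρ hρ]
    exact gSpeed_pos hT h (hs ρ hρ).1
  · obtain ⟨hs1, hs2, hs3⟩ := hs ρ hρ
    have hPs := (h (s ρ) hs1).1
    rw [kRatio_identity hT.ne hPs.ne', hs2]
    have hρ0 : 0 < 1 + ρ := by linarith [hρ.1]
    have := sq_pos_of_neg hT
    positivity
  · refine ((gSpeed_tendsto hT.ne D).comp hslim).congr' ?_
    filter_upwards [hmem] with ρ hρ
    exact (hg ρ hρ).symm
  · have := (hslim.mono_right nhdsWithin_le_nhds).const_mul (-T)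
    simpa using this

/-! ### Two arcs with common endpoints -/

lemma LeftArc.rRatio_eq {T D a y₀ y₁ τ : ℝ} (h : LeftArc T D a y₀ y₁ τ)
    (hy₀ : 0 < y₀) (hy₁ : y₁ < 0) : rRatio T D τ = -y₁ / y₀ := by
  rw [(h.eq_kRatio hy₀ hy₁).2]; field_simp

/-- Common endpoints mean a common ratio `ρ`, so the two profiles are compared at the same point.
There `k = a / (T y₀)` and `t = -T τ`, which translates `k_lt` and `time_lt` into the two claims. -/
lemma LeftArc.sign_of_neg {T₁ D₁ a₁ τ₁ T₂ D₂ a₂ τ₂ y₀ y₁ : ℝ} (h₁ : LeftArc T₁ D₁ a₁ y₀ y₁ τ₁)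
    (h₂ : LeftArc T₂ D₂ a₂ y₀ y₁ τ₂) (hy₀ : 0 < y₀) (hy₁ : y₁ < 0) (hT₁ : T₁ < 0) (hT₂ : T₂ < 0) :
    (D₁ / T₁ ^ 2 < D₂ / T₂ ^ 2 → T₁ * τ₁ < T₂ * τ₂ ∧ a₁ * T₂ - a₂ * T₁ < 0) ∧
      (D₁ / T₁ ^ 2 ≤ D₂ / T₂ ^ 2 → T₁ * τ₁ ≤ T₂ * τ₂ ∧ a₁ * T₂ - a₂ * T₁ ≤ 0) := by
  have g₁ := h₁.good hy₀ hy₁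
  have g₂ := h₂.good hy₀ hy₁
  obtain ⟨k₁, t₁, p₁, hk₁, ht₁⟩ := g₁.exists_ratioProfile hT₁ h₁.pos
  obtain ⟨k₂, t₂, p₂, hk₂, ht₂⟩ := g₂.exists_ratioProfile hT₂ h₂.pos
  have hr1 := rRatio_lt_one hT₁ g₁ h₁.pos
  rw [h₂.rRatio_eq hy₀ hy₁] at p₂ hk₂ ht₂
  rw [h₁.rRatio_eq hy₀ hy₁] at p₁ hk₁ ht₁ hr1
  have hmem : -y₁ / y₀ ∈ Ico (-y₁ / y₀) 1 := ⟨le_rfl, hr1⟩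
  have hTT : 0 < T₁ * T₂ := mul_pos_of_neg_of_neg hT₁ hT₂
  have e : a₁ * T₂ - a₂ * T₁ = y₀ * (T₁ * T₂) * (k₁ (-y₁ / y₀) - k₂ (-y₁ / y₀)) := by
    rw [hk₁, hk₂, (h₁.eq_kRatio hy₀ hy₁).1, (h₂.eq_kRatio hy₀ hy₁).1]
    have := hT₁.ne
    have := hT₂.ne
    field_simp
  constructor
  · intro hd
    have h3 := p₁.time_lt p₂ hd hmem
    have h4 := p₁.k_lt p₂ hd hmem
    rw [ht₁, ht₂] at h3
    refine ⟨by linarith, ?_⟩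
    rw [e]
    exact mul_neg_of_pos_of_neg (by positivity) (by linarith)
  · intro hd
    have h3 := p₁.time_le p₂ hd hmem
    have h4 := p₁.k_le p₂ hd hmem
    rw [ht₁, ht₂] at h3
    refine ⟨by linarith, ?_⟩
    rw [e]
    exact mul_nonpos_of_nonneg_of_nonpos (by positivity) (by linarith)

lemma LeftArc.sign_eq_of_neg {T₁ D₁ a₁ τ₁ T₂ D₂ a₂ τ₂ y₀ y₁ : ℝ} (h₁ : LeftArc T₁ D₁ a₁ y₀ y₁ τ₁)
    (h₂ : LeftArc T₂ D₂ a₂ y₀ y₁ τ₂) (hy₀ : 0 < y₀) (hy₁ : y₁ < 0) (hT₁ : T₁ < 0) (hT₂ : T₂ < 0) :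
    SignType.sign (T₁ * τ₁ - T₂ * τ₂) = SignType.sign (a₁ * T₂ - a₂ * T₁) := by
  obtain ⟨h1, h2⟩ := h₁.sign_of_neg h₂ hy₀ hy₁ hT₁ hT₂
  obtain ⟨h3, h4⟩ := h₂.sign_of_neg h₁ hy₀ hy₁ hT₂ hT₁
  rcases lt_trichotomy (D₁ / T₁ ^ 2) (D₂ / T₂ ^ 2) with hd | hd | hd
  · obtain ⟨h5, h6⟩ := h1 hd
    rw [sign_neg h6, sign_neg (by linarith)]
  · obtain ⟨h5, h6⟩ := h2 hd.le
    obtain ⟨h7, h8⟩ := h4 hd.ge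
    rw [show a₁ * T₂ - a₂ * T₁ = 0 by linarith, show T₁ * τ₁ - T₂ * τ₂ = 0 by linarith]
  · obtain ⟨h5, h6⟩ := h3 hd
    rw [sign_pos (show 0 < a₁ * T₂ - a₂ * T₁ by linarith), sign_pos (by linarith)]

/-- Since `y₀ + y₁ = y₀ (1 - R / P)`, this is the position of `R / P` relative to `1`. It forces
arcs with common endpoints to have traces of the same sign. -/
lemma LeftArc.trichotomy {T D a y₀ y₁ τ : ℝ} (h : LeftArc T D a y₀ y₁ τ)
    (hy₀ : 0 < y₀) (hy₁ : y₁ < 0) :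
    (T < 0 → 0 < y₀ + y₁) ∧ (T = 0 → y₀ + y₁ = 0) ∧ (0 < T → y₀ + y₁ < 0) := by
  have g := h.good hy₀ hy₁
  have hr := h.rRatio_eq hy₀ hy₁
  refine ⟨fun hT => ?_, fun hT => ?_, fun hT => ?_⟩
  · have := rRatio_lt_one hT g h.pos
    rw [hr, div_lt_one hy₀] at this
    linarith
  · subst hT
    have := rRatio_zero g h.pos
    rw [hr, div_eq_one_iff_eq hy₀.ne'] at this
    linarith
  · have := rRatio_lt_one (neg_neg_of_pos hT) g.neg h.pos
    rw [h.rev.rRatio_eq (by linarith) (by linarith), div_lt_one (by linarith)] at this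
    linarith

/-- Two left half-returns with the same endpoints: the comparison of the two total divergences is
decided by the constant terms and traces. -/
theorem LeftArc.sign_eq {T₁ D₁ a₁ τ₁ T₂ D₂ a₂ τ₂ y₀ y₁ : ℝ} (h₁ : LeftArc T₁ D₁ a₁ y₀ y₁ τ₁)
    (h₂ : LeftArc T₂ D₂ a₂ y₀ y₁ τ₂) (hy₀ : 0 < y₀) (hy₁ : y₁ < 0) :
    SignType.sign (T₁ * τ₁ - T₂ * τ₂) = SignType.sign (a₁ * T₂ - a₂ * T₁) := by
  obtain ⟨n₁, z₁, p₁⟩ := h₁.trichotomy hy₀ hy₁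
  obtain ⟨n₂, z₂, p₂⟩ := h₂.trichotomy hy₀ hy₁
  rcases lt_trichotomy T₁ 0 with hT₁ | hT₁ | hT₁ <;> rcases lt_trichotomy T₂ 0 with hT₂ | hT₂ | hT₂
  · exact h₁.sign_eq_of_neg h₂ hy₀ hy₁ hT₁ hT₂
  · linarith [n₁ hT₁, z₂ hT₂]
  · linarith [n₁ hT₁, p₂ hT₂]
  · linarith [z₁ hT₁, n₂ hT₂]
  · simp [hT₁, hT₂]
  · linarith [z₁ hT₁, p₂ hT₂]
  · linarith [p₁ hT₁, n₂ hT₂]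
  · linarith [p₁ hT₁, z₂ hT₂]
  · have := h₁.rev.sign_eq_of_neg h₂.rev (by linarith) (by linarith) (by linarith) (by linarith)
    have e1 : -T₁ * τ₁ - -T₂ * τ₂ = -(T₁ * τ₁ - T₂ * τ₂) := by ring
    have e2 : a₁ * -T₂ - a₂ * -T₁ = -(a₁ * T₂ - a₂ * T₁) := by ring
    rw [e1, e2, Left.sign_neg, Left.sign_neg] at this
    exact neg_injective this

end LienardParams

/-! ### Half-maps, their derivatives, and the displacement function -/

namespace LienardParams

/-- The return relation of a linear system in `x < 0`. -/
def Ret (T D a y₀ y₁ : ℝ) : Prop := ∃ τ, LeftArc T D a y₀ y₁ τ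

lemma leftReturn_iff (p : LienardParams) (y₀ y₁ : ℝ) :
    p.LeftReturn y₀ y₁ ↔ Ret p.TL p.DL p.aL y₀ y₁ := by
  constructor
  · rintro ⟨z, τ, hτ, hz, h0, h1, hneg⟩
    have hflow : ∀ t, z t = flow p.TL p.DL p.aL t (0, y₀) := fun t => by
      have := solution_eq_flow (T := p.TL) (D := p.DL) (a := p.aL) hz 0 t
      rwa [h0, sub_zero] at this
    exact ⟨τ, hτ, by rw [← hflow, h1], fun t ht => by rw [← hflow]; exact hneg t ht⟩
  · rintro ⟨τ, h⟩
    exact ⟨fun t => flow p.TL p.DL p.aL t (0, y₀), τ, h.pos,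
      fun t => hasDerivAt_flow _ _ _ _ _, flow_zero _ _ _ _, h.land, h.neg⟩

/-- The reflection `(x, y) ↦ (-x, y)`. -/
def refl (z : ℝ × ℝ) : ℝ × ℝ := (-z.1, z.2)

lemma hasDerivAt_refl_neg {T D a : ℝ} {z : ℝ → ℝ × ℝ} (hz : ∀ t, HasDerivAt z (field T D a (z t)) t)
    (t : ℝ) : HasDerivAt (fun t => refl (z (-t))) (field (-T) D (-a) (refl (z (-t)))) t := by
  have h0 : HasDerivAt (fun t => z (-t)) ((-1 : ℝ) • field T D a (z (-t))) t :=
    (hz (-t)).scomp t (hasDerivAt_neg t)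
  have h1 : HasDerivAt (fun t => (z (-t)).1) _ t := h0.fst
  have h2 : HasDerivAt (fun t => (z (-t)).2) _ t := h0.snd
  refine (h1.neg.prodMk h2).congr_deriv ?_
  simp [field, refl]
  ring

/-- The map `(x, y, t) ↦ (-x, y, -t)` fixes the switching line pointwise and sends backward motion
in `x > 0` to forward motion in `x < 0`. -/
lemma rightReturn_iff (p : LienardParams) (y₀ y₁ : ℝ) :
    p.RightReturn y₀ y₁ ↔ Ret (-p.TR) p.DR (-p.aR) y₀ y₁ := by
  constructor
  · rintro ⟨z, τ, hτ, hz, h0, h1, hpos⟩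
    have hflow : ∀ t, refl (z (-t)) = flow (-p.TR) p.DR (-p.aR) t (0, y₀) := fun t => by
      have := solution_eq_flow (hasDerivAt_refl_neg (T := p.TR) (D := p.DR) (a := p.aR) hz) 0 t
      simp only [sub_zero, neg_zero, h0] at this
      rw [this]; simp [refl]
    refine ⟨-τ, neg_pos.2 hτ, by rw [← hflow, neg_neg, h1]; simp [refl], fun t ht => ?_⟩
    rw [← hflow]
    have := hpos (-t) ⟨by linarith [ht.2], by linarith [ht.1]⟩
    simpa [refl] using this
  · rintro ⟨τ, h⟩
    refine ⟨fun t => refl (flow (-p.TR) p.DR (-p.aR) (-t) (0, y₀)), -τ, neg_neg_of_pos h.pos,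
      fun t => ?_, by simp [refl], by simp [h.land, refl], fun t ht => ?_⟩
    · have := hasDerivAt_refl_neg (fun t => hasDerivAt_flow (-p.TR) p.DR (-p.aR) t (0, y₀)) t
      rw [neg_neg, neg_neg] at this
      exact this
    · have := h.neg (-t) ⟨by linarith [ht.2], by linarith [ht.1]⟩
      simpa [refl] using this

lemma leftReturn_eq (p : LienardParams) : p.LeftReturn = Ret p.TL p.DL p.aL := by
  ext; exact leftReturn_iff _ _ _

lemma rightReturn_eq (p : LienardParams) : p.RightReturn = Ret (-p.TR) p.DR (-p.aR) := by
  ext; exact rightReturn_iff _ _ _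

lemma LeftArc.halfMap_eq {T D a y₀ y₁ τ : ℝ} (h : LeftArc T D a y₀ y₁ τ) :
    halfMap (Ret T D a) y₀ = y₁ := by
  have hex : ∃ y, Ret T D a y₀ y := ⟨y₁, τ, h⟩
  rw [halfMap, dif_pos hex]
  obtain ⟨τ', h'⟩ := hex.choose_spec
  exact (h'.unique h).2

/-- This is the identity that collapses the derivative of the half-map to an exponential. -/
lemma arc_identity (T D t : ℝ) :
    fR T D t ^ 2 + fS T D t ^ 2 * fP T D t + T * fS T D t * fR T D t * fP T D t
      - fR T D t * fS T D t ^ 2 = fP T D t ^ 2 * Real.exp (T * t) := by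
  rw [exp_eq_fR, fR]; ring

/-- An arc from `(0, y)` is found by solving `k(t) = a / y` for the flight time. This is possible
near `τ` because `k' = -R / P²` does not vanish there, even if `a = 0`. -/
lemma LeftArc.exists_local {T D a y₀ y₁ τ : ℝ} (h : LeftArc T D a y₀ y₁ τ)
    (hy₀ : 0 < y₀) (hy₁ : y₁ < 0) : ∃ f : ℝ → ℝ,
      HasDerivAt f (y₀ / y₁ * Real.exp (T * τ)) y₀ ∧
      ∀ᶠ y in 𝓝 y₀, ∃ τ', LeftArc T D a y (f y) τ' := by
  have hg := h.good hy₀ hy₁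
  obtain ⟨b, hb, hgb⟩ := hg.exists_gt h.pos
  have hP : 0 < fP T D τ := (hg τ ⟨h.pos, le_rfl⟩).1
  have hR : 0 < fR T D τ := (hg τ ⟨h.pos, le_rfl⟩).2
  have hmem : ∀ᶠ t in 𝓝 τ, t ∈ Ioo 0 b := Ioo_mem_nhds h.pos hb
  have hstrict : HasStrictDerivAt (kRatio T D) (-fR T D τ / fP T D τ ^ 2) τ := by
    refine hasStrictDerivAt_of_hasDerivAt_of_continuousAt
      (f' := fun t => -fR T D t / fP T D t ^ 2) ?_ ?_
    · filter_upwards [hmem] with t ht using hasDerivAt_kRatio (hgb t ⟨ht.1, ht.2.le⟩).1.ne'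
    · exact ((continuous_fR T D).neg.continuousAt).div
        ((continuous_fP T D).pow 2).continuousAt (by positivity)
  have hne : -fR T D τ / fP T D τ ^ 2 ≠ 0 := (div_neg_of_neg_of_pos (by linarith) (by positivity)).ne
  set g := hstrict.localInverse (kRatio T D) _ τ hne with hg_def
  have hgτ : g (kRatio T D τ) = τ := by
    rw [hg_def, HasStrictDerivAt.localInverse, HasStrictFDerivAt.localInverse_apply_image]
  have hgd := (hstrict.to_localInverse hne).hasDerivAt
  have hright := hstrict.eventually_right_inverse hne
  obtain ⟨ha, hy⟩ := h.eq_kRatio hy₀ hy₁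
  have hay : a / y₀ = kRatio T D τ := by rw [ha]; field_simp
  have hdiv : HasDerivAt (fun y => a / y) (-a / y₀ ^ 2) y₀ := by
    refine ((hasDerivAt_const y₀ a).div (hasDerivAt_id y₀) hy₀.ne').congr_deriv ?_
    simp
  have ht : HasDerivAt (fun y => g (a / y)) ((-fR T D τ / fP T D τ ^ 2)⁻¹ * (-a / y₀ ^ 2)) y₀ := by
    rw [← hay] at hgd
    exact hgd.comp y₀ hdiv
  have htτ : g (a / y₀) = τ := by rw [hay, hgτ]
  refine ⟨fun y => -(rRatio T D (g (a / y)) * y), ?_, ?_⟩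
  · have h1 := hasDerivAt_rRatio (T := T) (D := D) (t := τ) hP.ne'
    rw [← htτ] at h1
    have h2 := ((h1.comp y₀ ht).mul (hasDerivAt_id y₀)).neg
    refine h2.congr_deriv ?_
    simp only [Function.comp_apply, htτ, id]
    rw [hy, rRatio, ha, kRatio]
    have hid := arc_identity T D τ
    field_simp
    linear_combination -hid
  · have h1 : ∀ᶠ y in 𝓝 y₀, g (a / y) ∈ Ioo 0 b := by
      have := ht.continuousAt.tendsto
      rw [htτ] at this
      exact this.eventually hmem
    have h2 : ∀ᶠ y in 𝓝 y₀, kRatio T D (g (a / y)) = a / y := by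
      have := hdiv.continuousAt.tendsto
      rw [hay] at this
      exact this.eventually hright
    filter_upwards [h1, h2, lt_mem_nhds hy₀] with y hy1 hy2 hy3
    refine ⟨_, (hgb.mono hy1.2.le).leftArc hy1.1 hy3 ?_⟩
    rw [hy2]; field_simp

lemma LeftArc.hasDerivAt_halfMap {T D a y₀ y₁ τ : ℝ} (h : LeftArc T D a y₀ y₁ τ)
    (hy₀ : 0 < y₀) (hy₁ : y₁ < 0) :
    HasDerivAt (halfMap (Ret T D a)) (y₀ / y₁ * Real.exp (T * τ)) y₀ := by
  obtain ⟨f, hf, hev⟩ := h.exists_local hy₀ hy₁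
  refine hf.congr_of_eventuallyEq ?_
  filter_upwards [hev] with y ⟨τ', hy⟩ using hy.halfMap_eq

/-- `a / y` lies between `a / ya` and `a / yb`, and `k` is continuous between the two flight times.
Hence the starting points of arcs with `y₁ < 0` form an interval. -/
lemma LeftArc.exists_between {T D a ya yb y1a y1b τa τb y : ℝ} (ha : LeftArc T D a ya y1a τa)
    (hb : LeftArc T D a yb y1b τb) (hya : 0 < ya) (hy1a : y1a < 0) (hy1b : y1b < 0)
    (hy : y ∈ Icc ya yb) : ∃ y1 τ, y1 < 0 ∧ LeftArc T D a y y1 τ := by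
  have hyb : 0 < yb := hya.trans_le (hy.1.trans hy.2)
  have hy0 : 0 < y := hya.trans_le hy.1
  have ga := ha.good hya hy1a
  have gb := hb.good hyb hy1b
  have hsub : uIcc τa τb ⊆ Ioc 0 (max τa τb) := fun t ht =>
    ⟨(lt_min ha.pos hb.pos).trans_le ht.1, ht.2⟩
  have gmax : Good T D (max τa τb) := by
    rcases max_cases τa τb with h | h <;> rw [h.1] <;> assumption
  have hcont : ContinuousOn (kRatio T D) (uIcc τa τb) := fun t ht =>
    (hasDerivAt_kRatio (gmax t (hsub ht)).1.ne').continuousAt.continuousWithinAt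
  have hmem : a / y ∈ uIcc (kRatio T D τa) (kRatio T D τb) := by
    have e1 : kRatio T D τa = a / ya := by rw [(ha.eq_kRatio hya hy1a).1]; field_simp
    have e2 : kRatio T D τb = a / yb := by rw [(hb.eq_kRatio hyb hy1b).1]; field_simp
    rw [e1, e2, mem_uIcc]
    rcases le_total 0 a with h0 | h0
    · right
      exact ⟨div_le_div_of_nonneg_left h0 hy0 hy.2, div_le_div_of_nonneg_left h0 hya hy.1⟩
    · left
      have h1 : -a / y ≤ -a / ya := div_le_div_of_nonneg_left (by linarith) hya hy.1
      have h2 : -a / yb ≤ -a / y := div_le_div_of_nonneg_left (by linarith) hy0 hy.2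
      simp only [neg_div] at h1 h2
      exact ⟨by linarith, by linarith⟩
  obtain ⟨t, ht, hkt⟩ := intermediate_value_uIcc hcont hmem
  have ht' := hsub ht
  refine ⟨_, t, ?_, (gmax.mono ht'.2).leftArc ht'.1 hy0 (by rw [hkt]; field_simp)⟩
  have : 0 < rRatio T D t := div_pos (gmax t ht').2 (gmax t ht').1
  have := mul_pos this hy0
  linarith

lemma LeftArc.strictAntiOn {T D a ya yb y1a y1b τa τb : ℝ} (ha : LeftArc T D a ya y1a τa)
    (hb : LeftArc T D a yb y1b τb) (hya : 0 < ya) (hy1a : y1a < 0) (hy1b : y1b < 0) :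
    StrictAntiOn (halfMap (Ret T D a)) (Icc ya yb) := by
  have hd : ∀ y ∈ Icc ya yb, ∃ d < 0, HasDerivAt (halfMap (Ret T D a)) d y := fun y hy => by
    obtain ⟨y1, τ, hy1, h⟩ := ha.exists_between hb hya hy1a hy1b hy
    have hy0 := hya.trans_le hy.1
    exact ⟨_, mul_neg_of_neg_of_pos (div_neg_of_pos_of_neg hy0 hy1) (Real.exp_pos _),
      h.hasDerivAt_halfMap hy0 hy1⟩
  refine strictAntiOn_of_deriv_neg (convex_Icc _ _) (fun y hy => ?_) fun y hy => ?_
  · obtain ⟨d, -, h⟩ := hd y hy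
    exact h.continuousAt.continuousWithinAt
  · obtain ⟨d, hd, h⟩ := hd y (interior_subset hy)
    rwa [h.deriv]

lemma LeftArc.lt_of_lt {T D a ya yb y1a y1b τa τb : ℝ} (ha : LeftArc T D a ya y1a τa)
    (hb : LeftArc T D a yb y1b τb) (hya : 0 < ya) (hy1a : y1a < 0) (hy1b : y1b < 0)
    (hab : ya < yb) : y1b < y1a := by
  have := ha.strictAntiOn hb hya hy1a hy1b ⟨le_rfl, hab.le⟩ ⟨hab.le, le_rfl⟩ hab
  rwa [ha.halfMap_eq, hb.halfMap_eq] at this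

/-- A crossing periodic orbit consisting of one left arc and one right arc. -/
structure Loop (p : LienardParams) (y₀ y₁ τL τR : ℝ) : Prop where
  y₀_pos : 0 < y₀
  y₁_neg : y₁ < 0
  left : LeftArc p.TL p.DL p.aL y₀ y₁ τL
  right : LeftArc (-p.TR) p.DR (-p.aR) y₀ y₁ τR

lemma Loop.sign_eq {p : LienardParams} {y₀ y₁ τL τR : ℝ} (h : Loop p y₀ y₁ τL τR) :
    SignType.sign (p.TL * τL + p.TR * τR) = SignType.sign p.xi := by
  have := h.left.sign_eq h.right h.y₀_pos h.y₁_neg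
  convert this using 2
  · ring
  · rw [xi]; ring

lemma displacement_eq (p : LienardParams) : p.displacement = fun y =>
    halfMap (Ret (-p.TR) p.DR (-p.aR)) y - halfMap (Ret p.TL p.DL p.aL) y := by
  ext y
  rw [displacement, yR, yL, leftReturn_eq, rightReturn_eq]

lemma Loop.hasDerivAt_displacement {p : LienardParams} {y₀ y₁ τL τR : ℝ}
    (h : Loop p y₀ y₁ τL τR) : HasDerivAt p.displacement
      (y₀ / y₁ * (Real.exp (-p.TR * τR) - Real.exp (p.TL * τL))) y₀ := by
  rw [displacement_eq]
  exact ((h.right.hasDerivAt_halfMap h.y₀_pos h.y₁_neg).sub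
    (h.left.hasDerivAt_halfMap h.y₀_pos h.y₁_neg)).congr_deriv (by ring)

lemma Loop.sign_deriv {p : LienardParams} {y₀ y₁ τL τR : ℝ} (h : Loop p y₀ y₁ τL τR) :
    SignType.sign (y₀ / y₁ * (Real.exp (-p.TR * τR) - Real.exp (p.TL * τL)))
      = SignType.sign p.xi := by
  rw [← h.sign_eq]
  have hneg : y₀ / y₁ < 0 := div_neg_of_pos_of_neg h.y₀_pos h.y₁_neg
  rcases lt_trichotomy (p.TL * τL + p.TR * τR) 0 with hs | hs | hs
  · have : Real.exp (p.TL * τL) < Real.exp (-p.TR * τR) := Real.exp_lt_exp.2 (by linarith)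
    rw [sign_neg hs, sign_neg (mul_neg_of_neg_of_pos hneg (by linarith))]
  · have : -p.TR * τR = p.TL * τL := by linarith
    rw [this, hs, sub_self, mul_zero]
  · have : Real.exp (-p.TR * τR) < Real.exp (p.TL * τL) := Real.exp_lt_exp.2 (by linarith)
    rw [sign_pos hs, sign_pos (mul_pos_of_neg_of_neg hneg (by linarith))]

/-- On `[ya, yb]` the function `ξ δ` is differentiable, and its derivative is positive at every
zero. It is thus positive just after `ya`, and at its next zero the derivative would have to be at
most `0`. -/
lemma Loop.not_lt {p : LienardParams} (hξ : p.xi ≠ 0) {ya y1a τLa τRa yb y1b τLb τRb : ℝ}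
    (ha : Loop p ya y1a τLa τRa) (hb : Loop p yb y1b τLb τRb) : ¬ ya < yb := by
  intro hab
  have key : ∀ y ∈ Icc ya yb, ∃ d, HasDerivAt p.displacement d y ∧
      (p.displacement y = 0 → SignType.sign d = SignType.sign p.xi) := fun y hy => by
    have hy0 := ha.y₀_pos.trans_le hy.1
    obtain ⟨u, τ, hu, h⟩ := ha.left.exists_between hb.left ha.y₀_pos ha.y₁_neg hb.y₁_neg hy
    obtain ⟨v, σ, hv, h'⟩ := ha.right.exists_between hb.right ha.y₀_pos ha.y₁_neg hb.y₁_neg hy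
    by_cases huv : u = v
    · subst huv
      have hl : Loop p y u τ σ := ⟨hy0, hu, h, h'⟩
      exact ⟨_, hl.hasDerivAt_displacement, fun _ => hl.sign_deriv⟩
    · have hsub := (h'.hasDerivAt_halfMap hy0 hv).sub (h.hasDerivAt_halfMap hy0 hu)
      refine ⟨_, by rw [displacement_eq]; exact hsub, fun h0 => absurd ?_ huv⟩
      rw [displacement_eq] at h0
      simp only [h.halfMap_eq, h'.halfMap_eq] at h0
      linarith
  have hza : p.displacement ya = 0 := by
    rw [displacement_eq]; simp only [ha.left.halfMap_eq, ha.right.halfMap_eq, sub_self]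
  have hzb : p.displacement yb = 0 := by
    rw [displacement_eq]; simp only [hb.left.halfMap_eq, hb.right.halfMap_eq, sub_self]
  -- multiply by `ξ` to treat both signs at once
  have hd : ∀ y ∈ Icc ya yb, ∃ d, HasDerivAt (fun y => p.xi * p.displacement y) d y ∧
      (p.displacement y = 0 → 0 < d) := fun y hy => by
    obtain ⟨d, h1, h2⟩ := key y hy
    refine ⟨_, h1.const_mul p.xi, fun h0 => ?_⟩
    have h3 := h2 h0
    rcases lt_or_gt_of_ne hξ with h | h
    · rw [sign_neg h, sign_eq_neg_one_iff] at h3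
      exact mul_pos_of_neg_of_neg h h3
    · rw [sign_pos h, sign_eq_one_iff] at h3
      exact mul_pos h h3
  have hcont : ContinuousOn (fun y => p.xi * p.displacement y) (Icc ya yb) := fun y hy => by
    obtain ⟨d, h1, -⟩ := hd y hy
    exact h1.continuousAt.continuousWithinAt
  have hpos : ∀ᶠ y in 𝓝[>] ya, 0 < p.xi * p.displacement y := by
    obtain ⟨d, h1, h2⟩ := hd ya ⟨le_rfl, hab.le⟩
    have h3 := (hasDerivAt_iff_tendsto_slope.1 h1).mono_left
      (nhdsWithin_mono ya (fun y (hy : ya < y) => hy.ne'))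
    filter_upwards [h3.eventually (lt_mem_nhds (h2 hza)), self_mem_nhdsWithin] with y hy hy'
    have hy' : ya < y := hy'
    rw [slope_def_field, hza, mul_zero, sub_zero] at hy
    exact (div_pos_iff_of_pos_right (by linarith)).1 hy
  obtain ⟨c, hc, hc0, hcpos⟩ := exists_first_zero hcont hab hpos (by simp [hzb])
  obtain ⟨d, h1, h2⟩ := hd c ⟨hc.1.le, hc.2⟩
  have := deriv_nonpos_of_pos_left h1 hc.1 hc0 hcpos
  have := h2 ((mul_eq_zero.1 hc0).resolve_left hξ)
  linarith

lemma Loop.eq {p : LienardParams} (hξ : p.xi ≠ 0) {ya y1a τLa τRa yb y1b τLb τRb : ℝ}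
    (ha : Loop p ya y1a τLa τRa) (hb : Loop p yb y1b τLb τRb) : ya = yb :=
  le_antisymm (le_of_not_gt (Loop.not_lt hξ hb ha)) (le_of_not_gt (Loop.not_lt hξ ha hb))

end LienardParams

namespace LienardParams

/-! ### Symmetries of trajectories -/

lemma disjoint_uIoc_comp {σ c : ℝ} (hσ : σ = 1 ∨ σ = -1) {x y u v : ℝ}
    (h : Disjoint (uIoc x y) (uIoc u v)) :
    Disjoint (uIoc (σ * x + c) (σ * y + c)) (uIoc (σ * u + c) (σ * v + c)) := by
  simp only [uIoc, Ioc_disjoint_Ioc] at h ⊢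
  rcases hσ with rfl | rfl
  · simp only [one_mul, max_add_add_right, min_add_add_right]
    linarith
  · have e : ∀ x : ℝ, -1 * x + c = c - x := fun x => by ring
    simp only [e, min_sub_sub_left, max_sub_sub_left]
    rw [min_comm] at h
    rw [max_comm] at h
    simp only [min_comm, max_comm] at h ⊢
    linarith

lemma absolutelyContinuousOnInterval_comp {X : Type*} [PseudoMetricSpace X] {f : ℝ → X}
    {σ c a b : ℝ} (hσ : σ = 1 ∨ σ = -1)
    (hf : AbsolutelyContinuousOnInterval f (σ * a + c) (σ * b + c)) :
    AbsolutelyContinuousOnInterval (fun t => f (σ * t + c)) a b := by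
  rw [absolutelyContinuousOnInterval_iff] at hf ⊢
  intro ε hε
  obtain ⟨δ, hδ, h⟩ := hf ε hε
  refine ⟨δ, hδ, fun E hE hlen => ?_⟩
  refine h (E.1, fun i => (σ * (E.2 i).1 + c, σ * (E.2 i).2 + c)) ⟨fun i hi => ?_, fun i hi j hj hij => ?_⟩ ?_
  · have h1 := hE.1 i hi
    have key : ∀ x ∈ uIcc a b, σ * x + c ∈ uIcc (σ * a + c) (σ * b + c) := fun x hx => by
      rw [mem_uIcc] at hx ⊢
      rcases hσ with rfl | rfl
      · rcases hx with hx | hx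
        · left; constructor <;> linarith [hx.1, hx.2]
        · right; constructor <;> linarith [hx.1, hx.2]
      · rcases hx with hx | hx
        · right; constructor <;> linarith [hx.1, hx.2]
        · left; constructor <;> linarith [hx.1, hx.2]
    exact ⟨key _ h1.1, key _ h1.2⟩
  · exact disjoint_uIoc_comp hσ (hE.2 hi hj hij)
  · refine lt_of_le_of_lt (le_of_eq (Finset.sum_congr rfl fun i _ => ?_)) hlen
    simp only [Real.dist_eq]
    have e : σ * (E.2 i).1 + c - (σ * (E.2 i).2 + c) = σ * ((E.2 i).1 - (E.2 i).2) := by ring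
    rw [e, abs_mul]
    rcases hσ with rfl | rfl <;> simp

lemma absolutelyContinuousOnInterval_clm {E F : Type*} [NormedAddCommGroup E] [NormedSpace ℝ E]
    [NormedAddCommGroup F] [NormedSpace ℝ F] (L : E →L[ℝ] F) {f : ℝ → E} {a b : ℝ}
    (hf : AbsolutelyContinuousOnInterval f a b) :
    AbsolutelyContinuousOnInterval (fun t => L (f t)) a b := by
  have h1 : Tendsto _ _ (𝓝 (‖L‖ * 0)) := Tendsto.const_mul ‖L‖ hf
  rw [mul_zero] at h1
  refine squeeze_zero (fun E => Finset.sum_nonneg fun i _ => dist_nonneg) (fun E => ?_) h1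
  rw [Finset.mul_sum]
  exact Finset.sum_le_sum fun i _ => L.lipschitz.dist_le_mul _ _

lemma measurePreserving_affine {σ c : ℝ} (hσ : σ = 1 ∨ σ = -1) :
    MeasurePreserving (fun t : ℝ => σ * t + c) volume volume := by
  rcases hσ with rfl | rfl
  · simpa using measurePreserving_add_right volume c
  · have := Measure.measurePreserving_sub_left (volume : Measure ℝ) c
    convert this using 2
    ring

/-- A common source for time shifts, the half-turn and time reversal. -/
lemma IsTrajectoryOn.map {p p' : LienardParams} {J : Set ℝ} {γ : ℝ → ℝ × ℝ}
    (hγ : p.IsTrajectoryOn J γ) {σ c : ℝ} (hσ : σ = 1 ∨ σ = -1) (L : (ℝ × ℝ) →L[ℝ] (ℝ × ℝ))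
    (hL : ∀ z, ∀ v ∈ p.filippov z, σ • L v ∈ p'.filippov (L z)) {J' : Set ℝ}
    (hJ : MeasurableSet J) (hJ' : MeasurableSet J') (hmaps : ∀ t ∈ J', σ * t + c ∈ J) :
    p'.IsTrajectoryOn J' (fun t => L (γ (σ * t + c))) := by
  refine ⟨fun a ha b hb => ?_, ?_⟩
  · exact absolutelyContinuousOnInterval_clm L
      (absolutelyContinuousOnInterval_comp hσ (hγ.1 _ (hmaps a ha) _ (hmaps b hb)))
  · have h1 := hγ.2
    rw [ae_restrict_iff' hJ] at h1
    rw [ae_restrict_iff' hJ']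
    have h2 := (measurePreserving_affine (c := c) hσ).quasiMeasurePreserving.ae h1
    filter_upwards [h2] with t ht htJ
    obtain ⟨v, hv, hd⟩ := ht (hmaps t htJ)
    refine ⟨σ • L v, hL _ v hv, ?_⟩
    have h3 : HasDerivAt (fun t : ℝ => σ * t + c) σ t := by
      simpa using ((hasDerivAt_id t).const_mul σ).add_const c
    have h4 : HasDerivAt (fun t => γ (σ * t + c)) (σ • v) t := hd.scomp t h3
    have h5 : HasDerivAt (fun t => L (γ (σ * t + c))) (L (σ • v)) t :=
      L.hasFDerivAt.comp_hasDerivAt t h4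
    rwa [map_smul] at h5

/-- The parameters after the half-turn `(x, y) ↦ (-x, -y)`. -/
def rot (p : LienardParams) : LienardParams := ⟨p.TR, p.TL, p.DR, p.DL, -p.aR, -p.aL⟩

/-- The parameters after the time reversal `(x, y, t) ↦ (x, -y, -t)`. -/
def revp (p : LienardParams) : LienardParams := ⟨-p.TL, -p.TR, p.DL, p.DR, p.aL, p.aR⟩

lemma rot_rot (p : LienardParams) : rot (rot p) = p := by simp [rot]

lemma neg_mem_filippov_rot (p : LienardParams) {z v : ℝ × ℝ} (h : v ∈ p.filippov z) :
    -v ∈ (rot p).filippov (-z) := by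
  have hl : (rot p).leftField (-z) = -p.rightField z := by
    simp [rot, leftField, rightField]; constructor <;> ring
  have hr : (rot p).rightField (-z) = -p.leftField z := by
    simp [rot, leftField, rightField]; constructor <;> ring
  rcases h with ⟨h1, rfl⟩ | ⟨h1, rfl⟩ | ⟨h1, h2⟩
  · exact Or.inr (Or.inl ⟨by simpa using h1, hr.symm⟩)
  · exact Or.inl ⟨by simpa using h1, hl.symm⟩
  · refine Or.inr (Or.inr ⟨by simpa using h1, ?_⟩)
    rw [hl, hr, segment_symm]
    obtain ⟨a, b, ha, hb, hab, rfl⟩ := h2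
    exact ⟨a, b, ha, hb, hab, by simp only [smul_neg]; abel⟩

lemma neg_conj_mem_filippov_revp (p : LienardParams) {z v : ℝ × ℝ} (h : v ∈ p.filippov z) :
    -conj v ∈ (revp p).filippov (conj z) := by
  have hl : (revp p).leftField (conj z) = -conj (p.leftField z) := by
    simp [revp, leftField, conj]; ring
  have hr : (revp p).rightField (conj z) = -conj (p.rightField z) := by
    simp [revp, rightField, conj]; ring
  rcases h with ⟨h1, rfl⟩ | ⟨h1, rfl⟩ | ⟨h1, h2⟩
  · exact Or.inl ⟨h1, hl.symm⟩
  · exact Or.inr (Or.inl ⟨h1, hr.symm⟩)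
  · refine Or.inr (Or.inr ⟨h1, ?_⟩)
    rw [hl, hr]
    obtain ⟨a, b, ha, hb, hab, rfl⟩ := h2
    exact ⟨a, b, ha, hb, hab, by simp [conj]; ring⟩

/-- `conj` as a continuous linear map. -/
noncomputable def conjL : (ℝ × ℝ) →L[ℝ] (ℝ × ℝ) :=
  (ContinuousLinearMap.fst ℝ ℝ ℝ).prod (-ContinuousLinearMap.snd ℝ ℝ ℝ)

lemma conjL_apply (z : ℝ × ℝ) : conjL z = conj z := rfl

lemma IsTrajectoryOn.shift {p : LienardParams} {J J' : Set ℝ} {γ : ℝ → ℝ × ℝ}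
    (hγ : p.IsTrajectoryOn J γ) (hJ : MeasurableSet J) (hJ' : MeasurableSet J') (c : ℝ)
    (hmaps : ∀ t ∈ J', t + c ∈ J) : p.IsTrajectoryOn J' (fun t => γ (t + c)) := by
  have := IsTrajectoryOn.map (p' := p) hγ (σ := 1) (c := c) (Or.inl rfl)
    (ContinuousLinearMap.id ℝ (ℝ × ℝ)) (fun z v hv => by simpa using hv) hJ hJ'
    (fun t ht => by simpa using hmaps t ht)
  simpa using this

lemma IsTrajectoryOn.halfTurn {p : LienardParams} {J : Set ℝ} {γ : ℝ → ℝ × ℝ}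
    (hγ : p.IsTrajectoryOn J γ) (hJ : MeasurableSet J) :
    (rot p).IsTrajectoryOn J (fun t => -γ t) := by
  have := IsTrajectoryOn.map (p' := rot p) hγ (σ := 1) (c := 0) (Or.inl rfl)
    (-ContinuousLinearMap.id ℝ (ℝ × ℝ))
    (fun z v hv => by simpa using neg_mem_filippov_rot p hv) hJ hJ
    (fun t ht => by simpa using ht)
  simpa using this

lemma IsTrajectoryOn.timeReversal {p : LienardParams} {J J' : Set ℝ} {γ : ℝ → ℝ × ℝ}
    (hγ : p.IsTrajectoryOn J γ) (hJ : MeasurableSet J) (hJ' : MeasurableSet J') (c : ℝ)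
    (hmaps : ∀ t ∈ J', c - t ∈ J) : (revp p).IsTrajectoryOn J' (fun t => conj (γ (c - t))) := by
  have := IsTrajectoryOn.map (p' := revp p) hγ (σ := -1) (c := c) (Or.inr rfl) conjL
    (fun z v hv => by simpa [conjL_apply] using neg_conj_mem_filippov_revp p hv) hJ hJ'
    (fun t ht => by
      have := hmaps t ht
      rwa [show -1 * t + c = c - t by ring])
  simp only [conjL_apply, show ∀ t, -1 * t + c = c - t from fun t => by ring] at this
  exact this

/-! ### Regularity of trajectories -/

/-- An absolutely continuous function whose derivative agrees almost everywhere with a continuous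
`F` differs from the integral of `F` by a constant. -/
lemma hasDerivWithinAt_of_ae {E : Type*} [NormedAddCommGroup E] [NormedSpace ℝ E]
    [CompleteSpace E] {u F : ℝ → E} {a b : ℝ} (hab : a ≤ b)
    (hu : AbsolutelyContinuousOnInterval u a b) (hF : Continuous F)
    (hd : ∀ᵐ t, t ∈ Icc a b → HasDerivAt u (F t) t) {t : ℝ} (ht : t ∈ Icc a b) :
    HasDerivWithinAt u (F t) (Icc a b) t := by
  have hI : ∀ s, HasDerivAt (fun s => ∫ x in a..s, F x) (F s) s := fun s =>
    intervalIntegral.integral_hasDerivAt_right (hF.intervalIntegrable _ _)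
      (hF.stronglyMeasurableAtFilter _ _) hF.continuousAt
  have hI1 : ContDiff ℝ 1 (fun s => ∫ x in a..s, F x) := by
    rw [contDiff_one_iff_deriv]
    refine ⟨fun s => (hI s).differentiableAt, ?_⟩
    have : deriv (fun s => ∫ x in a..s, F x) = F := funext fun s => (hI s).deriv
    rwa [this]
  have hac := hu.sub (hI1.contDiffOn.absolutelyContinuousOnInterval (a := a) (b := b))
  obtain ⟨C, hC⟩ := hac.const_of_ae_hasDerivAt_zero (by
    filter_upwards [hd] with s hs hs'
    rw [uIcc_of_le hab] at hs'
    have := (hs hs').sub (hI s)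
    rwa [sub_self] at this)
  have heq : ∀ s ∈ Icc a b, u s = C + ∫ x in a..s, F x := fun s hs => by
    have := hC s (by rwa [uIcc_of_le hab])
    simp only [Pi.sub_apply] at this
    rw [← this]; abel
  exact (((hI t).const_add C).hasDerivWithinAt).congr heq (heq t ht)

lemma IsTrajectoryOn.ae_Icc {p : LienardParams} {J : Set ℝ} {γ : ℝ → ℝ × ℝ}
    (hγ : p.IsTrajectoryOn J γ) {a b : ℝ} (hJ : Icc a b ⊆ J) :
    ∀ᵐ t, t ∈ Icc a b → ∃ v ∈ p.filippov (γ t), HasDerivAt γ v t :=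
  (ae_restrict_iff' measurableSet_Icc).1 (ae_restrict_of_ae_restrict_of_subset hJ hγ.2)

lemma IsTrajectoryOn.continuousOn_Icc {p : LienardParams} {J : Set ℝ} {γ : ℝ → ℝ × ℝ}
    (hγ : p.IsTrajectoryOn J γ) {a b : ℝ} (hab : a ≤ b) (hJ : Icc a b ⊆ J) :
    ContinuousOn γ (Icc a b) := by
  have := (hγ.1 a (hJ ⟨le_rfl, hab⟩) b (hJ ⟨hab, le_rfl⟩)).continuousOn
  rwa [uIcc_of_le hab] at this

/-- The first component of the vector field, which is continuous across `x = 0`. -/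
noncomputable def xSpeed (p : LienardParams) (z : ℝ × ℝ) : ℝ :=
  p.TL * min z.1 0 + p.TR * max z.1 0 - z.2

lemma continuous_xSpeed (p : LienardParams) : Continuous (xSpeed p) := by
  unfold xSpeed; fun_prop

lemma fst_eq_xSpeed {p : LienardParams} {z v : ℝ × ℝ} (h : v ∈ p.filippov z) :
    v.1 = xSpeed p z := by
  rcases h with ⟨h1, rfl⟩ | ⟨h1, rfl⟩ | ⟨h1, a, b, ha, hb, hab, rfl⟩
  · simp [leftField, xSpeed, h1.le]
  · simp [rightField, xSpeed, h1.le]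
  · simp [leftField, rightField, xSpeed, h1]
    linear_combination (-z.2) * hab

/-- On `x = 0` every Filippov velocity has first component `-y`, so `x` is C¹ along a trajectory
even across the line. This excludes sliding where `y ≠ 0`. -/
lemma IsTrajectoryOn.hasDerivWithinAt_fst {p : LienardParams} {J : Set ℝ} {γ : ℝ → ℝ × ℝ}
    (hγ : p.IsTrajectoryOn J γ) {a b : ℝ} (hab : a ≤ b) (hJ : Icc a b ⊆ J) {t : ℝ}
    (ht : t ∈ Icc a b) :
    HasDerivWithinAt (fun t => (γ t).1) (xSpeed p (γ t)) (Icc a b) t := by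
  have hc := hγ.continuousOn_Icc hab hJ
  set F : ℝ → ℝ := IccExtend hab (fun s : Icc a b => xSpeed p (γ s)) with hF
  have hFe : ∀ s ∈ Icc a b, F s = xSpeed p (γ s) := fun s hs => by
    rw [hF, IccExtend_of_mem hab _ hs]
  have hFc : Continuous F := Continuous.Icc_extend'
    ((continuous_xSpeed p).comp (continuousOn_iff_continuous_domRestrict.1 hc))
  have hac := absolutelyContinuousOnInterval_clm (ContinuousLinearMap.fst ℝ ℝ ℝ)
    (hγ.1 a (hJ ⟨le_rfl, hab⟩) b (hJ ⟨hab, le_rfl⟩))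
  have := hasDerivWithinAt_of_ae hab hac hFc (by
    filter_upwards [hγ.ae_Icc hJ] with s hs hs'
    obtain ⟨v, hv, hd⟩ := hs hs'
    rw [hFe s hs', ← fst_eq_xSpeed hv]
    exact hd.fst) ht
  rwa [hFe t ht] at this

/-- Negativity is required only in the interior, so that the endpoints may lie on the switching
line; two points do not affect the almost-everywhere equation. -/
lemma IsTrajectoryOn.eq_flow {p : LienardParams} {J : Set ℝ} {γ : ℝ → ℝ × ℝ}
    (hγ : p.IsTrajectoryOn J γ) {a b : ℝ} (hJ : Icc a b ⊆ J)
    (hneg : ∀ t ∈ Ioo a b, (γ t).1 < 0) {t : ℝ} (ht : t ∈ Icc a b) :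
    γ t = flow p.TL p.DL p.aL (t - a) (γ a) := by
  have hab := ht.1.trans ht.2
  have hc := hγ.continuousOn_Icc hab hJ
  set F : ℝ → ℝ × ℝ := IccExtend hab (fun s : Icc a b => field p.TL p.DL p.aL (γ s)) with hF
  have hFe : ∀ s ∈ Icc a b, F s = field p.TL p.DL p.aL (γ s) := fun s hs => by
    rw [hF, IccExtend_of_mem hab _ hs]
  have hFc : Continuous F := Continuous.Icc_extend'
    ((continuous_field _ _ _).comp (continuousOn_iff_continuous_domRestrict.1 hc))
  have hne : ∀ᵐ s : ℝ, s ≠ a ∧ s ≠ b := by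
    have h1 : ∀ᵐ s : ℝ, s ∉ ({a} : Set ℝ) := measure_eq_zero_iff_ae_notMem.1 (by simp)
    have h2 : ∀ᵐ s : ℝ, s ∉ ({b} : Set ℝ) := measure_eq_zero_iff_ae_notMem.1 (by simp)
    filter_upwards [h1, h2] with s hs1 hs2 using ⟨hs1, hs2⟩
  have hd := fun s (hs : s ∈ Icc a b) => hasDerivWithinAt_of_ae hab
    (hγ.1 a (hJ ⟨le_rfl, hab⟩) b (hJ ⟨hab, le_rfl⟩)) hFc (by
      filter_upwards [hγ.ae_Icc hJ, hne] with s hs hne' hs'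
      obtain ⟨v, hv, hd⟩ := hs hs'
      have hlt : (γ s).1 < 0 := hneg s ⟨lt_of_le_of_ne hs'.1 hne'.1.symm, lt_of_le_of_ne hs'.2 hne'.2⟩
      rw [hFe s hs']
      rcases hv with ⟨h1, rfl⟩ | ⟨h1, -⟩ | ⟨h1, -⟩
      · exact hd
      · linarith
      · linarith) hs
  have huniq := ODE_solution_unique_of_mem_Icc_right (v := fun _ => field p.TL p.DL p.aL)
    (s := fun _ => univ) (K := ‖fieldLin p.TL p.DL‖₊) (f := γ)
    (g := fun t => flow p.TL p.DL p.aL (t - a) (γ a)) (a := a) (b := b)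
    (fun t _ => (lipschitzWith_field _ _ _).lipschitzOnWith) hc
    (fun s hs => by
      have := hd s ⟨hs.1, hs.2.le⟩
      rw [hFe s ⟨hs.1, hs.2.le⟩] at this
      exact this.mono_of_mem_nhdsWithin (mem_of_superset (Icc_mem_nhdsGE hs.2)
        (Icc_subset_Icc_left hs.1)))
    (fun _ _ => mem_univ _)
    (((continuous_flow_time _ _ _ _).comp (continuous_id.sub continuous_const)).continuousOn)
    (fun s _ => ((hasDerivAt_flow p.TL p.DL p.aL (s - a) (γ a)).comp_sub_const s a).hasDerivWithinAt)
    (fun _ _ => mem_univ _) (by simp)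
  exact huniq ht

end LienardParams

namespace LienardParams

/-! ### Trajectories follow arcs -/

/-- Points from which trajectories immediately move in `x < 0`. -/
def EntersLeft (z : ℝ × ℝ) : Prop := z.1 < 0 ∨ (z.1 = 0 ∧ 0 < z.2)

lemma IsTrajectoryOn.eventually_neg {p : LienardParams} {J : Set ℝ} {γ : ℝ → ℝ × ℝ}
    (hγ : p.IsTrajectoryOn J γ) {a b : ℝ} (hab : a < b) (hJ : Icc a b ⊆ J)
    (h : EntersLeft (γ a)) : ∀ᶠ t in 𝓝[>] a, (γ t).1 < 0 := by
  have hd : HasDerivWithinAt (fun t => (γ t).1) (xSpeed p (γ a)) (Ioi a) a :=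
    (hγ.hasDerivWithinAt_fst hab.le hJ ⟨le_rfl, hab.le⟩).mono_of_mem_nhdsWithin
      (mem_of_superset (Ioc_mem_nhdsGT hab) Ioc_subset_Icc_self)
  rcases h with h | ⟨h1, h2⟩
  · exact hd.continuousWithinAt.eventually (gt_mem_nhds h)
  · have hs : xSpeed p (γ a) < 0 := by simp [xSpeed, h1, h2]
    rw [hasDerivWithinAt_iff_tendsto_slope' self_notMem_Ioi] at hd
    filter_upwards [hd.eventually (gt_mem_nhds hs), self_mem_nhdsWithin] with t ht hta
    have hta : a < t := hta
    rw [slope_def_field, h1, sub_zero] at ht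
    by_contra hneg
    have := div_nonneg (not_lt.1 hneg) (sub_pos.2 hta).le
    linarith

lemma IsTrajectoryOn.next_zero {p : LienardParams} {J : Set ℝ} {γ : ℝ → ℝ × ℝ}
    (hγ : p.IsTrajectoryOn J γ) {a b : ℝ} (hab : a < b) (hJ : Icc a b ⊆ J)
    (h : EntersLeft (γ a)) (hb : 0 ≤ (γ b).1) :
    ∃ τ ∈ Ioc 0 (b - a), (flow p.TL p.DL p.aL τ (γ a)).1 = 0 ∧
      (∀ t ∈ Icc 0 τ, γ (a + t) = flow p.TL p.DL p.aL t (γ a)) ∧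
      ∀ t ∈ Ioo 0 τ, (flow p.TL p.DL p.aL t (γ a)).1 < 0 := by
  have hc := hγ.continuousOn_Icc hab.le hJ
  obtain ⟨c, hc1, hc0, hcneg⟩ := exists_first_zero (f := fun t => -(γ t).1)
    (continuous_fst.comp_continuousOn hc).neg hab
    (by filter_upwards [hγ.eventually_neg hab hJ h] with t ht using neg_pos.2 ht) (by linarith)
  have heq : ∀ t ∈ Icc a c, γ t = flow p.TL p.DL p.aL (t - a) (γ a) := fun t ht =>
    hγ.eq_flow ((Icc_subset_Icc_right hc1.2).trans hJ) (fun s hs => neg_pos.1 (hcneg s hs)) ht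
  have heq' : ∀ t ∈ Icc 0 (c - a), γ (a + t) = flow p.TL p.DL p.aL t (γ a) := fun t ht => by
    have := heq (a + t) ⟨by linarith [ht.1], by linarith [ht.2]⟩
    rwa [add_sub_cancel_left] at this
  refine ⟨c - a, ⟨by linarith [hc1.1], by linarith [hc1.2]⟩, ?_, heq', fun t ht => ?_⟩
  · rw [← heq c ⟨hc1.1.le, le_rfl⟩]; linarith
  · rw [← heq' t ⟨ht.1.le, ht.2.le⟩]
    exact neg_pos.1 (hcneg _ ⟨by linarith [ht.1], by linarith [ht.2]⟩)

lemma IsTrajectoryOn.follow {p : LienardParams} {J : Set ℝ} {γ : ℝ → ℝ × ℝ}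
    (hγ : p.IsTrajectoryOn J γ) {a τ : ℝ} (hJ : Icc a (a + τ) ⊆ J)
    (h : EntersLeft (γ a)) (hneg : ∀ t ∈ Ioo 0 τ, (flow p.TL p.DL p.aL t (γ a)).1 < 0) {t : ℝ}
    (ht : t ∈ Icc 0 τ) : γ (a + t) = flow p.TL p.DL p.aL t (γ a) := by
  have hlt : ∀ s ∈ Ioo a (a + τ), (γ s).1 < 0 := fun s hs => by
    by_contra hs0
    obtain ⟨σ, hσ, h0, -, -⟩ := hγ.next_zero hs.1 ((Icc_subset_Icc_right hs.2.le).trans hJ) h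
      (not_lt.1 hs0)
    have := hneg σ ⟨hσ.1, by linarith [hσ.2, hs.2]⟩
    linarith
  have := hγ.eq_flow hJ hlt (t := a + t) ⟨by linarith [ht.1], by linarith [ht.2]⟩
  rwa [add_sub_cancel_left] at this

lemma LeftArc.follow {p : LienardParams} {J : Set ℝ} {γ : ℝ → ℝ × ℝ} {y₀ y₁ τ : ℝ}
    (h : LeftArc p.TL p.DL p.aL y₀ y₁ τ) (hy₀ : 0 < y₀)
    (hγ : p.IsTrajectoryOn J γ) {a : ℝ} (hJ : Icc a (a + τ) ⊆ J) (ha : γ a = (0, y₀)) {t : ℝ}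
    (ht : t ∈ Icc 0 τ) : γ (a + t) = flow p.TL p.DL p.aL t (0, y₀) := by
  rw [← ha]
  refine hγ.follow hJ (by rw [ha]; exact Or.inr ⟨rfl, hy₀⟩) ?_ ht
  rw [ha]; exact h.neg

/-- At landing `x` rises to `0` from below, so `x' = -y₁ ≥ 0`. -/
lemma LeftArc.snd_nonpos {T D a y₀ y₁ τ : ℝ} (h : LeftArc T D a y₀ y₁ τ) : y₁ ≤ 0 := by
  have hd0 : HasDerivAt (fun t => (flow T D a t (0, y₀)).1) _ τ :=
    (hasDerivAt_flow T D a τ (0, y₀)).fst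
  have hd : HasDerivAt (fun t => -(flow T D a t (0, y₀)).1) _ τ := hd0.neg
  have := deriv_nonpos_of_pos_left hd h.pos (by simp [h.land]) fun t ht => neg_pos.2 (h.neg t ht)
  rw [h.land] at this
  simpa [field] using this

/-- One turn: a left arc from `(0, y₀)` to `(0, y₁)` and then a right arc to `(0, y₂)`. -/
structure Turn (p : LienardParams) (y₀ y₁ y₂ τL τR : ℝ) : Prop where
  y₀_pos : 0 < y₀
  y₁_neg : y₁ < 0
  left : LeftArc p.TL p.DL p.aL y₀ y₁ τL
  right : LeftArc p.TR p.DR (-p.aR) (-y₁) (-y₂) τR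

/-- The orbit during one turn. -/
def turnSet (p : LienardParams) (y₀ y₁ τL τR : ℝ) : Set (ℝ × ℝ) :=
  (fun t => flow p.TL p.DL p.aL t (0, y₀)) '' Icc 0 τL ∪
    (fun t => -flow p.TR p.DR (-p.aR) t (0, -y₁)) '' Icc 0 τR

lemma Loop.turn {p : LienardParams} {y₀ y₁ τL τR : ℝ} (h : Loop p y₀ y₁ τL τR) :
    Turn p y₀ y₁ y₀ τL τR :=
  ⟨h.y₀_pos, h.y₁_neg, h.left, by simpa using h.right.rev⟩

lemma Turn.loop {p : LienardParams} {y₀ y₁ τL τR : ℝ} (h : Turn p y₀ y₁ y₀ τL τR) :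
    Loop p y₀ y₁ τL τR :=
  ⟨h.y₀_pos, h.y₁_neg, h.left, by simpa using h.right.rev⟩

lemma Turn.follow {p : LienardParams} {J : Set ℝ} {γ : ℝ → ℝ × ℝ} {y₀ y₁ y₂ τL τR : ℝ}
    (h : Turn p y₀ y₁ y₂ τL τR) (hγ : p.IsTrajectoryOn J γ) (hJm : MeasurableSet J) {a : ℝ}
    (hJ : Icc a (a + τL + τR) ⊆ J) (ha : γ a = (0, y₀)) :
    (∀ t ∈ Icc 0 τL, γ (a + t) = flow p.TL p.DL p.aL t (0, y₀)) ∧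
    (∀ t ∈ Icc 0 τR, γ (a + τL + t) = -flow p.TR p.DR (-p.aR) t (0, -y₁)) ∧
    γ (a + τL + τR) = (0, y₂) := by
  have hL := h.left.pos
  have hR := h.right.pos
  have h1 : ∀ t ∈ Icc 0 τL, γ (a + t) = flow p.TL p.DL p.aL t (0, y₀) := fun t ht =>
    h.left.follow h.y₀_pos hγ ((Icc_subset_Icc_right (by linarith)).trans hJ) ha ht
  have h2 : γ (a + τL) = (0, y₁) := by rw [h1 τL ⟨hL.le, le_rfl⟩, h.left.land]
  have h3 : ∀ t ∈ Icc 0 τR, γ (a + τL + t) = -flow p.TR p.DR (-p.aR) t (0, -y₁) := fun t ht => by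
    have := LeftArc.follow (p := rot p) h.right (neg_pos.2 h.y₁_neg) (hγ.halfTurn hJm) (a := a + τL)
      ((Icc_subset_Icc_left (by linarith)).trans hJ) (by rw [h2]; simp) ht
    rw [← neg_neg (γ (a + τL + t)), this]
    rfl
  refine ⟨h1, h3, ?_⟩
  rw [h3 τR ⟨hR.le, le_rfl⟩, h.right.land]; simp

lemma Turn.follow_mem {p : LienardParams} {J : Set ℝ} {γ : ℝ → ℝ × ℝ} {y₀ y₁ y₂ τL τR : ℝ}
    (h : Turn p y₀ y₁ y₂ τL τR) (hγ : p.IsTrajectoryOn J γ) (hJm : MeasurableSet J) {a : ℝ}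
    (hJ : Icc a (a + τL + τR) ⊆ J) (ha : γ a = (0, y₀)) {t : ℝ} (ht : t ∈ Icc a (a + τL + τR)) :
    γ t ∈ turnSet p y₀ y₁ τL τR := by
  obtain ⟨h1, h2, -⟩ := h.follow hγ hJm hJ ha
  rcases le_total t (a + τL) with htl | htl
  · left
    refine ⟨t - a, ⟨by linarith [ht.1], by linarith⟩, ?_⟩
    have := h1 (t - a) ⟨by linarith [ht.1], by linarith⟩
    rw [add_sub_cancel] at this
    exact this.symm
  · right
    refine ⟨t - (a + τL), ⟨by linarith [ht.1], by linarith [ht.2]⟩, ?_⟩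
    have := h2 (t - (a + τL)) ⟨by linarith [ht.1], by linarith [ht.2]⟩
    rw [add_sub_cancel] at this
    exact this.symm

lemma Turn.turnSet_section {p : LienardParams} {y₀ y₁ y₂ τL τR : ℝ}
    (h : Turn p y₀ y₁ y₂ τL τR) {y : ℝ} (hy : (0, y) ∈ turnSet p y₀ y₁ τL τR) :
    y = y₀ ∨ y = y₁ ∨ y = y₂ := by
  rcases hy with ⟨t, ht, hty⟩ | ⟨t, ht, hty⟩
  · simp only at hty
    rcases eq_or_lt_of_le ht.1 with h0 | h0
    · rw [← h0, flow_zero] at hty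
      left; simpa using hty.symm
    rcases eq_or_lt_of_le ht.2 with h1 | h1
    · rw [h1, h.left.land] at hty
      right; left; simpa using hty.symm
    · have := h.left.neg t ⟨h0, h1⟩
      rw [hty] at this; simp at this
  · simp only at hty
    rcases eq_or_lt_of_le ht.1 with h0 | h0
    · rw [← h0, flow_zero] at hty
      right; left; simpa using hty.symm
    rcases eq_or_lt_of_le ht.2 with h1 | h1
    · rw [h1, h.right.land] at hty
      right; right; simpa using hty.symm
    · have := h.right.neg t ⟨h0, h1⟩
      rw [neg_eq_iff_eq_neg.1 hty] at this; simp at this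

/-! ### Closed crossing orbits are loops -/

/-- The orbit must come back to `x = 0` because it is periodic, and by the crossing hypothesis it
does not land at the origin. -/
lemma next_left {p : LienardParams} {γ : ℝ → ℝ × ℝ} (hγ : p.IsTrajectoryOn univ γ) {T : ℝ}
    (hT : 0 < T) (hper : Function.Periodic γ T) (hcr : ∀ z ∈ range γ, z.1 = 0 → z.2 ≠ 0) {y : ℝ}
    (hy : 0 < y) (h : (0, y) ∈ range γ) :
    ∃ y₁ τ, y₁ < 0 ∧ LeftArc p.TL p.DL p.aL y y₁ τ ∧ (0, y₁) ∈ range γ := by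
  obtain ⟨a, ha⟩ := h
  obtain ⟨τ, hτ, h0, hfl, hneg⟩ := hγ.next_zero (a := a) (b := a + T) (by linarith) (subset_univ _)
    (by rw [ha]; exact Or.inr ⟨rfl, hy⟩) (by rw [hper a, ha])
  rw [ha] at h0 hfl hneg
  have hland : flow p.TL p.DL p.aL τ (0, y) = (0, (flow p.TL p.DL p.aL τ (0, y)).2) := by
    ext
    · exact h0
    · rfl
  have harc : LeftArc p.TL p.DL p.aL y _ τ := ⟨hτ.1, hland, hneg⟩
  have hmem : (0, (flow p.TL p.DL p.aL τ (0, y)).2) ∈ range γ :=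
    ⟨a + τ, by rw [hfl τ ⟨hτ.1.le, le_rfl⟩, ← hland]⟩
  exact ⟨_, τ, lt_of_le_of_ne harc.snd_nonpos (hcr (0, _) hmem rfl), harc, hmem⟩

lemma next_turn {p : LienardParams} {γ : ℝ → ℝ × ℝ} (hγ : p.IsTrajectoryOn univ γ) {T : ℝ}
    (hT : 0 < T) (hper : Function.Periodic γ T) (hcr : ∀ z ∈ range γ, z.1 = 0 → z.2 ≠ 0) {y : ℝ}
    (hy : 0 < y) (h : (0, y) ∈ range γ) :
    ∃ y₁ y₂ τL τR, 0 < y₂ ∧ Turn p y y₁ y₂ τL τR ∧ (0, y₂) ∈ range γ := by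
  obtain ⟨y₁, τL, hy₁, hL, a, ha⟩ := next_left hγ hT hper hcr hy h
  obtain ⟨y₂, τR, hy₂, hR, b, hb⟩ := next_left (p := rot p) (hγ.halfTurn MeasurableSet.univ) hT
    (fun t => congrArg Neg.neg (hper t))
    (by
      rintro z ⟨t, rfl⟩ hz
      have := hcr (γ t) ⟨t, rfl⟩ (by simpa using hz)
      simpa using this)
    (y := -y₁) (by linarith) ⟨a, by simp [ha]⟩
  refine ⟨y₁, -y₂, τL, τR, by linarith, ⟨hy, hy₁, hL, by rw [neg_neg]; exact hR⟩, b, ?_⟩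
  rw [← neg_neg (γ b)]
  exact (congrArg Neg.neg hb).trans (by simp)

/-- Two left arcs of the time-reversed orbit, the first after a half-turn, give the preceding turn.
-/
lemma prev_turn {p : LienardParams} {γ : ℝ → ℝ × ℝ} (hγ : p.IsTrajectoryOn univ γ) {T : ℝ}
    (hT : 0 < T) (hper : Function.Periodic γ T) (hcr : ∀ z ∈ range γ, z.1 = 0 → z.2 ≠ 0) {y : ℝ}
    (hy : 0 < y) (h : (0, y) ∈ range γ) :
    ∃ y₁ y₀ τL τR, Turn p y₀ y₁ y τL τR ∧ (0, y₀) ∈ range γ := by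
  have hrev : (revp p).IsTrajectoryOn univ (fun t => conj (γ (0 - t))) :=
    hγ.timeReversal MeasurableSet.univ MeasurableSet.univ 0 fun _ _ => mem_univ _
  have hperr : Function.Periodic (fun t => conj (γ (0 - t))) T := fun t => by
    have := hper (0 - (t + T))
    simp only
    rw [← this]; congr 2; ring
  have hcrr : ∀ z ∈ range (fun t => conj (γ (0 - t))), z.1 = 0 → z.2 ≠ 0 := by
    rintro z ⟨t, rfl⟩ hz
    have := hcr (γ (0 - t)) ⟨_, rfl⟩ hz
    simpa [conj] using this
  obtain ⟨y₁, τR, hy₁, hR, a, ha⟩ := next_left (p := rot (revp p))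
    (hrev.halfTurn MeasurableSet.univ) hT (fun t => congrArg Neg.neg (hperr t))
    (by
      rintro z ⟨t, rfl⟩ hz
      have := hcrr _ ⟨t, rfl⟩ (by simpa using hz)
      simpa using this) hy (by
        obtain ⟨s, hs⟩ := h
        exact ⟨-s, by simp [hs, conj]⟩)
  have ha' : conj (γ (0 - a)) = (0, -y₁) := by
    rw [← neg_neg (conj (γ (0 - a)))]
    exact (congrArg Neg.neg ha).trans (by simp)
  obtain ⟨y₀, τL, hy₀, hL, b, hb⟩ := next_left hrev hT hperr hcrr (y := -y₁) (by linarith) ⟨a, ha'⟩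
  refine ⟨y₁, -y₀, τL, τR, ⟨by linarith, hy₁, by simpa [revp] using hL.rev, ?_⟩, 0 - b, ?_⟩
  · have := hR.rev
    simpa [revp, rot] using this
  · have h1 := congrArg conj hb
    simpa [conj] using h1

/-- The return map is increasing, being composed of two decreasing half-maps and two changes of
sign. -/
lemma Turn.lt_of_lt {p : LienardParams} {u₀ u₁ u₂ τL τR v₀ v₁ v₂ σL σR : ℝ}
    (h : Turn p u₀ u₁ u₂ τL τR) (h' : Turn p v₀ v₁ v₂ σL σR) (hlt : u₀ < v₀)
    (hu : 0 < u₂) (hv : 0 < v₂) : u₂ < v₂ := by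
  have h1 := h.left.lt_of_lt h'.left h.y₀_pos h.y₁_neg h'.y₁_neg hlt
  have h2 := h.right.lt_of_lt h'.right (neg_pos.2 h.y₁_neg) (neg_neg_of_pos hu)
    (neg_neg_of_pos hv) (by linarith)
  linarith

lemma Loop.mem_turnSet {p : LienardParams} {γ : ℝ → ℝ × ℝ} {y₀ y₁ τL τR a : ℝ}
    (h : Loop p y₀ y₁ τL τR) (hγ : p.IsTrajectoryOn univ γ) (ha : γ a = (0, y₀)) {t : ℝ}
    (ht : a ≤ t) : γ t ∈ turnSet p y₀ y₁ τL τR := by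
  have hτ : 0 < τL + τR := add_pos h.left.pos h.right.pos
  have hn : ∀ n : ℕ, γ (a + n * (τL + τR)) = (0, y₀) := fun n => by
    induction n with
    | zero => simpa using ha
    | succ n ih =>
      have := (h.turn.follow hγ MeasurableSet.univ (subset_univ _) ih).2.2
      rw [← this]; congr 1; push_cast; ring
  set n := ⌊(t - a) / (τL + τR)⌋₊
  have h1 : (n : ℝ) ≤ (t - a) / (τL + τR) := Nat.floor_le (div_nonneg (by linarith) hτ.le)
  have h2 : (t - a) / (τL + τR) < n + 1 := Nat.lt_floor_add_one _
  rw [le_div_iff₀ hτ] at h1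
  rw [div_lt_iff₀ hτ] at h2
  exact h.turn.follow_mem hγ MeasurableSet.univ (subset_univ _) (hn n)
    ⟨by linarith, by linarith⟩

lemma Loop.range_eq {p : LienardParams} {γ : ℝ → ℝ × ℝ} {y₀ y₁ τL τR a T : ℝ}
    (h : Loop p y₀ y₁ τL τR) (hγ : p.IsTrajectoryOn univ γ) (hT : 0 < T)
    (hper : Function.Periodic γ T) (ha : γ a = (0, y₀)) : range γ = turnSet p y₀ y₁ τL τR := by
  apply Subset.antisymm
  · rintro z ⟨t, rfl⟩
    obtain ⟨n, hn⟩ := exists_nat_gt ((a - t) / T)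
    rw [div_lt_iff₀ hT] at hn
    have := hper.nat_mul n t
    rw [← this]
    exact h.mem_turnSet hγ ha (by linarith)
  · obtain ⟨h1, h2, -⟩ := h.turn.follow hγ MeasurableSet.univ (subset_univ _) ha
    rintro z (⟨t, ht, rfl⟩ | ⟨t, ht, rfl⟩)
    · exact ⟨_, h1 t ht⟩
    · exact ⟨_, h2 t ht⟩

/-- Let `M` be the largest intersection with the positive half-line, `v₀` its predecessor and `u₂`
its successor under the return map. Then `v₀ ≤ M`, and `v₀ < M` would give `M < u₂` by monotonicity.
So `M` is a fixed point, and the orbit is the loop through it, which meets the half-line only there.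
-/
theorem IsClosedOrbit.exists_loop {p : LienardParams} {Γ : Set (ℝ × ℝ)} (hΓ : p.IsClosedOrbit Γ)
    (hcr : IsCrossing Γ) {y : ℝ} (hy : 0 < y) (hmem : (0, y) ∈ Γ) :
    ∃ y₁ τL τR, Loop p y y₁ τL τR ∧ Γ = turnSet p y y₁ τL τR := by
  obtain ⟨γ, hγ, ⟨T, hT, hper⟩, -, rfl⟩ := hΓ
  have hcr := hcr.2
  have hcont : Continuous γ := continuous_iff_continuousAt.2 fun t =>
    (hγ.continuousOn_Icc (a := t - 1) (b := t + 1) (by linarith) (subset_univ _)).continuousAt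
      (Icc_mem_nhds (by linarith) (by linarith))
  have hΓc : IsCompact (range γ) := by
    rw [← hper.image_Icc hT 0]
    exact isCompact_Icc.image hcont
  have hAc : IsCompact ((Prod.snd '' (range γ ∩ {z | z.1 = 0})) ∩ Ici 0) :=
    ((hΓc.inter_right (isClosed_eq continuous_fst continuous_const)).image continuous_snd).inter_right
      isClosed_Ici
  have hA : ∀ u : ℝ, 0 ≤ u → (0, u) ∈ range γ →
      u ∈ (Prod.snd '' (range γ ∩ {z | z.1 = 0})) ∩ Ici 0 := fun u hu h =>
    ⟨⟨(0, u), ⟨h, rfl⟩, rfl⟩, hu⟩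
  obtain ⟨M, ⟨⟨⟨x, M'⟩, ⟨hM1, hM2⟩, hM3⟩, hM4⟩, hM⟩ := hAc.exists_isGreatest ⟨y, hA y hy.le hmem⟩
  simp only [mem_ofPred_eq] at hM2 hM3
  subst hM2 hM3
  have hM4 : 0 ≤ M' := hM4
  have hM0 : 0 < M' := lt_of_le_of_ne hM4 (hcr _ hM1 rfl).symm
  -- the predecessor of the largest intersection is itself
  obtain ⟨u₁, u₂, σL, σR, hu₂, hu, hu₂mem⟩ := next_turn hγ hT hper hcr hM0 hM1
  obtain ⟨v₁, v₀, ρL, ρR, hv, hv₀mem⟩ := prev_turn hγ hT hper hcr hM0 hM1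
  have hv₀ : v₀ ≤ M' := hM (hA v₀ hv.y₀_pos.le hv₀mem)
  have hu₂' : u₂ ≤ M' := hM (hA u₂ hu₂.le hu₂mem)
  have heq : v₀ = M' := by
    rcases eq_or_lt_of_le hv₀ with h | h
    · exact h
    · have := hv.lt_of_lt hu h hM0 hu₂
      linarith
  subst heq
  obtain ⟨a, ha⟩ := hM1
  have hrange := hv.loop.range_eq hγ hT hper ha
  have hyM : y = v₀ := by
    rw [hrange] at hmem
    rcases hv.turnSet_section hmem with h | h | h
    · exact h
    · linarith [hv.y₁_neg]
    · exact h
  subst hyM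
  exact ⟨v₁, ρL, ρR, hv.loop, hrange⟩

end LienardParams

namespace LienardParams

/-! ### Landing on the switching line near an arc -/

/-- The time `η` is uniform over a neighbourhood: either `x < 0` persists near `w`, or `x' < 0`
does. -/
lemma EntersLeft.exists_neg {T D a : ℝ} {w : ℝ × ℝ} (hw : EntersLeft w) :
    ∃ η > 0, ∀ᶠ z in 𝓝 w, EntersLeft z → ∀ t ∈ Ioc 0 η, (flow T D a t z).1 < 0 := by
  have hc := continuous_flow T D a
  rcases hw with h | ⟨h1, h2⟩
  · have : ∀ᶠ q : ℝ × (ℝ × ℝ) in 𝓝 (0, w), (flow T D a q.1 q.2).1 < 0 :=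
      (continuous_fst.comp hc).continuousAt.eventually (gt_mem_nhds (by simpa using h))
    rw [nhds_prod_eq, eventually_prod_iff] at this
    obtain ⟨P, hP, Q, hQ, hPQ⟩ := this
    obtain ⟨η, hη, hP⟩ := mem_nhdsGT_iff_exists_Ioc_subset.1 (mem_nhdsWithin_of_mem_nhds hP)
    exact ⟨η, hη, by filter_upwards [hQ] with z hz _ t ht using hPQ (hP ht) hz⟩
  · have : ∀ᶠ q : ℝ × (ℝ × ℝ) in 𝓝 (0, w), (field T D a (flow T D a q.1 q.2)).1 < 0 :=
      (continuous_fst.comp ((continuous_field T D a).comp hc)).continuousAt.eventually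
        (gt_mem_nhds (by simpa [field, h1] using h2))
    rw [nhds_prod_eq, eventually_prod_iff] at this
    obtain ⟨P, hP, Q, hQ, hPQ⟩ := this
    obtain ⟨η, hη, hP⟩ := mem_nhdsGT_iff_exists_Ioc_subset.1 (mem_nhdsWithin_of_mem_nhds hP)
    refine ⟨η, hη, ?_⟩
    filter_upwards [hQ] with z hz hzl t ht
    have hd : ∀ s, HasDerivAt (fun s => (flow T D a s z).1) (field T D a (flow T D a s z)).1 s :=
      fun s => (hasDerivAt_flow T D a s z).fst
    have hanti : StrictAntiOn (fun s => (flow T D a s z).1) (Icc 0 η) := by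
      refine strictAntiOn_of_deriv_neg (convex_Icc 0 η)
        (fun s _ => (hd s).continuousAt.continuousWithinAt) fun s hs => ?_
      rw [interior_Icc] at hs
      rw [(hd s).deriv]
      exact hPQ (hP ⟨hs.1, hs.2.le⟩) hz
    have hη : (0 : ℝ) < η := hη
    have := hanti ⟨le_rfl, hη.le⟩ ⟨ht.1.le, ht.2⟩ ht.1
    simp only [flow_zero] at this
    rcases hzl with h | h <;> linarith [h]

lemma flow_pos_after {T D a : ℝ} {w : ℝ × ℝ} {s y₁ : ℝ} (hland : flow T D a s w = (0, y₁))
    (hy₁ : y₁ < 0) {U : Set (ℝ × ℝ)} (hU : IsOpen U) (hmem : (0, y₁) ∈ U) :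
    ∃ b > s, ∀ t ∈ Ioc s b, 0 < (flow T D a t w).1 ∧ flow T D a t w ∈ U := by
  have hd : HasDerivAt (fun t => (flow T D a t w).1) (-y₁) s := by
    have : HasDerivAt (fun t => (flow T D a t w).1) _ s := (hasDerivAt_flow T D a s w).fst
    rw [hland] at this
    exact this.congr_deriv (by simp [field])
  have h1 : ∀ᶠ t in 𝓝[>] s, 0 < (flow T D a t w).1 := by
    have h := (hasDerivWithinAt_iff_tendsto_slope' self_notMem_Ioi).1
      (hd.hasDerivWithinAt (s := Ioi s))
    filter_upwards [h.eventually (lt_mem_nhds (neg_pos.2 hy₁)), self_mem_nhdsWithin] with t ht hts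
    rw [slope_def_field, hland, sub_zero] at ht
    exact (div_pos_iff_of_pos_right (sub_pos.2 hts)).1 ht
  have h2 : ∀ᶠ t in 𝓝[>] s, flow T D a t w ∈ U :=
    ((continuous_flow_time T D a w).continuousAt.eventually
      (hU.mem_nhds (by simpa only [hland] using hmem))).filter_mono nhdsWithin_le_nhds
  obtain ⟨b, hb, hsub⟩ := mem_nhdsGT_iff_exists_Ioc_subset.1 (h1.and h2)
  exact ⟨b, hb, hsub⟩

/-- The flow from `z` stays in `U` and in `x < 0` until it lands on `x = 0`, in `O`, after a time
at least `η`. -/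
def Lands (T D a η : ℝ) (U O : Set (ℝ × ℝ)) (z : ℝ × ℝ) : Prop :=
  ∃ c, 0 < c ∧ η ≤ c ∧ (flow T D a c z).1 = 0 ∧ flow T D a c z ∈ O ∧
    (∀ t ∈ Ioo 0 c, (flow T D a t z).1 < 0) ∧ ∀ t ∈ Icc 0 c, flow T D a t z ∈ U

/-- The arc from `w` crosses the line transversally at time `s` and is in `x > 0` at a slightly
later time `b`. Nearby orbits are also in `x > 0` at time `b`, so they hit the line before; by
compactness of the time intervals they do so inside `O` without leaving `U`. The case `s = 0` treats
the landing point itself. -/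
lemma eventually_lands {T D a : ℝ} {w : ℝ × ℝ} {s y₁ : ℝ} (hs : 0 ≤ s)
    (hland : flow T D a s w = (0, y₁)) (hy₁ : y₁ < 0)
    (hneg : ∀ t ∈ Ioo 0 s, (flow T D a t w).1 < 0) (hw : s = 0 ∨ EntersLeft w)
    {U : Set (ℝ × ℝ)} (hU : IsOpen U) (hUm : ∀ t ∈ Icc 0 s, flow T D a t w ∈ U)
    {O : Set (ℝ × ℝ)} (hO : IsOpen O) (hmem : (0, y₁) ∈ O) :
    ∃ η, 0 ≤ η ∧ (0 < s → 0 < η) ∧ ∀ᶠ z in 𝓝 w, EntersLeft z → Lands T D a η U O z := by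
  have hc := continuous_flow T D a
  have hc' : Continuous fun q : (ℝ × ℝ) × ℝ => flow T D a q.2 q.1 :=
    hc.comp (continuous_snd.prodMk continuous_fst)
  obtain ⟨b, hb, hbp⟩ := flow_pos_after hland hy₁ hU
    (by rw [← hland]; exact hUm s ⟨hs, le_rfl⟩)
  obtain ⟨η, hη0, hηs, hηb, hη⟩ : ∃ η, 0 ≤ η ∧ (0 < s → 0 < η) ∧ η ≤ s ∧
      ∀ᶠ z in 𝓝 w, EntersLeft z → ∀ t ∈ Ioc 0 η, (flow T D a t z).1 < 0 := by
    rcases eq_or_lt_of_le hs with h0 | h0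
    · exact ⟨0, le_rfl, fun h => by linarith, hs, Eventually.of_forall fun z _ t ht => by
        linarith [ht.1, ht.2]⟩
    · obtain ⟨η, hη, h⟩ := (hw.resolve_left h0.ne').exists_neg (T := T) (D := D) (a := a)
      refine ⟨min η s, le_min hη.le hs, fun _ => lt_min hη h0, min_le_right _ _, ?_⟩
      filter_upwards [h] with z hz hl t ht using hz hl t ⟨ht.1, ht.2.trans (min_le_left _ _)⟩
  have htube1 : ∀ᶠ z in 𝓝 w, ∀ t ∈ Icc 0 b, flow T D a t z ∈ U := by
    refine isCompact_Icc.eventually_forall_of_forall_eventually fun t ht =>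
      hc'.continuousAt.eventually (hU.mem_nhds ?_)
    rcases le_or_gt t s with h | h
    · exact hUm t ⟨ht.1, h⟩
    · exact (hbp t ⟨h, ht.2⟩).2
  -- Times below `η` are excluded, since `w` itself may lie on the switching line outside `O`.
  have htube2 : ∀ᶠ z in 𝓝 w, ∀ t ∈ Icc η b, (flow T D a t z).1 ≠ 0 ∨ flow T D a t z ∈ O := by
    have hop : IsOpen {z : ℝ × ℝ | z.1 ≠ 0 ∨ z ∈ O} :=
      (isOpen_ne_fun continuous_fst continuous_const).union hO
    refine isCompact_Icc.eventually_forall_of_forall_eventually fun t ht =>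
      hc'.continuousAt.eventually (hop.mem_nhds ?_)
    rcases lt_trichotomy t s with h | h | h
    · rcases eq_or_lt_of_le (hη0.trans ht.1) with h0 | h0
      · exact absurd (hηs (by linarith)) (by linarith [ht.1])
      · exact Or.inl (hneg t ⟨h0, h⟩).ne
    · right; simpa only [h, hland] using hmem
    · exact Or.inl (hbp t ⟨h, ht.2⟩).1.ne'
  have hpos : ∀ᶠ z in 𝓝 w, 0 < (flow T D a b z).1 :=
    (continuous_fst.comp (hc.comp (Continuous.prodMk_right b))).continuousAt.eventually
      (lt_mem_nhds (hbp b ⟨hb, le_rfl⟩).1)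
  refine ⟨η, hη0, hηs, ?_⟩
  filter_upwards [hη, htube1, htube2, hpos] with z h1 h2 h3 h4 hz
  have hb0 : 0 < b := lt_of_le_of_lt hs hb
  obtain ⟨η', hη', hz'⟩ := hz.exists_neg (T := T) (D := D) (a := a)
  have hz' := hz'.self_of_nhds hz
  obtain ⟨c, hc1, hc0, hcneg⟩ := exists_first_zero (f := fun t => -(flow T D a t z).1) (a := 0) (b := b)
    (continuous_fst.comp (continuous_flow_time T D a z)).neg.continuousOn hb0
    (by filter_upwards [Ioc_mem_nhdsGT hη'] with t ht using neg_pos.2 (hz' t ht)) (by linarith)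
  have hc0 : (flow T D a c z).1 = 0 := by linarith
  have hηc : η ≤ c := by
    by_contra hlt
    have := h1 hz c ⟨hc1.1, (not_le.1 hlt).le⟩
    linarith
  exact ⟨c, hc1.1, hηc, hc0, (h3 c ⟨hηc, hc1.2⟩).resolve_left (not_not.2 hc0),
    fun t ht => neg_pos.1 (hcneg t ht), fun t ht => h2 t ⟨ht.1, ht.2.trans hc1.2⟩⟩

/-! ### Trajectories that reach a set inside a neighbourhood -/

/-- Every forward trajectory from `z` reaches `A`, after a time at least `η`, and is in `U` until
then. -/
def Reach (p : LienardParams) (η : ℝ) (U A : Set (ℝ × ℝ)) (z : ℝ × ℝ) : Prop :=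
  ∀ γ ∈ p.forwardTrajectories, γ 0 = z → ∃ s, 0 ≤ s ∧ η ≤ s ∧ γ s ∈ A ∧ ∀ t ∈ Icc 0 s, γ t ∈ U

lemma shift_mem_forwardTrajectories {p : LienardParams} {γ : ℝ → ℝ × ℝ}
    (hγ : γ ∈ p.forwardTrajectories) {s : ℝ} (hs : 0 ≤ s) :
    (fun t => γ (t + s)) ∈ p.forwardTrajectories :=
  IsTrajectoryOn.shift hγ measurableSet_Ici measurableSet_Ici s fun _ ht => add_nonneg ht hs

lemma neg_mem_forwardTrajectories {p : LienardParams} {γ : ℝ → ℝ × ℝ}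
    (hγ : γ ∈ p.forwardTrajectories) : (fun t => -γ t) ∈ (rot p).forwardTrajectories :=
  IsTrajectoryOn.halfTurn hγ measurableSet_Ici

lemma Reach.trans {p : LienardParams} {η η' : ℝ} {U A B : Set (ℝ × ℝ)} {z : ℝ × ℝ}
    (h : Reach p η U A z) (hAB : ∀ w ∈ A, Reach p η' U B w) : Reach p (η + η') U B z := by
  intro γ hγ hz
  obtain ⟨s, hs0, hs, hsA, hsU⟩ := h γ hγ hz
  obtain ⟨s', hs0', hs', hsB, hsU'⟩ := hAB _ hsA _ (shift_mem_forwardTrajectories hγ hs0) (by simp)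
  refine ⟨s' + s, by linarith, by linarith, hsB, fun t ht => ?_⟩
  rcases le_total t s with h | h
  · exact hsU t ⟨ht.1, h⟩
  · have := hsU' (t - s) ⟨by linarith, by linarith [ht.2]⟩
    simpa using this

lemma Reach.mono {p : LienardParams} {η η' : ℝ} {U A B : Set (ℝ × ℝ)} {z : ℝ × ℝ}
    (h : Reach p η U A z) (hη : η' ≤ η) (hAB : A ⊆ B) : Reach p η' U B z := fun γ hγ hz => by
  obtain ⟨s, hs0, hs, hsA, hsU⟩ := h γ hγ hz
  exact ⟨s, hs0, hη.trans hs, hAB hsA, hsU⟩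

lemma Reach.of_rot {p : LienardParams} {η : ℝ} {U A : Set (ℝ × ℝ)} {z : ℝ × ℝ}
    (h : Reach (rot p) η (-U) (-A) (-z)) : Reach p η U A z := fun γ hγ hz => by
  obtain ⟨s, hs0, hs, hsA, hsU⟩ := h _ (neg_mem_forwardTrajectories hγ) (by simp [hz])
  exact ⟨s, hs0, hs, by simpa using hsA, fun t ht => by simpa using hsU t ht⟩

lemma Lands.reach {p : LienardParams} {η : ℝ} {U O : Set (ℝ × ℝ)} {z : ℝ × ℝ}
    (h : Lands p.TL p.DL p.aL η U O z) (hz : EntersLeft z) :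
    Reach p η U (O ∩ {w | w.1 = 0}) z := by
  rintro γ hγ rfl
  obtain ⟨c, hc, hηc, h0, hO, hneg, hU⟩ := h
  have hf : ∀ t ∈ Icc 0 c, γ t = flow p.TL p.DL p.aL t (γ 0) := fun t ht => by
    have := IsTrajectoryOn.follow hγ (a := 0) (τ := c) (fun t ht => ht.1) hz hneg ht
    simpa using this
  refine ⟨c, hc.le, hηc, ?_, fun t ht => by rw [hf t ht]; exact hU t ht⟩
  rw [hf c ⟨hc.le, le_rfl⟩]
  exact ⟨hO, h0⟩

lemma Lands.reach_right {p : LienardParams} {η : ℝ} {U O : Set (ℝ × ℝ)} {z : ℝ × ℝ}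
    (h : Lands p.TR p.DR (-p.aR) η (-U) (-O) (-z)) (hz : EntersLeft (-z)) :
    Reach p η U (O ∩ {w | w.1 = 0}) z := by
  refine Reach.of_rot ((Lands.reach (p := rot p) h hz).mono le_rfl fun w hw => ?_)
  simpa using hw

end LienardParams

namespace LienardParams

/-! ### Stability of contracting loops -/

lemma Lands.of_leftArc {T D a η : ℝ} {U O : Set (ℝ × ℝ)} {y y' τ : ℝ}
    (h : Lands T D a η U O (0, y)) (h' : LeftArc T D a y y' τ) :
    Lands T D a η U {(0, y')} (0, y) := by
  obtain ⟨c, hc, hηc, h0, -, hneg, hU⟩ := h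
  have hl : flow T D a c (0, y) = (0, (flow T D a c (0, y)).2) := Prod.ext h0 rfl
  have harc : LeftArc T D a y _ c := ⟨hc, hl, hneg⟩
  refine ⟨c, hc, hηc, h0, ?_, hneg, hU⟩
  rw [hl, (harc.unique h').2]; rfl

lemma LeftArc.eventually_lands {T D a y₀ y₁ τ : ℝ} (h : LeftArc T D a y₀ y₁ τ) (hy₀ : 0 < y₀)
    (hy₁ : y₁ < 0) {U : Set (ℝ × ℝ)} (hU : IsOpen U)
    (hUm : ∀ t ∈ Icc 0 τ, flow T D a t (0, y₀) ∈ U) {O : Set (ℝ × ℝ)} (hO : IsOpen O)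
    (hmem : (0, y₁) ∈ O) {s : ℝ} (hs : s ∈ Icc 0 τ) :
    ∃ η, 0 ≤ η ∧ (s < τ → 0 < η) ∧
      ∀ᶠ z in 𝓝 (flow T D a s (0, y₀)), EntersLeft z → Lands T D a η U O z := by
  have := LienardParams.eventually_lands (T := T) (D := D) (a := a) (w := flow T D a s (0, y₀))
    (s := τ - s) (by linarith [hs.2]) (by rw [← flow_add, add_sub_cancel, h.land]) hy₁
    (fun t ht => by
      rw [← flow_add]; exact h.neg _ ⟨by linarith [hs.1, ht.1], by linarith [ht.2]⟩)
    (by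
      rcases eq_or_lt_of_le hs.2 with h1 | h1
      · exact Or.inl (by linarith)
      · rcases eq_or_lt_of_le hs.1 with h0 | h0
        · rw [← h0, flow_zero]; exact Or.inr (Or.inr ⟨rfl, hy₀⟩)
        · exact Or.inr (Or.inl (h.neg s ⟨h0, h1⟩))) hU
    (fun t ht => by
      rw [← flow_add]; exact hUm _ ⟨by linarith [hs.1, ht.1], by linarith [ht.2]⟩) hO hmem
  simpa only [sub_pos] using this

/-- The points of the switching line at distance less than `ε` from `(0, y₀)`. -/
def sect (y₀ ε : ℝ) : Set (ℝ × ℝ) := {w | w.1 = 0 ∧ |w.2 - y₀| < ε}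

lemma Loop.left_subset {p : LienardParams} {y₀ y₁ τL τR : ℝ} {U : Set (ℝ × ℝ)}
    (hU : turnSet p y₀ y₁ τL τR ⊆ U) : ∀ t ∈ Icc 0 τL, flow p.TL p.DL p.aL t (0, y₀) ∈ U :=
  fun t ht => hU (Or.inl ⟨t, ht, rfl⟩)

lemma Loop.right_subset {p : LienardParams} {y₀ y₁ τL τR : ℝ} {U : Set (ℝ × ℝ)}
    (hU : turnSet p y₀ y₁ τL τR ⊆ U) :
    ∀ t ∈ Icc 0 τR, flow p.TR p.DR (-p.aR) t (0, -y₁) ∈ -U :=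
  fun t ht => hU (Or.inr ⟨t, ht, rfl⟩)

/-- In the derivative of the return map the factors `y₀ / y₁` and `y₁ / y₀` of the two half-maps
cancel, leaving `exp (TL τL + TR τR) < 1`. -/
lemma Loop.exists_turns {p : LienardParams} {y₀ y₁ τL τR : ℝ} (h : Loop p y₀ y₁ τL τR)
    (hneg : p.TL * τL + p.TR * τR < 0) :
    ∃ (k : ℝ) (f P : ℝ → ℝ), 0 < k ∧ k < 1 ∧ Tendsto f (𝓝 y₀) (𝓝 y₁) ∧ ∀ᶠ y in 𝓝 y₀,
      |P y - y₀| ≤ k * |y - y₀| ∧ ∃ σL σR, Turn p y (f y) (P y) σL σR := by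
  have hR := h.turn.right
  have hy₀ := h.y₀_pos
  have hy₁ := h.y₁_neg
  obtain ⟨f, hf, hfa⟩ := h.left.exists_local hy₀ hy₁
  obtain ⟨g, hg, hga⟩ := hR.exists_local (neg_pos.2 hy₁) (neg_neg_of_pos hy₀)
  have hf0 : f y₀ = y₁ := by
    obtain ⟨τ, hτ⟩ := hfa.self_of_nhds
    exact (hτ.unique h.left).2
  have hg0 : g (-y₁) = -y₀ := by
    obtain ⟨τ, hτ⟩ := hga.self_of_nhds
    exact (hτ.unique hR).2
  have hcf : Tendsto f (𝓝 y₀) (𝓝 y₁) := by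
    have := hf.continuousAt.tendsto
    rwa [hf0] at this
  have hnf : HasDerivAt (fun y => -f y) _ y₀ := hf.neg
  have hP : HasDerivAt (fun y => -g (-f y)) (Real.exp (p.TL * τL + p.TR * τR)) y₀ := by
    have hg' : HasDerivAt g (-y₁ / -y₀ * Real.exp (p.TR * τR)) ((fun y => -f y) y₀) := by
      rw [show (fun y => -f y) y₀ = -y₁ by simp [hf0]]; exact hg
    refine ((hg'.comp y₀ hnf).neg).congr_deriv ?_
    have h0 := hy₀.ne'
    have h1 := hy₁.ne
    rw [Real.exp_add]
    field_simp
  set e := Real.exp (p.TL * τL + p.TR * τR)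
  have he0 : 0 < e := Real.exp_pos _
  have he1 : e < 1 := by rw [← Real.exp_zero]; exact Real.exp_lt_exp.2 hneg
  have hcontr : ∀ᶠ y in 𝓝 y₀, |-g (-f y) - y₀| ≤ (1 + e) / 2 * |y - y₀| := by
    -- The error `(1 - e) / 2` is chosen so that the contraction constant `e + (1 - e) / 2` is
    -- halfway between `e` and `1`.
    have := (hasDerivAt_iff_isLittleO.1 hP).def (show 0 < (1 - e) / 2 by linarith)
    filter_upwards [this] with y hy
    simp only [hf0, hg0, neg_neg, smul_eq_mul, Real.norm_eq_abs] at hy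
    have h3 := abs_add_le (-g (-f y) - y₀ - (y - y₀) * e) ((y - y₀) * e)
    rw [sub_add_cancel, abs_mul (y - y₀) e, abs_of_pos he0] at h3
    linarith
  refine ⟨(1 + e) / 2, f, fun y => -g (-f y), by linarith, by linarith, hcf, ?_⟩
  filter_upwards [hcontr, hfa, hcf.neg.eventually hga, lt_mem_nhds hy₀,
    hcf.eventually (gt_mem_nhds hy₁)] with y h1 ⟨τ, h4⟩ ⟨τ', h5⟩ h6 h7
  exact ⟨h1, τ, τ', h6, h7, h4, by rwa [neg_neg]⟩

/-- Each turn takes at least a fixed time `η > 0`, so that iterating turns exhausts `[0, ∞)`. -/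
lemma Loop.exists_contraction {p : LienardParams} {y₀ y₁ τL τR : ℝ} (h : Loop p y₀ y₁ τL τR)
    (hneg : p.TL * τL + p.TR * τR < 0) {U : Set (ℝ × ℝ)} (hU : IsOpen U)
    (hΓ : turnSet p y₀ y₁ τL τR ⊆ U) :
    ∃ k η ε, 0 < k ∧ k < 1 ∧ 0 < η ∧ 0 < ε ∧ ∀ r ≤ ε, ∀ w ∈ sect y₀ r,
      Reach p η U (sect y₀ (k * r)) w := by
  have hR := h.turn.right
  have hy₀ := h.y₀_pos
  have hy₁ := h.y₁_neg
  obtain ⟨k, f, P, hk, hk1, hf, hturn⟩ := h.exists_turns hneg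
  obtain ⟨η₁, hη₁, -, hL⟩ := h.left.eventually_lands hy₀ hy₁ hU (Loop.left_subset hΓ) isOpen_univ
    (mem_univ _) ⟨le_rfl, h.left.pos.le⟩
  obtain ⟨η₂, -, hη₂, hRl⟩ := hR.eventually_lands (neg_pos.2 hy₁) (neg_neg_of_pos hy₀) hU.neg
    (Loop.right_subset hΓ) isOpen_univ (mem_univ _) ⟨le_rfl, hR.pos.le⟩
  rw [flow_zero] at hL hRl
  have hη₂ := hη₂ hR.pos
  have hyR : ∀ᶠ y in 𝓝 y₀, EntersLeft (0, -f y) → Lands p.TR p.DR (-p.aR) η₂ (-U) univ (0, -f y) :=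
    ((Continuous.prodMk_right (0 : ℝ)).continuousAt.tendsto.comp hf.neg).eventually hRl
  have hyL : ∀ᶠ y in 𝓝 y₀, EntersLeft (0, y) → Lands p.TL p.DL p.aL η₁ U univ (0, y) :=
    (Continuous.prodMk_right (0 : ℝ)).continuousAt.tendsto.eventually hL
  have hall : ∀ᶠ y in 𝓝 y₀, |P y - y₀| ≤ k * |y - y₀| ∧
      Reach p (η₁ + η₂) U {(0, P y)} (0, y) := by
    filter_upwards [hturn, hyR, hyL] with y ⟨h1, τ, τ', ht⟩ h2 h3
    refine ⟨h1, ?_⟩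
    have hel : EntersLeft (0, y) := Or.inr ⟨rfl, ht.y₀_pos⟩
    have her : EntersLeft (0, -f y) := Or.inr ⟨rfl, neg_pos.2 ht.y₁_neg⟩
    refine (((h3 hel).of_leftArc ht.left).reach hel).trans (A := _) ?_
    rintro w ⟨rfl, -⟩
    have hz : -((0 : ℝ), f y) = (0, -f y) := by simp
    refine (Lands.reach_right (O := {(0, P y)}) ?_ (by rw [hz]; exact her)).mono le_rfl
      inter_subset_left
    rw [hz, neg_singleton]
    convert (h2 her).of_leftArc ht.right using 2
    simp
  obtain ⟨ε, hε, hball⟩ := Metric.eventually_nhds_iff.1 hall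
  refine ⟨k, η₁ + η₂, ε, hk, hk1, by linarith, hε, ?_⟩
  rintro r hr ⟨x, y⟩ ⟨hx, hy⟩
  simp only at hx hy
  subst hx
  obtain ⟨h1, h2⟩ := hball (lt_of_lt_of_le hy hr)
  refine h2.mono le_rfl ?_
  rintro w rfl
  exact ⟨rfl, lt_of_le_of_lt h1 (by gcongr)⟩

lemma Loop.exists_left_of_nonpos {p : LienardParams} {y₀ y₁ τL τR : ℝ} (h : Loop p y₀ y₁ τL τR)
    {w : ℝ × ℝ} (hw : w ∈ turnSet p y₀ y₁ τL τR) (hw1 : w.1 ≤ 0) :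
    ∃ s ∈ Icc 0 τL, flow p.TL p.DL p.aL s (0, y₀) = w := by
  rcases hw with hw | ⟨t, ht, rfl⟩
  · exact hw
  · simp only at hw1 ⊢
    have hR := h.turn.right
    rcases eq_or_lt_of_le ht.1 with h0 | h0
    · exact ⟨τL, ⟨h.left.pos.le, le_rfl⟩, by rw [h.left.land, ← h0, flow_zero]; simp⟩
    rcases eq_or_lt_of_le ht.2 with h1 | h1
    · exact ⟨0, ⟨le_rfl, h.left.pos.le⟩, by rw [h1, hR.land, flow_zero]; simp⟩
    · have := hR.neg t ⟨h0, h1⟩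
      simp at hw1; linarith

lemma Loop.exists_right_of_nonneg {p : LienardParams} {y₀ y₁ τL τR : ℝ}
    (h : Loop p y₀ y₁ τL τR) {w : ℝ × ℝ} (hw : w ∈ turnSet p y₀ y₁ τL τR) (hw1 : 0 ≤ w.1) :
    ∃ s ∈ Icc 0 τR, flow p.TR p.DR (-p.aR) s (0, -y₁) = -w := by
  have hR := h.turn.right
  rcases hw with ⟨t, ht, rfl⟩ | ⟨t, ht, rfl⟩
  · simp only at hw1 ⊢
    rcases eq_or_lt_of_le ht.1 with h0 | h0
    · exact ⟨τR, ⟨hR.pos.le, le_rfl⟩, by rw [hR.land, ← h0, flow_zero]; simp⟩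
    rcases eq_or_lt_of_le ht.2 with h1 | h1
    · exact ⟨0, ⟨le_rfl, hR.pos.le⟩, by rw [h1, h.left.land, flow_zero]; simp⟩
    · have := h.left.neg t ⟨h0, h1⟩
      linarith
  · exact ⟨t, ht, by simp⟩

lemma Loop.mem_left {p : LienardParams} {y₀ y₁ τL τR : ℝ} (h : Loop p y₀ y₁ τL τR) :
    (0, y₀) ∈ turnSet p y₀ y₁ τL τR :=
  Or.inl ⟨0, ⟨le_rfl, h.left.pos.le⟩, by simp⟩

lemma Loop.mem_right {p : LienardParams} {y₀ y₁ τL τR : ℝ} (h : Loop p y₀ y₁ τL τR) :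
    (0, y₁) ∈ turnSet p y₀ y₁ τL τR :=
  Or.inl ⟨τL, ⟨h.left.pos.le, le_rfl⟩, h.left.land⟩

lemma Loop.eventually_reach {p : LienardParams} {y₀ y₁ τL τR : ℝ} (h : Loop p y₀ y₁ τL τR)
    {U : Set (ℝ × ℝ)} (hU : IsOpen U) (hΓ : turnSet p y₀ y₁ τL τR ⊆ U) {ε : ℝ} (hε : 0 < ε)
    {w : ℝ × ℝ} (hw : w ∈ turnSet p y₀ y₁ τL τR) : ∀ᶠ z in 𝓝 w, Reach p 0 U (sect y₀ ε) z := by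
  have hR := h.turn.right
  have hy₀ := h.y₀_pos
  have hy₁ := h.y₁_neg
  have hright : ∀ w ∈ turnSet p y₀ y₁ τL τR, 0 ≤ w.1 →
      ∀ᶠ z in 𝓝 w, EntersLeft (-z) → Reach p 0 U (sect y₀ ε) z := by
    intro w hw hw1
    obtain ⟨s, hs, hsw⟩ := h.exists_right_of_nonneg hw hw1
    set O : Set (ℝ × ℝ) := {w | |w.2 - y₀| < ε}
    have hO : IsOpen O := isOpen_lt (by fun_prop) continuous_const
    obtain ⟨η, hη, -, hl⟩ := hR.eventually_lands (neg_pos.2 hy₁) (neg_neg_of_pos hy₀) hU.neg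
      (Loop.right_subset hΓ) hO.neg (by simpa [O] using hε) hs
    rw [hsw] at hl
    filter_upwards [(continuous_neg.tendsto w).eventually hl] with z hz hzr
    exact (Lands.reach_right (hz hzr) hzr).mono hη fun v hv => ⟨hv.2, hv.1⟩
  -- A left arc is required to land in a neighbourhood of `(0, y₁)` from which the right arc is
  -- already controlled.
  obtain ⟨O, hOsub, hO, hOm⟩ := mem_nhds_iff.1 ((hright _ h.mem_right le_rfl).and
    ((isOpen_lt continuous_snd continuous_const).mem_nhds (show ((0 : ℝ), y₁).2 < 0 from hy₁)))
  have hleft : ∀ w ∈ turnSet p y₀ y₁ τL τR, w.1 ≤ 0 →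
      ∀ᶠ z in 𝓝 w, EntersLeft z → Reach p 0 U (sect y₀ ε) z := by
    intro w hw hw1
    obtain ⟨s, hs, hsw⟩ := h.exists_left_of_nonpos hw hw1
    obtain ⟨η, hη, -, hl⟩ := h.left.eventually_lands hy₀ hy₁ hU (Loop.left_subset hΓ) hO hOm hs
    rw [hsw] at hl
    filter_upwards [hl] with z hz hzl
    refine (((hz hzl).reach hzl).trans (η' := 0) fun v hv => ?_).mono (by linarith) subset_rfl
    obtain ⟨h1, h2⟩ := hOsub hv.1
    have hv2 : v.1 = 0 := hv.2
    exact h1 (Or.inr ⟨by simp [hv2], by simpa using h2⟩)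
  have hl : ∀ᶠ z in 𝓝 w, EntersLeft z → Reach p 0 U (sect y₀ ε) z := by
    rcases le_or_gt w.1 0 with h1 | h1
    · exact hleft w hw h1
    · filter_upwards [continuous_fst.continuousAt.eventually (lt_mem_nhds h1)] with z hz hzl
      rcases hzl with h | h
      · linarith
      · linarith [h.1]
  have hr : ∀ᶠ z in 𝓝 w, EntersLeft (-z) → Reach p 0 U (sect y₀ ε) z := by
    rcases le_or_gt 0 w.1 with h1 | h1
    · exact hright w hw h1
    · filter_upwards [continuous_fst.continuousAt.eventually (gt_mem_nhds h1)] with z hz hzl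
      rcases hzl with h | h
      · simp at h; linarith
      · have := h.1; simp at this; linarith
  -- Only from the origin is neither side entered, and the loop avoids it.
  have hw0 : w ≠ 0 := by
    rintro rfl
    rcases h.turn.turnSet_section (y := 0) hw with h | h | h <;> linarith
  filter_upwards [hl, hr, isOpen_ne.mem_nhds hw0] with z h1 h2 h3
  rcases lt_trichotomy z.1 0 with hz | hz | hz
  · exact h1 (Or.inl hz)
  · rcases lt_trichotomy z.2 0 with hz2 | hz2 | hz2
    · exact h2 (Or.inr ⟨by simp [hz], by simpa using hz2⟩)
    · exact absurd (Prod.ext hz hz2) h3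
    · exact h1 (Or.inr ⟨hz, hz2⟩)
  · exact h2 (Or.inl (by simpa using hz))

lemma Loop.exists_trapping {p : LienardParams} {y₀ y₁ τL τR : ℝ} (h : Loop p y₀ y₁ τL τR)
    (hneg : p.TL * τL + p.TR * τR < 0) {U : Set (ℝ × ℝ)} (hU : IsOpen U)
    (hΓ : turnSet p y₀ y₁ τL τR ⊆ U) :
    ∃ k η ε : ℝ, 0 < k ∧ k < 1 ∧ 0 < η ∧ 0 < ε ∧ ∃ V, IsOpen V ∧ turnSet p y₀ y₁ τL τR ⊆ V ∧
      ∀ z ∈ V, ∀ n : ℕ, Reach p (n * η) U (sect y₀ (k ^ n * ε)) z := by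
  obtain ⟨k, η, ε, hk, hk1, hη, hε, hc⟩ := h.exists_contraction hneg hU hΓ
  refine ⟨k, η, ε, hk, hk1, hη, hε, {z | ∀ᶠ z' in 𝓝 z, Reach p 0 U (sect y₀ ε) z'},
    isOpen_setOfPred_eventually_nhds, fun w hw => h.eventually_reach hU hΓ hε hw, fun z hz n => ?_⟩
  induction n with
  | zero => simpa using Eventually.self_of_nhds hz
  | succ n ih =>
    have := ih.trans (hc (k ^ n * ε) (by
      have : k ^ n ≤ 1 := pow_le_one₀ hk.le hk1.le
      nlinarith))
    refine this.mono (by push_cast; linarith) (le_of_eq ?_)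
    rw [pow_succ]; congr 1; ring

lemma Loop.orbitallyStable {p : LienardParams} {y₀ y₁ τL τR : ℝ} (h : Loop p y₀ y₁ τL τR)
    (hneg : p.TL * τL + p.TR * τR < 0) :
    OrbitallyStable p.forwardTrajectories (turnSet p y₀ y₁ τL τR) := by
  intro U hU hΓ
  obtain ⟨k, η, ε, -, -, hη, -, V, hV, hΓV, hr⟩ := h.exists_trapping hneg hU hΓ
  refine ⟨V, hV, hΓV, fun γ hγ h0 t ht => ?_⟩
  obtain ⟨n, hn⟩ := exists_nat_gt (t / η)
  rw [div_lt_iff₀ hη] at hn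
  obtain ⟨s, -, hs, -, hsU⟩ := hr _ h0 n γ hγ rfl
  exact hsU t ⟨ht, by linarith⟩

/-- After enough turns the trajectory meets the section within any prescribed distance of `(0, y₀)`.
From there stability keeps it in a given neighbourhood of the loop. -/
theorem Loop.isAsymptoticallyStable {p : LienardParams} {y₀ y₁ τL τR : ℝ}
    (h : Loop p y₀ y₁ τL τR) (hneg : p.TL * τL + p.TR * τR < 0) :
    p.IsAsymptoticallyStable (turnSet p y₀ y₁ τL τR) := by
  refine ⟨h.orbitallyStable hneg, ?_⟩
  obtain ⟨k, η, ε, hk, hk1, -, -, V, hV, hΓV, hr⟩ := h.exists_trapping hneg isOpen_univ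
    (subset_univ _)
  refine ⟨V, hV, hΓV, fun γ hγ h0 => ?_⟩
  rw [Metric.tendsto_atTop]
  intro e he
  set U : Set (ℝ × ℝ) := {z | Metric.infDist z (turnSet p y₀ y₁ τL τR) < e}
  obtain ⟨W, hW, hΓW, hst⟩ := h.orbitallyStable hneg U
    (isOpen_lt (Metric.continuous_infDist_pt _) continuous_const)
    fun z hz => by simpa [U, Metric.infDist_zero_of_mem hz] using he
  obtain ⟨r, hr0, hball⟩ := Metric.isOpen_iff.1 hW _ (hΓW h.mem_left)
  have hlim : Tendsto (fun n : ℕ => k ^ n * ε) atTop (𝓝 (0 * ε)) :=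
    (tendsto_pow_atTop_nhds_zero_of_lt_one hk.le hk1).mul_const ε
  rw [zero_mul] at hlim
  obtain ⟨n, hn⟩ := (hlim.eventually (gt_mem_nhds hr0)).exists
  obtain ⟨s, hs, -, ⟨hs1, hs2⟩, -⟩ := hr _ h0 n γ hγ rfl
  refine ⟨s, fun t ht => ?_⟩
  have := hst _ (shift_mem_forwardTrajectories hγ hs) (by
    refine hball ?_
    rw [zero_add, Metric.mem_ball, Prod.dist_eq]
    exact max_lt (by simpa [hs1] using hr0) (by rw [Real.dist_eq]; linarith)) (t - s)
    (sub_nonneg.2 ht)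
  simp only [sub_add_cancel, U, mem_ofPred_eq] at this
  rwa [Real.dist_eq, sub_zero, abs_of_nonneg Metric.infDist_nonneg]

end LienardParams

namespace LienardParams

/-! ### Existence of global forward trajectories -/

/-- A growth bound which is satisfied by trajectories and stable under concatenation. -/
def GrowsOn (C : ℝ) (J : Set ℝ) (γ : ℝ → ℝ × ℝ) : Prop :=
  ∀ s, 0 ≤ s → ∀ t ∈ J, s ≤ t → dist (γ s) (γ t) ≤ (‖γ s‖ + 1) * (Real.exp (C * (t - s)) - 1)

lemma norm_field_le {T D a C : ℝ} (hC : |T| + |D| + |a| + 1 ≤ C) (z : ℝ × ℝ) :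
    ‖field T D a z‖ ≤ C * (‖z‖ + 1) := by
  have h1 : |z.1| ≤ ‖z‖ := norm_fst_le z
  have h2 : |z.2| ≤ ‖z‖ := norm_snd_le z
  have hz := norm_nonneg z
  have hT := abs_nonneg T
  have hD := abs_nonneg D
  have ha := abs_nonneg a
  have hC' : (|T| + |D| + |a| + 1) * (‖z‖ + 1) ≤ C * (‖z‖ + 1) := by gcongr
  refine (max_le ?_ ?_).trans hC'
  · simp only [field, Real.norm_eq_abs]
    have := abs_sub (T * z.1) z.2
    rw [abs_mul] at this
    have := mul_le_mul_of_nonneg_left h1 hT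
    nlinarith
  · simp only [field, Real.norm_eq_abs]
    have := abs_sub (D * z.1) a
    rw [abs_mul] at this
    have := mul_le_mul_of_nonneg_left h1 hD
    nlinarith

lemma dist_flow_le {T D a C : ℝ} (hC : |T| + |D| + |a| + 1 ≤ C) (z : ℝ × ℝ) {t : ℝ} (ht : 0 ≤ t) :
    dist z (flow T D a t z) ≤ (‖z‖ + 1) * (Real.exp (C * t) - 1) := by
  have hC0 : 0 < C := by
    have hT := abs_nonneg T
    have hD := abs_nonneg D
    have ha := abs_nonneg a
    linarith
  have := norm_le_gronwallBound_of_norm_deriv_right_le (f := fun t => flow T D a t z - z)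
    (f' := fun t => field T D a (flow T D a t z)) (δ := 0) (K := C) (ε := C * (‖z‖ + 1)) (a := 0)
    (b := t) ((continuous_flow_time T D a z).sub continuous_const).continuousOn
    (fun s _ => ((hasDerivAt_flow T D a s z).sub_const z).hasDerivWithinAt) (by simp)
    (fun s _ => by
      have h1 := norm_field_le hC (flow T D a s z)
      have h2 : ‖flow T D a s z‖ ≤ ‖flow T D a s z - z‖ + ‖z‖ := norm_le_norm_sub_add _ _
      nlinarith) t ⟨ht, le_rfl⟩
  rw [gronwallBound_of_K_ne_0 hC0.ne'] at this
  rw [dist_comm, dist_eq_norm]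
  refine this.trans (le_of_eq ?_)
  field_simp
  ring_nf

lemma growsOn_flow {T D a C : ℝ} (hC : |T| + |D| + |a| + 1 ≤ C) (J : Set ℝ) (z : ℝ × ℝ) :
    GrowsOn C J (fun t => flow T D a t z) := fun s _ t _ hst => by
  have := dist_flow_le hC (flow T D a s z) (sub_nonneg.2 hst)
  rwa [← flow_add, add_sub_cancel] at this

/-- From `exp u - 1 ≤ u exp u`. The Lipschitz bound yields absolute continuity and the extension to
a limiting endpoint. -/
lemma GrowsOn.exists_lipschitz {C T : ℝ} {J : Set ℝ} {γ : ℝ → ℝ × ℝ} (hC : 0 ≤ C)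
    (h : GrowsOn C J γ) : ∃ K, LipschitzOnWith K γ (J ∩ Icc 0 T) := by
  set M := (‖γ 0‖ + 1) * Real.exp (C * T) * (C * Real.exp (C * T))
  have hM : 0 ≤ M := by positivity
  have key : ∀ s ∈ J ∩ Icc 0 T, ∀ t ∈ J ∩ Icc 0 T, s ≤ t → dist (γ s) (γ t) ≤ M * (t - s) := by
    intro s hs t ht hst
    have h1 := h 0 le_rfl s hs.1 hs.2.1
    have h2 := h s hs.2.1 t ht.1 hst
    have h3 : ‖γ s‖ ≤ ‖γ 0‖ + dist (γ 0) (γ s) := by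
      have := norm_le_norm_add_norm_sub' (γ s) (γ 0)
      rwa [← dist_eq_norm, dist_comm] at this
    have h4 : ‖γ s‖ + 1 ≤ (‖γ 0‖ + 1) * Real.exp (C * T) := by
      have : Real.exp (C * (s - 0)) ≤ Real.exp (C * T) := by
        gcongr; linarith [hs.2.2]
      have := mul_le_mul_of_nonneg_left this (show 0 ≤ ‖γ 0‖ + 1 by positivity)
      linarith
    have h5 : Real.exp (C * (t - s)) - 1 ≤ C * Real.exp (C * T) * (t - s) := by
      have e1 := Real.add_one_le_exp (-(C * (t - s)))
      have e2 : Real.exp (C * (t - s)) ≤ Real.exp (C * T) := by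
        gcongr; linarith [hs.2.1, ht.2.2]
      have e3 : Real.exp (-(C * (t - s))) * Real.exp (C * (t - s)) = 1 := by
        rw [← Real.exp_add]; simp
      have e4 := Real.exp_pos (C * (t - s))
      have e5 : 0 ≤ C * (t - s) := mul_nonneg hC (sub_nonneg.2 hst)
      nlinarith
    calc dist (γ s) (γ t) ≤ _ := h2
      _ ≤ (‖γ 0‖ + 1) * Real.exp (C * T) * (C * Real.exp (C * T) * (t - s)) := by
        have : 0 ≤ Real.exp (C * (t - s)) - 1 := by
          have := Real.one_le_exp (mul_nonneg hC (sub_nonneg.2 hst))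
          linarith
        gcongr
      _ = M * (t - s) := by ring
  refine ⟨⟨M, hM⟩, LipschitzOnWith.of_dist_le_mul fun s hs t ht => ?_⟩
  rcases le_total s t with hst | hst
  · rw [Real.dist_eq, abs_sub_comm, abs_of_nonneg (sub_nonneg.2 hst)]
    exact key s hs t ht hst
  · rw [dist_comm, Real.dist_eq, abs_of_nonneg (sub_nonneg.2 hst)]
    exact key t ht s hs hst

/-- A growth constant for the system. -/
noncomputable def growth (p : LienardParams) : ℝ :=
  |p.TL| + |p.DL| + |p.aL| + (|p.TR| + |p.DR| + |p.aR|) + 1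

lemma growth_pos (p : LienardParams) : 0 < p.growth := by unfold growth; positivity

lemma growth_rot (p : LienardParams) : (rot p).growth = p.growth := by
  simp only [growth, rot, abs_neg]; ring

/-- A trajectory on the part in `[0, ∞)` of a lower set of times. -/
structure IsPartial (p : LienardParams) (J : Set ℝ) (γ : ℝ → ℝ × ℝ) : Prop where
  lower : IsLowerSet J
  zero_mem : 0 ∈ J
  grows : GrowsOn p.growth J γ
  ae : ∀ᵐ t, 0 < t → (∃ u ∈ J, t < u) → ∃ v ∈ p.filippov (γ t), HasDerivAt γ v t

lemma IsPartial.halfTurn {p : LienardParams} {J : Set ℝ} {γ : ℝ → ℝ × ℝ} (h : IsPartial p J γ) :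
    IsPartial (rot p) J (fun t => -γ t) := by
  refine ⟨h.lower, h.zero_mem, fun s hs t ht hst => ?_, ?_⟩
  · rw [dist_neg_neg, norm_neg, growth_rot]
    exact h.grows s hs t ht hst
  · filter_upwards [h.ae] with t ht h0 hu
    obtain ⟨v, hv, hd⟩ := ht h0 hu
    exact ⟨-v, neg_mem_filippov_rot p hv, hd.neg⟩

lemma IsPartial.mem_forwardTrajectories {p : LienardParams} {γ : ℝ → ℝ × ℝ}
    (h : IsPartial p univ γ) : γ ∈ p.forwardTrajectories := by
  refine ⟨fun a ha b hb => ?_, ?_⟩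
  · obtain ⟨K, hK⟩ := h.grows.exists_lipschitz (T := max a b) p.growth_pos.le
    refine (hK.mono fun t ht => ⟨mem_univ _, ?_, ht.2⟩).absolutelyContinuousOnInterval
    exact (le_min ha hb).trans ht.1
  · rw [ae_restrict_iff' measurableSet_Ici]
    have h0 : ∀ᵐ s : ℝ, s ∉ ({0} : Set ℝ) := measure_eq_zero_iff_ae_notMem.1 (by simp)
    filter_upwards [h.ae, h0] with t ht ht0 ht1
    exact ht (lt_of_le_of_ne ht1 (Ne.symm ht0)) ⟨t + 1, mem_univ _, by linarith⟩

lemma isPartial_flow {p : LienardParams} {z : ℝ × ℝ} {δ : ℝ} (hδ : 0 < δ)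
    (hneg : ∀ t ∈ Ioo 0 δ, (flow p.TL p.DL p.aL t z).1 < 0) :
    IsPartial p (Iic δ) (fun t => flow p.TL p.DL p.aL t z) := by
  refine ⟨isLowerSet_Iic δ, hδ.le, growsOn_flow ?_ _ z, Eventually.of_forall ?_⟩
  · unfold growth
    have hT := abs_nonneg p.TR
    have hD := abs_nonneg p.DR
    have ha := abs_nonneg p.aR
    linarith
  · rintro t ht ⟨u, hu, htu⟩
    exact ⟨_, Or.inl ⟨hneg t ⟨ht, htu.trans_le hu⟩, rfl⟩, hasDerivAt_flow p.TL p.DL p.aL t z⟩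

lemma exists_isPartial_left {p : LienardParams} {z : ℝ × ℝ}
    (h : EntersLeft z ∨ (z = 0 ∧ p.aL < 0)) :
    ∃ δ > 0, ∃ γ, γ 0 = z ∧ IsPartial p (Iic δ) γ := by
  rcases h with h | ⟨rfl, h⟩
  · obtain ⟨δ, hδ, hz⟩ := h.exists_neg (T := p.TL) (D := p.DL) (a := p.aL)
    exact ⟨δ, hδ, _, flow_zero _ _ _ _,
      isPartial_flow hδ fun t ht => hz.self_of_nhds h t ⟨ht.1, ht.2.le⟩⟩
  · obtain ⟨δ, hδ, hP⟩ := mem_nhdsGT_iff_exists_Ioc_subset.1 (fP_eventually_pos p.TL p.DL)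
    refine ⟨δ, hδ, _, flow_zero _ _ _ _, isPartial_flow hδ fun t ht => ?_⟩
    have : 0 < fP p.TL p.DL t := hP ⟨ht.1, ht.2.le⟩
    simp only [flow, Prod.fst_zero, Prod.snd_zero]
    nlinarith

lemma exists_isPartial (p : LienardParams) (z : ℝ × ℝ) :
    ∃ δ > 0, ∃ γ, γ 0 = z ∧ IsPartial p (Iic δ) γ := by
  have hright : (EntersLeft (-z) ∨ (z = 0 ∧ 0 < p.aR)) →
      ∃ δ > 0, ∃ γ, γ 0 = z ∧ IsPartial p (Iic δ) γ := fun h => by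
    obtain ⟨δ, hδ, γ, h0, hγ⟩ := exists_isPartial_left (p := rot p) (z := -z)
      (h.imp_right fun h => ⟨by simp [h.1], by simpa [rot] using h.2⟩)
    have := hγ.halfTurn
    rw [rot_rot] at this
    exact ⟨δ, hδ, _, by simp [h0], this⟩
  rcases lt_trichotomy z.1 0 with hz | hz | hz
  · exact exists_isPartial_left (Or.inl (Or.inl hz))
  · rcases lt_trichotomy z.2 0 with hz2 | hz2 | hz2
    · exact hright (Or.inl (Or.inr ⟨by simp [hz], by simpa using hz2⟩))
    · have hz0 : z = 0 := Prod.ext hz hz2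
      rcases lt_or_ge p.aL 0 with hl | hl
      · exact exists_isPartial_left (Or.inr ⟨hz0, hl⟩)
      rcases lt_or_ge 0 p.aR with hr | hr
      · exact hright (Or.inr ⟨hz0, hr⟩)
      -- Here `aR ≤ 0 ≤ aL`, so `0` lies between the velocities `(0, -aL)` and `(0, -aR)`, and
      -- resting at the origin is allowed.
      refine ⟨1, one_pos, fun _ => z, rfl, isLowerSet_Iic _, mem_Iic.2 zero_le_one, fun s _ t _ hst => ?_,
        Eventually.of_forall fun t _ _ => ⟨0, Or.inr (Or.inr ⟨hz, ?_⟩), hasDerivAt_const t z⟩⟩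
      · rw [dist_self]
        have := Real.one_le_exp (mul_nonneg p.growth_pos.le (sub_nonneg.2 hst))
        exact mul_nonneg (by positivity) (by linarith)
      · subst hz0
        rcases eq_or_lt_of_le hl with h0 | h0
        · refine ⟨1, 0, zero_le_one, le_rfl, add_zero 1, ?_⟩
          simp [leftField, ← h0]
        · refine ⟨-p.aR / (p.aL - p.aR), p.aL / (p.aL - p.aR), div_nonneg (by linarith) (by linarith),
            div_nonneg hl (by linarith), ?_, ?_⟩
          · field_simp [show p.aL - p.aR ≠ 0 by linarith]
            ring
          · simp [leftField, rightField]
            ring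
    · exact exists_isPartial_left (Or.inl (Or.inr ⟨hz, hz2⟩))
  · exact hright (Or.inl (Or.inl (by simpa using hz)))

/-- The growth bound survives concatenation because it says `‖γ T‖ + 1 ≤ (‖γ s‖ + 1) exp (C (T -
s))`, and exponentials multiply. -/
lemma IsPartial.extend {p : LienardParams} {T : ℝ} {γ : ℝ → ℝ × ℝ} (h : IsPartial p (Iic T) γ) :
    ∃ T' > T, ∃ γ', EqOn γ γ' (Iic T) ∧ IsPartial p (Iic T') γ' := by
  obtain ⟨δ, hδ, g, hg0, hg⟩ := exists_isPartial p (γ T)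
  have hT : 0 ≤ T := h.zero_mem
  set γ' : ℝ → ℝ × ℝ := fun t => if t ≤ T then γ t else g (t - T)
  have h1 : ∀ t ≤ T, γ' t = γ t := fun t ht => if_pos ht
  have h2 : ∀ t ≥ T, γ' t = g (t - T) := fun t ht => by
    rcases eq_or_lt_of_le ht with rfl | ht
    · rw [h1 _ le_rfl, sub_self, hg0]
    · exact if_neg (not_le.2 ht)
  refine ⟨T + δ, by linarith, γ', fun t ht => (h1 t ht).symm, isLowerSet_Iic _, by
    show 0 ≤ T + δ; linarith, fun s hs t ht hst => ?_, ?_⟩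
  · have ht : t ≤ T + δ := ht
    rcases le_total t T with htT | htT
    · rw [h1 t htT, h1 s (hst.trans htT)]
      exact h.grows s hs t htT hst
    rcases le_total T s with hsT | hsT
    · rw [h2 t htT, h2 s hsT]
      have := hg.grows (s - T) (by linarith) (t - T) (show t - T ≤ δ by linarith) (by linarith)
      rwa [sub_sub_sub_cancel_right] at this
    · rw [h2 t htT, h1 s hsT]
      have e1 := h.grows s hs T (mem_Iic.2 le_rfl) hsT
      have e2 := hg.grows 0 le_rfl (t - T) (show t - T ≤ δ by linarith) (by linarith)
      rw [hg0, sub_zero] at e2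
      have e3 : ‖γ T‖ ≤ ‖γ s‖ + dist (γ s) (γ T) := by
        have := norm_le_norm_add_norm_sub' (γ T) (γ s)
        rwa [← dist_eq_norm, dist_comm] at this
      have e4 := dist_triangle (γ s) (γ T) (g (t - T))
      have e5 : Real.exp (p.growth * (t - s)) =
          Real.exp (p.growth * (T - s)) * Real.exp (p.growth * (t - T)) := by
        rw [← Real.exp_add]; ring_nf
      have e6 : 1 ≤ Real.exp (p.growth * (t - T)) :=
        Real.one_le_exp (mul_nonneg p.growth_pos.le (sub_nonneg.2 htT))
      rw [e5]
      have e7 : ‖γ T‖ + 1 ≤ (‖γ s‖ + 1) * Real.exp (p.growth * (T - s)) := by linarith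
      have e8 := mul_le_mul_of_nonneg_right e7 (sub_nonneg.2 e6)
      linarith
  · have h0 : ∀ᵐ s : ℝ, s ∉ ({T} : Set ℝ) := measure_eq_zero_iff_ae_notMem.1 (by simp)
    have hsh := (measurePreserving_sub_right volume T).quasiMeasurePreserving.ae hg.ae
    filter_upwards [h.ae, h0, hsh] with t ht htT hgt h0t ⟨u, hu, htu⟩
    rcases lt_or_gt_of_ne (show t ≠ T from htT) with hlt | hlt
    · obtain ⟨v, hv, hd⟩ := ht h0t ⟨T, mem_Iic.2 le_rfl, hlt⟩
      refine ⟨v, by rwa [h1 t hlt.le], hd.congr_of_eventuallyEq ?_⟩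
      filter_upwards [Iio_mem_nhds hlt] with s hs using h1 s (le_of_lt hs)
    · obtain ⟨v, hv, hd⟩ := hgt (sub_pos.2 hlt) ⟨u - T, by
        have hu : u ≤ T + δ := hu
        show u - T ≤ δ
        linarith, by linarith⟩
      refine ⟨v, by rwa [h2 t hlt.le], (hd.comp_sub_const t T).congr_of_eventuallyEq ?_⟩
      filter_upwards [Ioi_mem_nhds hlt] with s hs using h2 s (le_of_lt hs)

lemma IsPartial.closure {p : LienardParams} {J : Set ℝ} {γ : ℝ → ℝ × ℝ} (h : IsPartial p J γ)
    {T : ℝ} (hT : IsLUB J T) : ∃ γ', EqOn γ γ' (J ∩ Ici 0) ∧ IsPartial p (Iic T) γ' := by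
  obtain ⟨K, hK⟩ := h.grows.exists_lipschitz (T := T) p.growth_pos.le
  obtain ⟨g, hg, heq⟩ := hK.extend_finite_dimension
  have hlt : ∀ t < T, t ∈ J := fun t ht => by
    obtain ⟨u, hu, htu, -⟩ := hT.exists_between ht
    exact h.lower htu.le hu
  have hJ : ∀ t ∈ J, 0 ≤ t → γ t = g t := fun t ht h0 => heq ⟨ht, h0, hT.1 ht⟩
  have hT0 : 0 ≤ T := hT.1 h.zero_mem
  refine ⟨g, fun t ht => hJ t ht.1 ht.2, isLowerSet_Iic _, hT0, fun s hs t ht hst => ?_, ?_⟩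
  · have ht : t ≤ T := ht
    rcases eq_or_lt_of_le hst with rfl | hst'
    · simp
    have hsJ : s ∈ J := hlt s (by linarith)
    have hev : ∀ᶠ u in 𝓝[<] t, dist (g s) (g u) ≤ (‖g s‖ + 1) * (Real.exp (p.growth * (u - s)) - 1) := by
      filter_upwards [Ioo_mem_nhdsLT hst'] with u hu
      have huJ : u ∈ J := hlt u (by linarith [hu.2])
      rw [← hJ s hsJ hs, ← hJ u huJ (by linarith [hu.1])]
      exact h.grows s hs u huJ hu.1.le
    refine le_of_tendsto_of_tendsto ?_ ?_ hev
    · exact ((continuous_const.dist hg.continuous).continuousAt.tendsto).mono_left nhdsWithin_le_nhds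
    · have : Continuous fun u => (‖g s‖ + 1) * (Real.exp (p.growth * (u - s)) - 1) := by fun_prop
      exact this.continuousAt.tendsto.mono_left nhdsWithin_le_nhds
  · filter_upwards [h.ae] with t ht h0 ⟨u, hu, htu⟩
    have htT : t < T := htu.trans_le hu
    obtain ⟨w, hw, htw, -⟩ := hT.exists_between htT
    obtain ⟨v, hv, hd⟩ := ht h0 ⟨w, hw, htw⟩
    refine ⟨v, by rwa [← hJ t (hlt t htT) h0.le], hd.congr_of_eventuallyEq ?_⟩
    filter_upwards [Ioo_mem_nhds h0 htT] with s hs using (hJ s (hlt s hs.2) hs.1.le).symm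

lemma isPartial_of_chain {p : LienardParams} {c : Set (Set ℝ × (ℝ → ℝ × ℝ))} (hne : c.Nonempty)
    (hp : ∀ x ∈ c, IsPartial p x.1 x.2)
    (hc : ∀ x ∈ c, ∀ y ∈ c, ∀ t ∈ x.1, t ∈ y.1 → 0 ≤ t → x.2 t = y.2 t) :
    ∃ γ, (∀ x ∈ c, EqOn x.2 γ (x.1 ∩ Ici 0)) ∧ IsPartial p (⋃ x ∈ c, x.1) γ := by
  classical
  set γ : ℝ → ℝ × ℝ := fun t => if h : ∃ x ∈ c, t ∈ x.1 then h.choose.2 t else 0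
  have hγ : ∀ x ∈ c, ∀ t ∈ x.1, 0 ≤ t → x.2 t = γ t := fun x hx t ht h0 => by
    have h : ∃ x ∈ c, t ∈ x.1 := ⟨x, hx, ht⟩
    simp only [γ, dif_pos h]
    exact hc x hx _ h.choose_spec.1 t ht h.choose_spec.2 h0
  refine ⟨γ, fun x hx t ht => hγ x hx t ht.1 ht.2,
    isLowerSet_iUnion₂ fun x hx => (hp x hx).lower, ?_, fun s hs t ht hst => ?_, ?_⟩
  · obtain ⟨x, hx⟩ := hne
    exact mem_iUnion₂.2 ⟨x, hx, (hp x hx).zero_mem⟩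
  · obtain ⟨x, hx, htx⟩ := mem_iUnion₂.1 ht
    rw [← hγ x hx t htx (hs.trans hst), ← hγ x hx s ((hp x hx).lower hst htx) hs]
    exact (hp x hx).grows s hs t htx hst
  -- The chain may be uncountable, so exceptional sets cannot simply be united; locally, one member
  -- of the chain decides.
  · refine measure_null_of_locally_null _ fun t ht => ?_
    simp only [mem_compl_iff, mem_ofPred_eq, Classical.not_imp] at ht
    obtain ⟨h0, ⟨u, hu, htu⟩, -⟩ := ht
    obtain ⟨x, hx, hux⟩ := mem_iUnion₂.1 hu
    refine ⟨_, inter_mem_nhdsWithin _ (Iio_mem_nhds htu), measure_mono_null ?_ (hp x hx).ae⟩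
    rintro s ⟨hs, hsu⟩
    have hsu : s < u := hsu
    simp only [mem_compl_iff, mem_ofPred_eq, Classical.not_imp] at hs ⊢
    obtain ⟨hs0, -, hs⟩ := hs
    refine ⟨hs0, ⟨u, hux, hsu⟩, fun ⟨v, hv, hd⟩ => hs ⟨v, ?_, hd.congr_of_eventuallyEq ?_⟩⟩
    · rwa [← hγ x hx s ((hp x hx).lower hsu.le hux) hs0.le]
    · filter_upwards [Ioo_mem_nhds hs0 hsu] with r hr
      exact (hγ x hx r ((hp x hx).lower hr.2.le hux) hr.1.le).symm

/-- A maximal partial trajectory with bounded domain could be continued to the supremum by the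
Lipschitz bound, and then beyond it. -/
theorem exists_forwardTrajectory (p : LienardParams) (z : ℝ × ℝ) :
    ∃ γ ∈ p.forwardTrajectories, γ 0 = z := by
  set α := {x : Set ℝ × (ℝ → ℝ × ℝ) // IsPartial p x.1 x.2 ∧ x.2 0 = z}
  set r : α → α → Prop := fun x y => x.1.1 ⊆ y.1.1 ∧ EqOn x.1.2 y.1.2 (x.1.1 ∩ Ici 0)
  obtain ⟨δ, -, γ₀, h0, hγ₀⟩ := exists_isPartial p z
  have : Nonempty α := ⟨⟨(Iic δ, γ₀), hγ₀, h0⟩⟩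
  obtain ⟨⟨⟨J, γ⟩, hγ, hγ0⟩, hmax⟩ := exists_maximal_of_nonempty_chains_bounded (r := r)
    (fun c hc hne => by
      obtain ⟨g, hg, hgp⟩ := isPartial_of_chain (p := p) (c := Subtype.val '' c) (hne.image _)
        (by rintro _ ⟨x, -, rfl⟩; exact x.2.1)
        (by
          rintro _ ⟨x, hx, rfl⟩ _ ⟨y, hy, rfl⟩ t htx hty h0
          rcases eq_or_ne x y with rfl | hxy
          · rfl
          · rcases hc hx hy hxy with h | h
            · exact h.2 ⟨htx, h0⟩
            · exact (h.2 ⟨hty, h0⟩).symm)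
      refine ⟨⟨(_, g), hgp, ?_⟩, fun x hx => ⟨?_, hg _ ⟨x, hx, rfl⟩⟩⟩
      · obtain ⟨x, hx⟩ := hne
        exact (hg _ ⟨x, hx, rfl⟩ ⟨x.2.1.zero_mem, mem_Ici.2 le_rfl⟩).symm.trans x.2.2
      · exact subset_biUnion_of_mem (u := fun x : Set ℝ × (ℝ → ℝ × ℝ) => x.1) ⟨x, hx, rfl⟩)
    (fun {x y w} hxy hyw => ⟨hxy.1.trans hyw.1, fun t ht =>
      (hxy.2 ht).trans (hyw.2 ⟨hxy.1 ht.1, ht.2⟩)⟩)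
  simp only at hγ hγ0
  by_cases hJ : J = univ
  · rw [hJ] at hγ
    exact ⟨γ, hγ.mem_forwardTrajectories, hγ0⟩
  exfalso
  obtain ⟨u, hu⟩ := (ne_univ_iff_exists_notMem J).1 hJ
  have hbdd : BddAbove J := ⟨u, fun t ht => by
    by_contra hlt
    exact hu (hγ.lower (not_le.1 hlt).le ht)⟩
  have hlub := isLUB_csSup ⟨0, hγ.zero_mem⟩ hbdd
  obtain ⟨g, hg, hgp⟩ := hγ.closure hlub
  obtain ⟨T', hT', g', hg', hgp'⟩ := hgp.extend
  have heq : EqOn γ g' (J ∩ Ici 0) := fun t ht => (hg ht).trans (hg' (hlub.1 ht.1))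
  have := (hmax ⟨(Iic T', g'), hgp', (heq ⟨hγ.zero_mem, mem_Ici.2 le_rfl⟩).symm.trans hγ0⟩
    ⟨fun t ht => (hlub.1 ht).trans hT'.le, heq⟩).1
  exact absurd (hlub.1 (this (mem_Iic.2 le_rfl))) (not_le.2 hT')

end LienardParams

namespace LienardParams

/-! ### Repelling loops -/

lemma conj_conj (z : ℝ × ℝ) : conj (conj z) = z := by simp [conj]

lemma continuous_conj : Continuous conj := conjL.continuous

lemma isometry_conj : Isometry conj :=
  Isometry.of_dist_eq fun z w => by simp [conj, Prod.dist_eq]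

lemma Loop.revp {p : LienardParams} {y₀ y₁ τL τR : ℝ} (h : Loop p y₀ y₁ τL τR) :
    Loop (revp p) (-y₁) (-y₀) τL τR :=
  ⟨neg_pos.2 h.y₁_neg, neg_neg_of_pos h.y₀_pos, h.left.rev, h.right.rev⟩

lemma Loop.rot_revp {p : LienardParams} {y₀ y₁ τL τR : ℝ} (h : Loop p y₀ y₁ τL τR) :
    Loop (rot (LienardParams.revp p)) y₀ y₁ τR τL :=
  ⟨h.y₀_pos, h.y₁_neg, h.right, by simpa [rot, LienardParams.revp] using h.left⟩

lemma Turn.of_rot_revp {p : LienardParams} {y₀ y₁ y₂ τL τR : ℝ}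
    (h : Turn (rot (revp p)) y₀ y₁ y₂ τL τR) (hy₂ : 0 < y₂) : Turn p y₂ y₁ y₀ τR τL :=
  ⟨hy₂, h.y₁_neg, by simpa [rot, revp] using h.right.rev, by simpa [rot, revp] using h.left.rev⟩

lemma LeftArc.image_rev {T D a y₀ y₁ τ : ℝ} (h : LeftArc T D a y₀ y₁ τ) :
    (fun t => flow (-T) D a t (0, -y₁)) '' Icc 0 τ =
      conj '' ((fun t => flow T D a t (0, y₀)) '' Icc 0 τ) := by
  have e : ∀ t, flow (-T) D a t (0, -y₁) = conj (flow T D a (τ - t) (0, y₀)) := fun t => by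
    have h1 := flow_conj T D a t (0, y₁)
    rw [← h.land, ← flow_add, h.land] at h1
    exact h1
  have hfun : (fun t => flow (-T) D a t (0, -y₁)) =
      conj ∘ (fun t => flow T D a t (0, y₀)) ∘ fun t => τ - t := funext e
  rw [hfun, image_comp, image_comp, image_const_sub_Icc, sub_self, sub_zero]

lemma Loop.turnSet_revp {p : LienardParams} {y₀ y₁ τL τR : ℝ} (h : Loop p y₀ y₁ τL τR) :
    turnSet (LienardParams.revp p) (-y₁) (-y₀) τL τR = conj '' turnSet p y₀ y₁ τL τR := by
  have hneg : ∀ (F : ℝ → ℝ × ℝ) (s : Set ℝ), (fun t => -F t) '' s = Neg.neg '' (F '' s) :=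
    fun F s => by rw [image_image]
  rw [turnSet, turnSet, image_union, hneg, hneg]
  have h1 := h.left.image_rev
  have h2 := h.turn.right.image_rev
  simp only [LienardParams.revp] at h1 h2 ⊢
  rw [h1, h2, image_image (f := conj) (g := Neg.neg), image_image (f := Neg.neg) (g := conj)]
  congr 2

lemma conj_mem_forwardTrajectories {p : LienardParams} {γ : ℝ → ℝ × ℝ}
    (hγ : γ ∈ p.backwardTrajectories) : (fun t => conj (γ t)) ∈ (revp p).forwardTrajectories := by
  have := IsTrajectoryOn.timeReversal hγ measurableSet_Iic (measurableSet_Ici (a := (0 : ℝ))) 0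
    fun t ht => by simpa using ht
  simp only [neg_sub, sub_zero] at this
  exact this

/-- The conjugation is an isometric involution taking backward trajectories to forward trajectories
of the reversed system. -/
lemma isRepelling_of_revp {p : LienardParams} {Γ : Set (ℝ × ℝ)}
    (h : (revp p).IsAsymptoticallyStable (conj '' Γ)) : p.IsRepelling Γ := by
  have hsub : ∀ {U : Set (ℝ × ℝ)}, conj '' Γ ⊆ U → Γ ⊆ conj ⁻¹' U := fun h => image_subset_iff.1 h
  refine ⟨fun U hU hΓ => ?_, ?_⟩
  · obtain ⟨V, hV, hΓV, hst⟩ := h.1 (conj ⁻¹' U) (hU.preimage continuous_conj) (by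
      rintro _ ⟨z, hz, rfl⟩
      simpa [conj_conj] using hΓ hz)
    refine ⟨conj ⁻¹' V, hV.preimage continuous_conj, hsub hΓV, fun γ hγ h0 t ht => ?_⟩
    simpa [conj_conj] using hst _ (conj_mem_forwardTrajectories hγ) h0 t ht
  · obtain ⟨V, hV, hΓV, hst⟩ := h.2
    refine ⟨conj ⁻¹' V, hV.preimage continuous_conj, hsub hΓV, fun γ hγ h0 => ?_⟩
    simpa only [Metric.infDist_image isometry_conj] using
      hst _ (conj_mem_forwardTrajectories hγ) h0

theorem Loop.isRepelling {p : LienardParams} {y₀ y₁ τL τR : ℝ} (h : Loop p y₀ y₁ τL τR)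
    (hpos : 0 < p.TL * τL + p.TR * τR) : p.IsRepelling (turnSet p y₀ y₁ τL τR) := by
  refine isRepelling_of_revp ?_
  rw [← h.turnSet_revp]
  refine h.revp.isAsymptoticallyStable ?_
  simp only [LienardParams.revp]
  linarith

/-- Iterating the contracting return map of the reversed system from a point `w` off the loop gives
points tending to `(0, y₀)`. Every forward trajectory from any of them passes through `w`, so the
complement of `w` is a neighbourhood that violates stability. -/
theorem Loop.isUnstable {p : LienardParams} {y₀ y₁ τL τR : ℝ} (h : Loop p y₀ y₁ τL τR)
    (hpos : 0 < p.TL * τL + p.TR * τR) : p.IsUnstable (turnSet p y₀ y₁ τL τR) := by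
  intro hst
  obtain ⟨k, f, P, hk, hk1, -, hturn⟩ := h.rot_revp.exists_turns (by
    simp only [rot, LienardParams.revp]; linarith)
  obtain ⟨ε, hε, hball⟩ := Metric.eventually_nhds_iff.1 (hturn.and (lt_mem_nhds h.y₀_pos))
  set w : ℝ × ℝ := (0, y₀ + ε / 2)
  have hw : w ∉ turnSet p y₀ y₁ τL τR := fun hw => by
    rcases h.turn.turnSet_section hw with h' | h' | h' <;> linarith [h.y₀_pos, h.y₁_neg]
  obtain ⟨V, hV, hΓV, hVU⟩ := hst {w}ᶜ isOpen_compl_singleton (subset_compl_singleton_iff.2 hw)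
  have key : ∀ n : ℕ, ∃ y, |y - y₀| ≤ k ^ n * (ε / 2) ∧
      ∀ γ ∈ p.forwardTrajectories, γ 0 = (0, y) → ∃ t ≥ 0, γ t = w := fun n => by
    induction n with
    | zero =>
      refine ⟨y₀ + ε / 2, ?_, fun γ _ h0 => ⟨0, le_rfl, h0⟩⟩
      rw [add_sub_cancel_left, abs_of_pos (by linarith), pow_zero, one_mul]
    | succ n ih =>
      obtain ⟨y, hy, hyw⟩ := ih
      have hkn : k ^ n ≤ 1 := pow_le_one₀ hk.le hk1.le
      obtain ⟨⟨h1, σL, σR, ht⟩, -⟩ := hball (y := y) (lt_of_le_of_lt hy (by nlinarith))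
      have hle : |P y - y₀| ≤ k ^ (n + 1) * (ε / 2) := by
        rw [pow_succ]; nlinarith
      have hlt : k ^ (n + 1) * (ε / 2) < ε := by
        have : k ^ (n + 1) ≤ 1 := pow_le_one₀ hk.le hk1.le
        nlinarith
      have hpos' := (hball (y := P y) (lt_of_le_of_lt hle hlt)).2
      have ht' := ht.of_rot_revp hpos'
      refine ⟨P y, hle, fun γ hγ h0 => ?_⟩
      have hσ : 0 ≤ 0 + σR + σL := by linarith [ht'.left.pos, ht'.right.pos]
      have h2 := (ht'.follow hγ measurableSet_Ici (a := 0) (fun t ht => ht.1) h0).2.2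
      obtain ⟨t, ht0, htw⟩ := hyw _ (shift_mem_forwardTrajectories hγ hσ) (by simpa using h2)
      exact ⟨t + (0 + σR + σL), by linarith, htw⟩
  obtain ⟨r, hr0, hrV⟩ := Metric.isOpen_iff.1 hV _ (hΓV h.mem_left)
  have hlim : Tendsto (fun n : ℕ => k ^ n * (ε / 2)) atTop (𝓝 (0 * (ε / 2))) :=
    (tendsto_pow_atTop_nhds_zero_of_lt_one hk.le hk1).mul_const _
  rw [zero_mul] at hlim
  obtain ⟨n, hn⟩ := (hlim.eventually (gt_mem_nhds hr0)).exists
  obtain ⟨y, hy, hyw⟩ := key n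
  -- Without existence, stability could hold vacuously.
  obtain ⟨γ, hγ, h0⟩ := exists_forwardTrajectory p (0, y)
  obtain ⟨t, ht, htw⟩ := hyw γ hγ h0
  refine hVU γ hγ ?_ t ht htw
  rw [h0]
  refine hrV ?_
  rw [Metric.mem_ball, Prod.dist_eq]
  exact max_lt (by simpa using hr0) (by rw [Real.dist_eq]; exact lt_of_le_of_lt hy hn)

/-! ### Hyperbolic limit cycles are loops -/

/-- The interior of the domain excludes `y₀ = 0`, and `ξ = 0` would make the derivative of `δ` at
the loop vanish. -/
lemma IsHyperbolicLimitCycle.exists_loop {p : LienardParams} {Γ : Set (ℝ × ℝ)}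
    (h : p.IsHyperbolicLimitCycle Γ) :
    p.xi ≠ 0 ∧ ∃ y₀ y₁ τL τR, Loop p y₀ y₁ τL τR ∧ Γ = turnSet p y₀ y₁ τL τR := by
  obtain ⟨⟨hcl, hcr, -⟩, y₀, hint, hmem, d, hd, hd0⟩ := h
  have hy₀ : 0 < y₀ := by
    have : y₀ ∈ interior (Ici (0 : ℝ)) := interior_mono (fun y hy => hy.1.1) hint
    rwa [interior_Ici] at this
  obtain ⟨y₁, τL, τR, hloop, hΓ⟩ := hcl.exists_loop hcr hy₀ hmem
  refine ⟨fun hξ => hd0 ?_, y₀, y₁, τL, τR, hloop, hΓ⟩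
  have hs := hloop.sign_deriv
  rw [hξ, sign_zero, sign_eq_zero_iff] at hs
  rw [← hs]
  exact hd.unique hloop.hasDerivAt_displacement

end LienardParams

theorem mainTheorem2 (p : LienardParams) :
    (∀ Γ₁ Γ₂ : Set (ℝ × ℝ), p.IsHyperbolicLimitCycle Γ₁ → p.IsHyperbolicLimitCycle Γ₂ → Γ₁ = Γ₂) ∧
      ∀ Γ : Set (ℝ × ℝ), p.IsHyperbolicLimitCycle Γ →
        p.xi ≠ 0 ∧ (p.xi < 0 → p.IsAsymptoticallyStable Γ) ∧
          (0 < p.xi → p.IsUnstable Γ ∧ p.IsRepelling Γ) := by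
  refine ⟨fun Γ₁ Γ₂ h₁ h₂ => ?_, fun Γ hΓ => ?_⟩
  · obtain ⟨hξ, y, y₁, τL, τR, h, rfl⟩ := h₁.exists_loop
    obtain ⟨-, z, z₁, σL, σR, h', rfl⟩ := h₂.exists_loop
    obtain rfl := LienardParams.Loop.eq hξ h h'
    obtain ⟨rfl, rfl⟩ := h.left.unique h'.left
    obtain ⟨rfl, -⟩ := h.right.unique h'.right
    rfl
  · obtain ⟨hξ, y₀, y₁, τL, τR, h, rfl⟩ := hΓ.exists_loop
    refine ⟨hξ, fun hneg => h.isAsymptoticallyStable ?_, fun hpos => ?_⟩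
    · rw [← sign_eq_neg_one_iff, h.sign_eq, sign_eq_neg_one_iff]; exact hneg
    · have : 0 < p.TL * τL + p.TR * τR := by
        rw [← sign_eq_one_iff, h.sign_eq, sign_eq_one_iff]; exact hpos
      exact ⟨h.isUnstable this, h.isRepelling this⟩
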